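/- Let $\Lambda$ be a finite set, let $\beta=(\beta_{ij})_{i,j\in\Lambda}$ be symmetric edge weights with $\beta_{ij}\ge 0$, and let $h=(h_i)_{i\in\Lambda}$ with $h_i\ge0$. Assume that $\beta$ is irreducible, i.e. the graph on $\Lambda$ with edges $\{ij : i\ne j,\ \beta_{ij}\neq0\}$ is connected, and that $h_i>0$ for at least one $i$. **The $\mathbb H^{2|4}$ model.** For $(x,y)\in\mathbb R^{2\Lambda}$ and anticommuting Grassmann generators $\xi_i^\gamma,\eta_i^\gamma$ ($i\in\Lambda$, $\gamma=1,2$), put $$z_i=\sqrt{1+x_i^2+y_i^2-2\xi_i^1\eta_i^1-2\xi_i^2\eta_i^2},\qquad u_i\cdot u_j=x_ix_j+y_iy_j+\sum_{\gamma=1}^2(\eta_i^\gamma\xi_j^\gamma-\xi_i^\gamma\eta_j^\gamma)-z_iz_j,$$ $$H_{\beta,h}=\frac12\sum_{i,j\in\Lambda}\beta_{ij}(u_i\cdot u_i-u_i\cdot u_j)+\sum_{i\in\Lambda}h_i(z_i-1),$$ where smooth functions of even forms are defined by Taylor expansion in the nilpotent parts. For a form $G$ let $$[G]^{\mathbb H^{2|4}}_{\beta,h}=\int_{\mathbb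 R^{2\Lambda}}\prod_{i}\frac{dx_i\,dy_i}{2\pi}\;\prod_i\partial_{\eta_i^1}\partial_{\xi_i^1}\partial_{\eta_i^2}\partial_{\xi_i^2}\Big(\prod_i\frac1{z_i}\;G\,e^{-H_{\beta,h}}\Big);$$ this integral is said to converge absolutely if the real-valued function on $\mathbb R^{2\Lambda}$ that remains after the fermionic derivatives is Lebesgue integrable. **Horospherical densities.** Let $-\Delta_{\beta(t),h(t)}$ be the $\Lambda\times\Lambda$ matrix with entries $-\beta_{ij}e^{t_i+t_j}$ for $i\ne j$ and diagonal entries $\sum_{j\neq i}\beta_{ij}e^{t_i+t_j}+h_ie^{t_i}$. With $\sum_{ij}$ denoting the sum over unordered pairs $\{i,j\}$ of distinct vertices, let $$\tilde H_{\beta,h}(t,s)=\sum_{ij}\beta_{ij}\Big(\cosh(t_i-t_j)+\tfrac12e^{t_i+t_j}(s_i-s_j)^2-1\Big)+\sum_ih_i\Big(\cosh t_i+\tfrac12e^{t_i}s_i^2-1\Big)-2\log\det(-\Delta_{\beta(t),h(t)})+3\sum_it_i,$$ $$\tilde H_{\beta,h}(t)=\sum_{ij}\beta_{ij}(\cosh(t_i-t_j)-1)+\sum_ih_i(\cosh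 t_i-1)-\tfrac32\log\det(-\Delta_{\beta(t),h(t)})+3\sum_it_i.$$ **Claim.** 1. For every smooth $F\colon\mathbb R^{2\Lambda}\to\mathbb R$ such that the integrals on both sides converge absolutely, $$[F((x_i+z_i)_i,(y_i)_i)]^{\mathbb H^{2|4}}_{\beta,h}=\int_{\mathbb R^{2\Lambda}}F((e^{t_i})_i,(e^{t_i}s_i)_i)\,e^{-\tilde H_{\beta,h}(t,s)}\prod_i\frac{dt_i\,ds_i}{2\pi}.$$ 2. For every smooth $F\colon\mathbb R^{\Lambda}\to\mathbb R$ such that the integrals on both sides converge absolutely, $$[F((x_i+z_i)_i)]^{\mathbb H^{2|4}}_{\beta,h}=\int_{\mathbb R^{\Lambda}}F((e^{t_i})_i)\,e^{-\tilde H_{\beta,h}(t)}\prod_i\frac{dt_i}{\sqrt{2\pi}}.$$ 3. In particular, the integral defining $[1]^{\mathbb H^{2|4}}_{\beta,h}$ converges absolutely, and $[1]^{\mathbb H^{2|4}}_{\beta,h}$ equals the partition function of the arboreal gas, $$[1]^{\mathbb H^{2|4}}_{\beta,h}=Z_{\beta,h}:=\sum_{F}\ \prod_{ij\in F}\beta_{ij}\prod_{T\in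 F}\Big(1+\sum_{i\in T}h_i\Big),$$ where $F$ runs over all spanning forests (acyclic edge subsets) of the graph of $\beta$ and $T$ over the trees of $F$ (isolated vertices included). -/

import Mathlib

open scoped ContDiff

namespace HoroH24

noncomputable section

/-! ### The Grassmann algebra with generators `ξ_i^γ, η_i^γ`, `i ∈ Λ`, `γ ∈ {1, 2}` -/

/-- Index set of the `4|Λ|` generators: `Sum.inl (i, γ)` labels `ξ_i^γ` and `Sum.inr (i, γ)`
labels `η_i^γ`. -/
abbrev Gen (Λ : Type*) : Type _ := (Λ × Fin 2) ⊕ (Λ × Fin 2)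

/-- The real Grassmann algebra on the generators. A form on `ℝ^{2Λ}`, i.e. an element of the
Grassmann algebra over functions on `ℝ^{2Λ}`, is represented by its pointwise values, hence as a
function from `ℝ^{2Λ}` to this algebra. -/
abbrev Grass (Λ : Type*) : Type _ := ExteriorAlgebra ℝ (Gen Λ → ℝ)

variable {Λ : Type*}

/-- The fermionic derivative with respect to the generator `g`: the odd derivation which sends the
generator `g` to `1` and the other generators to `0`. -/
def fermiD (g : Gen Λ) : Module.End ℝ (Grass Λ) :=
  CliffordAlgebra.contractLeft (Q := (0 : QuadraticForm ℝ (Gen Λ → ℝ)))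
    (LinearMap.proj g : (Gen Λ → ℝ) →ₗ[ℝ] ℝ)

/-- `∂_{η_i^1} ∂_{ξ_i^1} ∂_{η_i^2} ∂_{ξ_i^2}`. -/
def fermiDAt (i : Λ) : Module.End ℝ (Grass Λ) :=
  fermiD (Sum.inr (i, 0)) * fermiD (Sum.inl (i, 0)) *
    (fermiD (Sum.inr (i, 1)) * fermiD (Sum.inl (i, 1)))

theorem fermiD_anticomm (g g' : Gen Λ) (a : Grass Λ) :
    fermiD g (fermiD g' a) = -fermiD g' (fermiD g a) :=
  CliffordAlgebra.contractLeft_comm _ _ a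

theorem fermiD_pair_comm (a b c d : Gen Λ) :
    Commute (fermiD a * fermiD b) (fermiD c * fermiD d) := by
  refine LinearMap.ext fun w => ?_
  simp only [Module.End.mul_apply]
  rw [fermiD_anticomm b c, map_neg, fermiD_anticomm a c, neg_neg, fermiD_anticomm b d,
    map_neg, fermiD_anticomm a d, neg_neg]

theorem fermiDAt_comm (i j : Λ) : Commute (fermiDAt i) (fermiDAt j) :=
  ((fermiD_pair_comm _ _ _ _).mul_right (fermiD_pair_comm _ _ _ _)).mul_left
    ((fermiD_pair_comm _ _ _ _).mul_right (fermiD_pair_comm _ _ _ _))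

variable [Fintype Λ] [DecidableEq Λ]

/-- The generator `ξ_i^γ`. -/
def xi (i : Λ) (γ : Fin 2) : Grass Λ := ExteriorAlgebra.ι ℝ (Pi.single (Sum.inl (i, γ)) 1)

/-- The generator `η_i^γ`. -/
def eta (i : Λ) (γ : Fin 2) : Grass Λ := ExteriorAlgebra.ι ℝ (Pi.single (Sum.inr (i, γ)) 1)

/-- The fermionic integral `∏_i ∂_{η_i^1} ∂_{ξ_i^1} ∂_{η_i^2} ∂_{ξ_i^2} a ∈ ℝ`. All generators
are removed by the derivatives, so the result is a scalar, which `algebraMapInv` reads off. -/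
def fermiInt (a : Grass Λ) : ℝ :=
  ExteriorAlgebra.algebraMapInv
    ((Finset.univ : Finset Λ).noncommProd fermiDAt (fun i _ j _ _ => fermiDAt_comm i j) a)

/-- The degree-zero part (body) of an element. -/
def body (a : Grass Λ) : ℝ := ExteriorAlgebra.algebraMapInv a

/-- The nilpotent part (soul) of an element. -/
def soul (a : Grass Λ) : Grass Λ := a - algebraMap ℝ (Grass Λ) (body a)

/-- `f(a)` for a function `f` of one variable, smooth near `body a`, and an even element `a`:
the Taylor expansion of `f` about the body. A product of more than `4|Λ|` souls vanishes, so the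
finite sum is the whole Taylor series. -/
def applyOne (f : ℝ → ℝ) (a : Grass Λ) : Grass Λ :=
  ∑ k ∈ Finset.range (Fintype.card (Gen Λ) + 1),
    ((k.factorial : ℝ)⁻¹ * iteratedDeriv k f (body a)) • soul a ^ k

/-- `f((a_κ)_κ)` for a function `f` of several variables, smooth near the bodies, and even
elements `a_κ`: the multivariate Taylor expansion
`∑_k (1/k!) ∑_{κ_1, …, κ_k} ∂_{κ_1} ⋯ ∂_{κ_k} f(body a) · soul a_{κ_1} ⋯ soul a_{κ_k}`. -/
def applyMany {κ : Type*} [Fintype κ] [DecidableEq κ] (f : (κ → ℝ) → ℝ) (a : κ → Grass Λ) :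
    Grass Λ :=
  ∑ k ∈ Finset.range (Fintype.card (Gen Λ) + 1), ∑ j : Fin k → κ,
    ((k.factorial : ℝ)⁻¹ *
      iteratedFDeriv ℝ k f (fun l => body (a l)) (fun m => Pi.single (j m) 1)) •
        (List.ofFn (fun m => soul (a (j m)))).prod

/-! ### The `ℍ^{2|4}` model -/

/-- `ℝ^{2Λ}`: a point is `p = (x, y)`. -/
abbrev Config (Λ : Type*) : Type _ := (Λ → ℝ) × (Λ → ℝ)

/-- The form `x_i`. -/
def xf (i : Λ) (p : Config Λ) : Grass Λ := algebraMap ℝ (Grass Λ) (p.1 i)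

/-- The form `y_i`. -/
def yf (i : Λ) (p : Config Λ) : Grass Λ := algebraMap ℝ (Grass Λ) (p.2 i)

/-- `z_i = √(1 + x_i² + y_i² - 2 ξ_i^1 η_i^1 - 2 ξ_i^2 η_i^2)`. -/
def zf (i : Λ) (p : Config Λ) : Grass Λ :=
  applyOne Real.sqrt
    (1 + xf i p ^ 2 + yf i p ^ 2 + ∑ γ : Fin 2, (-2 : ℝ) • (xi i γ * eta i γ))

/-- `u_i · u_j = x_i x_j + y_i y_j + ∑_γ (η_i^γ ξ_j^γ - ξ_i^γ η_j^γ) - z_i z_j`. -/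
def dotf (i j : Λ) (p : Config Λ) : Grass Λ :=
  xf i p * xf j p + yf i p * yf j p + ∑ γ : Fin 2, (eta i γ * xi j γ - xi i γ * eta j γ)
    - zf i p * zf j p

/-- The action `H_{β,h} = ½ (u, -Δ_β u) + (h, z - 1)`, where
`(u, -Δ_β u) = ∑_i u_i · ∑_j β_{ij} (u_i - u_j)`. -/
def action (β : Sym2 Λ → ℝ) (h : Λ → ℝ) (p : Config Λ) : Grass Λ :=
  (1 / 2 : ℝ) • ∑ i, ∑ j, β s(i, j) • (dotf i i p - dotf i j p)
    + ∑ i, h i • (zf i p - 1)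

/-- The function on `ℝ^{2Λ}` that is left to integrate in `[F]_{β,h}` after the fermionic
derivatives have been taken:
`∏_i (1/2π) ∂_{η_i^1} ∂_{ξ_i^1} ∂_{η_i^2} ∂_{ξ_i^2} ((∏_i 1/z_i) F e^{-H_{β,h}})`. -/
def integrand (β : Sym2 Λ → ℝ) (h : Λ → ℝ) (F : Config Λ → Grass Λ) (p : Config Λ) : ℝ :=
  ((2 * Real.pi) ^ Fintype.card Λ)⁻¹ *
    fermiInt (applyMany (fun v : Λ → ℝ => ∏ i, (v i)⁻¹) (fun i => zf i p) *
      (F p * applyOne Real.exp (-action β h p)))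

/-- The unnormalised expectation `[F]_{β,h}` of the `ℍ^{2|4}` model. -/
def expect (β : Sym2 Λ → ℝ) (h : Λ → ℝ) (F : Config Λ → Grass Λ) : ℝ :=
  ∫ p, integrand β h F p

/-- The form `F((x_i + z_i)_i, (y_i)_i)`. -/
def obsTS (F : (Λ ⊕ Λ → ℝ) → ℝ) (p : Config Λ) : Grass Λ :=
  applyMany F (Sum.elim (fun i => xf i p + zf i p) (fun i => yf i p))

/-- The form `F((x_i + z_i)_i)`. -/
def obsT (F : (Λ → ℝ) → ℝ) (p : Config Λ) : Grass Λ :=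
  applyMany F (fun i => xf i p + zf i p)

/-! ### Horospherical densities -/

/-- The matrix `-Δ_{β(t),h(t)}` with `β_{ij}(t) = β_{ij} e^{t_i + t_j}`, `h_i(t) = h_i e^{t_i}`. -/
def negLap (β : Sym2 Λ → ℝ) (h t : Λ → ℝ) : Matrix Λ Λ ℝ :=
  Matrix.of fun i j =>
    if i = j then
      (∑ k ∈ Finset.univ.erase i, β s(i, k) * Real.exp (t i + t k)) + h i * Real.exp (t i)
    else -(β s(i, j) * Real.exp (t i + t j))

/-- `H̃_{β,h}(t, s)`; the sum over unordered pairs is written as half the sum over ordered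
pairs. -/
def horoTS (β : Sym2 Λ → ℝ) (h t s : Λ → ℝ) : ℝ :=
  (1 / 2) * ∑ i, ∑ j, β s(i, j) *
      (Real.cosh (t i - t j) + (1 / 2) * Real.exp (t i + t j) * (s i - s j) ^ 2 - 1)
    + ∑ i, h i * (Real.cosh (t i) + (1 / 2) * Real.exp (t i) * s i ^ 2 - 1)
    - 2 * Real.log (negLap β h t).det + 3 * ∑ i, t i

/-- `H̃_{β,h}(t)`. -/
def horoT (β : Sym2 Λ → ℝ) (h t : Λ → ℝ) : ℝ :=
  (1 / 2) * ∑ i, ∑ j, β s(i, j) * (Real.cosh (t i - t j) - 1)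
    + ∑ i, h i * (Real.cosh (t i) - 1)
    - (3 / 2) * Real.log (negLap β h t).det + 3 * ∑ i, t i

/-! ### The arboreal gas -/

/-- The graph induced by the edge weights. -/
def weightGraph (β : Sym2 Λ → ℝ) : SimpleGraph Λ :=
  SimpleGraph.fromEdgeSet {e | β e ≠ 0}

open Classical in
/-- `Z_{β,h} = ∑_F ∏_{ij ∈ F} β_{ij} ∏_{T ∈ F} (1 + ∑_{i ∈ T} h_i)`, where `F` runs over the edge
sets of forests in the graph of `β` and `T` over the trees (components, isolated vertices
included) of the forest `F`. -/
def arborealZ (β : Sym2 Λ → ℝ) (h : Λ → ℝ) : ℝ :=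
  ∑ F ∈ (weightGraph β).edgeFinset.powerset with
      (SimpleGraph.fromEdgeSet (F : Set (Sym2 Λ))).IsAcyclic,
    (∏ e ∈ F, β e) *
      ∏ T : (SimpleGraph.fromEdgeSet (F : Set (Sym2 Λ))).ConnectedComponent,
        (1 + ∑ i with (SimpleGraph.fromEdgeSet (F : Set (Sym2 Λ))).connectedComponentMk i = T, h i)

end

end HoroH24

namespace HoroH24

noncomputable section

/-! ### Even elements and the fermionic integral -/

section Grassmann

variable {Λ : Type*}

/-! At each site put x = (e^t - w e^{-t})/2 with w = 1 + y² - n and n = 2ξ¹η¹ + 2ξ²η². Then z = (e^t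
+ w e^{-t})/2, so x + z = e^t and dx/z = dt. In these coordinates the action is affine in the even
nilpotents, so the fermionic integral is Gaussian with matrix M = e^{-t}(-Δ_{β(t),h(t)})e^{-t}
(`horoMat`) and equals (det M)², one determinant for each γ. The substitution y = e^t s gives claim
1; integrating out the Gaussian variable y costs a factor (det M)^{-1/2} and gives claim 2.

The substitution involves Grassmann elements, so it needs a justification. All forms in play are
obtained by inserting 4|Λ| even square-zero elements (`evenGen`) into smooth functions of real
parameters v. For each small real v the substitution is ordinary calculus. A polynomial in 4|Λ|
square-zero elements sees only its part of degree at most 4|Λ|, so an identity of integrals valid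
for all small v passes to the forms (`aeval_eq_zero_of_bound`, `IsJet.integral_congr`). Uniform
Taylor bounds require compact domains, hence cutoffs θ_i(x_i). After the substitution the cutoffs
contain nilpotents, and their derivatives produce extra terms in which rows of M are replaced by
unit vectors (`integral_cutoff_form`).

To remove the cutoffs under absolute convergence alone, the extra terms must be dominated by a
constant times (det M)². If the quadratic form of M dominates δ_i v_i², replacing row i costs at
most a factor 1/δ_i (`det_replaceRC_bound`). Cutoffs of logarithmically slow decay, chosen
successively by graph distance from a vertex with positive h, have derivatives small enough to
compensate (`exists_cutoff_family`). Dominated convergence then finishes (`integral_form_eq`).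

For claim 3, the integrand of [1] is of polynomial growth times the exponential of minus the body of
the action, and some power of that body controls the norm (`integrable_integrand_one`). The
t-integral is evaluated by taking the diagonal b of M as new variable: t ↦ b maps bijectively onto
the positive definite cone, with Jacobian det M. The resulting integral `psi` is reduced one vertex
at a time by Schur complements and the integral of √c exp(-(c + a²/c)/2), which gives √(2π)(1 +
a)e^{-a}. Up to normalisation `psi` then satisfies the same recursion as the arboreal partition
function: it is affine in each h_n, and at h = 0 a vertex can be deleted while its edge weights
become external fields (`psi_update`, `arborealZ_update`, `exp_mul_psi`). -/

theorem fermiD_ι_mul (g : Gen Λ) (u : Gen Λ → ℝ) (b : Grass Λ) :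
    fermiD g (ExteriorAlgebra.ι ℝ u * b) = u g • b - ExteriorAlgebra.ι ℝ u * fermiD g b :=
  CliffordAlgebra.contractLeft_ι_mul _ _ _

theorem fermiD_ι_mul_ι_mul (g : Gen Λ) (u v : Gen Λ → ℝ) (b : Grass Λ) :
    fermiD g (ExteriorAlgebra.ι ℝ u * ExteriorAlgebra.ι ℝ v * b) =
      u g • (ExteriorAlgebra.ι ℝ v * b) - v g • (ExteriorAlgebra.ι ℝ u * b)
        + ExteriorAlgebra.ι ℝ u * ExteriorAlgebra.ι ℝ v * fermiD g b := by
  rw [mul_assoc, fermiD_ι_mul, fermiD_ι_mul, mul_sub, mul_smul_comm, mul_assoc]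
  abel

theorem fermiD_one (g : Gen Λ) : fermiD g (1 : Grass Λ) = 0 :=
  CliffordAlgebra.contractLeft_one (Q := (0 : QuadraticForm ℝ (Gen Λ → ℝ))) _

theorem ι_mul_swap (u v : Gen Λ → ℝ) :
    ExteriorAlgebra.ι ℝ u * ExteriorAlgebra.ι ℝ v =
      -(ExteriorAlgebra.ι ℝ v * ExteriorAlgebra.ι ℝ u) :=
  eq_neg_of_add_eq_zero_left (ExteriorAlgebra.ι_add_mul_swap u v)

/-- Even elements are central, so the computations can take place in the commutative ring
`Subalgebra.center`, where products over finite sets are available. -/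
theorem ι_mul_ι_mem_center (u v : Gen Λ → ℝ) :
    ExteriorAlgebra.ι ℝ u * ExteriorAlgebra.ι ℝ v ∈ Subalgebra.center ℝ (Grass Λ) := by
  rw [Subalgebra.mem_center_iff]
  intro b
  induction b using ExteriorAlgebra.induction with
  | algebraMap r => exact Algebra.commutes r _
  | ι w =>
    rw [← mul_assoc, ι_mul_swap w u, neg_mul, mul_assoc, ι_mul_swap w v, mul_neg, neg_neg, mul_assoc]
  | mul a b ha hb => rw [mul_assoc, hb, ← mul_assoc, ha, mul_assoc]
  | add a b ha hb => rw [add_mul, mul_add, ha, hb]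

variable [Fintype Λ] [DecidableEq Λ]

/-- The linear combination `∑_j v_j η_j^γ`, as a vector of the generating space. -/
def etaVec (γ : Fin 2) : (Λ → ℝ) →ₗ[ℝ] (Gen Λ → ℝ) :=
  ∑ j, (LinearMap.proj j).smulRight (Pi.single (Sum.inr (j, γ)) 1)

theorem etaVec_apply (γ : Fin 2) (v : Λ → ℝ) :
    etaVec γ v = ∑ j, v j • (Pi.single (Sum.inr (j, γ)) 1 : Gen Λ → ℝ) := by
  simp [etaVec, LinearMap.sum_apply]

theorem etaVec_inl (γ : Fin 2) (v : Λ → ℝ) (a : Λ × Fin 2) : etaVec γ v (Sum.inl a) = 0 := by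
  simp [etaVec_apply, Finset.sum_apply]

theorem etaVec_single (γ : Fin 2) (i : Λ) :
    etaVec γ (Pi.single i 1) = (Pi.single (Sum.inr (i, γ)) 1 : Gen Λ → ℝ) := by
  rw [etaVec_apply, Finset.sum_eq_single i] <;> simp +contextual

/-- The even element `ξ_i^γ (∑_j v_j η_j^γ)`, as an element of the centre. -/
def xiEta (i : Λ) (γ : Fin 2) : (Λ → ℝ) →ₗ[ℝ] Subalgebra.center ℝ (Grass Λ) where
  toFun v := ⟨xi i γ * ExteriorAlgebra.ι ℝ (etaVec γ v), ι_mul_ι_mem_center _ _⟩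
  map_add' v w := by ext; simp [mul_add]
  map_smul' c v := by ext; simp

theorem coe_xiEta (i : Λ) (γ : Fin 2) (v : Λ → ℝ) :
    (xiEta i γ v : Grass Λ) = xi i γ * ExteriorAlgebra.ι ℝ (etaVec γ v) := rfl

theorem coe_xiEta_single (i j : Λ) (γ : Fin 2) :
    (xiEta i γ (Pi.single j 1) : Grass Λ) = xi i γ * eta j γ := by
  rw [coe_xiEta, etaVec_single]; rfl

theorem xiEta_mul_self (i : Λ) (γ : Fin 2) (v w : Λ → ℝ) : xiEta i γ v * xiEta i γ w = 0 := by
  ext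
  simp only [MulMemClass.coe_mul, coe_xiEta, xi, ZeroMemClass.coe_zero]
  rw [mul_assoc, ← mul_assoc _ (ExteriorAlgebra.ι ℝ _) (ExteriorAlgebra.ι ℝ (etaVec γ w)),
    ι_mul_swap (etaVec γ v), neg_mul, mul_neg, ← mul_assoc, ← mul_assoc, ExteriorAlgebra.ι_sq_zero]
  simp

/-- The factor `etaVec γ v` occurs twice. This makes the product over sites alternating in its
vectors, which is where determinants come from. -/
theorem xiEta_mul_swap (i j : Λ) (γ : Fin 2) (v : Λ → ℝ) : xiEta i γ v * xiEta j γ v = 0 := by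
  ext
  simp only [MulMemClass.coe_mul, coe_xiEta, xi, ZeroMemClass.coe_zero]
  rw [mul_assoc, ← mul_assoc _ (ExteriorAlgebra.ι ℝ _) (ExteriorAlgebra.ι ℝ (etaVec γ v)),
    ι_mul_swap (etaVec γ v), neg_mul, mul_neg, mul_assoc, ExteriorAlgebra.ι_sq_zero]
  simp

theorem fermiD_xiEta_mul (g : Gen Λ) (i : Λ) (γ : Fin 2) (v : Λ → ℝ) (b : Grass Λ)
    (hg : g = Sum.inl (i, γ) → False) (hv : etaVec γ v g = 0) (hb : fermiD g b = 0) :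
    fermiD g (xiEta i γ v * b) = 0 := by
  have : (Pi.single (Sum.inl (i, γ)) 1 : Gen Λ → ℝ) g = 0 := Pi.single_eq_of_ne (by tauto) _
  rw [coe_xiEta, xi, fermiD_ι_mul_ι_mul, this, hv, hb]
  simp

omit [Fintype Λ] [DecidableEq Λ] in
theorem fermiDAt_pairwise_comm (s : Finset Λ) :
    (s : Set Λ).Pairwise (Function.onFun Commute fermiDAt) :=
  fun i _ j _ _ => fermiDAt_comm i j

/-- `fermiInt` as a linear functional. -/
def fermiIntL : Grass Λ →ₗ[ℝ] ℝ :=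
  (ExteriorAlgebra.algebraMapInv (R := ℝ) (M := Gen Λ → ℝ)).toLinearMap ∘ₗ
    (Finset.univ : Finset Λ).noncommProd fermiDAt (fermiDAt_pairwise_comm _)

omit [Fintype Λ] [DecidableEq Λ] in
theorem fermiDAt_eq_zero (i : Λ) (γ : Fin 2) (a : Grass Λ) (h : fermiD (Sum.inl (i, γ)) a = 0) :
    fermiDAt i a = 0 := by
  simp only [fermiDAt, Module.End.mul_apply]
  fin_cases γ
  · rw [Fin.zero_eta] at h
    rw [fermiD_anticomm (Sum.inl (i, 0)), fermiD_anticomm (Sum.inl (i, 0)) (Sum.inl (i, 1)), h]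
    simp
  · rw [Fin.mk_one] at h
    rw [h]
    simp

theorem fermiIntL_eq_zero (i : Λ) (γ : Fin 2) (a : Grass Λ)
    (h : fermiD (Sum.inl (i, γ)) a = 0) : fermiIntL a = 0 := by
  rw [fermiIntL, LinearMap.comp_apply]
  have : (Finset.univ : Finset Λ).noncommProd fermiDAt (fermiDAt_pairwise_comm _) =
      (Finset.univ.erase i).noncommProd fermiDAt (fermiDAt_pairwise_comm _)
        * fermiDAt i :=
    (Finset.noncommProd_erase_mul _ (Finset.mem_univ i) _ _).symm
  rw [this, Module.End.mul_apply, fermiDAt_eq_zero i γ a h, map_zero, map_zero]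

theorem fermiD_prod_xiEta (s : Finset (Λ × Fin 2)) (v : Λ × Fin 2 → Λ → ℝ) (a : Λ × Fin 2)
    (ha : a ∉ s) :
    fermiD (Sum.inl a) ((∏ b ∈ s, xiEta b.1 b.2 (v b) : Subalgebra.center ℝ (Grass Λ)) :
      Grass Λ) = 0 := by
  induction s using Finset.induction_on with
  | empty => simpa using fermiD_one _
  | insert b s hb ih =>
    rw [Finset.prod_insert hb, MulMemClass.coe_mul]
    refine fermiD_xiEta_mul _ _ _ _ _ ?_ (etaVec_inl _ _ _) (ih fun h => ha (by simp [h]))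
    intro h
    exact ha (by simp [Sum.inl_injective h])

/-- In the expanded product, a term that takes a scalar at `a` has lost the generator ξ_a, and the
derivative with respect to ξ_a kills it. -/
theorem fermiIntL_prod_add (c : Λ × Fin 2 → ℝ) (v : Λ × Fin 2 → Λ → ℝ) :
    fermiIntL ((∏ b, (algebraMap ℝ _ (c b) + xiEta b.1 b.2 (v b)) :
      Subalgebra.center ℝ (Grass Λ)) : Grass Λ) =
    fermiIntL ((∏ b, xiEta b.1 b.2 (v b) : Subalgebra.center ℝ (Grass Λ)) : Grass Λ) := by
  have hcomm : ∀ b : Λ × Fin 2, algebraMap ℝ (Subalgebra.center ℝ (Grass Λ)) (c b)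
      + xiEta b.1 b.2 (v b) = xiEta b.1 b.2 (v b) + algebraMap ℝ _ (c b) := fun b => add_comm _ _
  simp_rw [hcomm]
  rw [Finset.prod_add]
  rw [AddSubmonoidClass.coe_finsetSum, map_sum, Finset.sum_eq_single Finset.univ]
  · simp
  · intro s _ hs
    obtain ⟨a, ha⟩ : ∃ a, a ∉ s := by
      by_contra! h
      exact hs (Finset.eq_univ_iff_forall.2 h)
    rw [← map_prod, mul_comm, ← Algebra.smul_def, Subalgebra.coe_smul, map_smul,
      fermiIntL_eq_zero a.1 a.2 _ (fermiD_prod_xiEta s v a ha), smul_zero]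
  · simp

omit [Fintype Λ] in
theorem fermiDAt_site (i : Λ) (b : Grass Λ) (hb : ∀ γ, fermiD (Sum.inl (i, γ)) b = 0)
    (hb' : ∀ γ, fermiD (Sum.inr (i, γ)) b = 0) :
    fermiDAt i (xi i 0 * eta i 0 * (xi i 1 * eta i 1 * b)) = b := by
  simp [fermiDAt, xi, eta, mul_assoc, fermiD_ι_mul, hb, hb']

omit [Fintype Λ] in
theorem fermiD_site_ne {i j : Λ} (hij : j ≠ i) (γ : Fin 2) (g : Gen Λ)
    (hg : g = Sum.inl (i, γ) ∨ g = Sum.inr (i, γ)) (b : Grass Λ) (hb : fermiD g b = 0) :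
    fermiD g (xi j 0 * eta j 0 * (xi j 1 * eta j 1 * b)) = 0 := by
  have h : ∀ δ, (Pi.single (Sum.inl (j, δ)) 1 : Gen Λ → ℝ) g = 0 ∧
      (Pi.single (Sum.inr (j, δ)) 1 : Gen Λ → ℝ) g = 0 := by
    rcases hg with rfl | rfl <;> simp [hij.symm]
  simp [xi, eta, mul_assoc, fermiD_ι_mul, hb, h]

/-- Normalisation of the Berezin integral: the order of the derivatives matches the order ξη of the
generators, so the sign is +1. -/
theorem fermiIntL_sites :
    fermiIntL ((∏ b : Λ × Fin 2, xiEta b.1 b.2 (Pi.single b.1 1) :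
      Subalgebra.center ℝ (Grass Λ)) : Grass Λ) = 1 := by
  -- The vanishing of the derivatives at sites outside `s` is carried along, since it is what lets
  -- `fermiDAt` strip off a new site.
  have key : ∀ s : Finset Λ,
      (∀ i ∉ s, ∀ γ g, g = Sum.inl (i, γ) ∨ g = Sum.inr (i, γ) →
        fermiD g ((∏ i ∈ s, ∏ γ, xiEta i γ (Pi.single i 1) :
          Subalgebra.center ℝ (Grass Λ)) : Grass Λ) = 0) ∧
      s.noncommProd fermiDAt (fermiDAt_pairwise_comm _)
        ((∏ i ∈ s, ∏ γ, xiEta i γ (Pi.single i 1) : Subalgebra.center ℝ (Grass Λ)) : Grass Λ)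
        = 1 := by
    intro s
    induction s using Finset.induction_on with
    | empty =>
      refine ⟨fun i _ γ g _ => ?_, ?_⟩
      · simpa using fermiD_one g
      · rw [Finset.noncommProd_empty]; simp
    | insert j s hj ih =>
      have e : ((∏ i ∈ insert j s, ∏ γ, xiEta i γ (Pi.single i 1) :
          Subalgebra.center ℝ (Grass Λ)) : Grass Λ) = xi j 0 * eta j 0 * (xi j 1 * eta j 1 *
          ((∏ i ∈ s, ∏ γ, xiEta i γ (Pi.single i 1) :
          Subalgebra.center ℝ (Grass Λ)) : Grass Λ)) := by
        rw [Finset.prod_insert hj, Fin.prod_univ_two]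
        simp only [MulMemClass.coe_mul, coe_xiEta_single, mul_assoc]
      constructor
      · intro i hi γ g hg
        simp only [Finset.mem_insert, not_or] at hi
        rw [e]
        exact fermiD_site_ne (Ne.symm hi.1) γ g hg _ (ih.1 i hi.2 γ g hg)
      · rw [e, Finset.noncommProd_insert_of_notMem' _ _ _ _ hj, Module.End.mul_apply,
          fermiDAt_site j _ (fun γ => ih.1 j hj γ _ (Or.inl rfl))
          (fun γ => ih.1 j hj γ _ (Or.inr rfl)), ih.2]
  rw [Fintype.prod_prod_type, fermiIntL, LinearMap.comp_apply, (key Finset.univ).2]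
  simp

/-- The Berezin Gaussian integral. -/
theorem fermiIntL_prod_xiEta (A B : Λ → Λ → ℝ) :
    fermiIntL (((∏ i, xiEta i 0 (A i)) * ∏ i, xiEta i 1 (B i) : Subalgebra.center ℝ (Grass Λ)) :
      Grass Λ) = (Matrix.of A).det * (Matrix.of B).det := by
  -- An alternating form in |Λ| vectors of `Λ → ℝ` is a multiple of the determinant.
  have alt : ∀ γ : Fin 2, ∃ f : (Λ → ℝ) [⋀^Λ]→ₗ[ℝ] Subalgebra.center ℝ (Grass Λ),
      ∀ v, f v = ∏ i, xiEta i γ (v i) := by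
    intro γ
    refine ⟨{ (MultilinearMap.mkPiAlgebra ℝ Λ (Subalgebra.center ℝ (Grass Λ))).compLinearMap
      (fun i => xiEta i γ) with map_eq_zero_of_eq' := ?_ }, fun v => ?_⟩
    · intro v i j hv hij
      simp only [MultilinearMap.toFun_eq_coe, MultilinearMap.compLinearMap_apply,
        MultilinearMap.mkPiAlgebra_apply]
      rw [← Finset.mul_prod_erase _ _ (Finset.mem_univ i), ← Finset.mul_prod_erase _ _
        (Finset.mem_erase.2 ⟨hij.symm, Finset.mem_univ j⟩), ← mul_assoc, hv, xiEta_mul_swap,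
        zero_mul]
    · simp [← AlternatingMap.coe_multilinearMap]
  obtain ⟨f0, hf0⟩ := alt 0
  obtain ⟨f1, hf1⟩ := alt 1
  have h : ∀ (L : Subalgebra.center ℝ (Grass Λ) →ₗ[ℝ] ℝ)
      (f : (Λ → ℝ) [⋀^Λ]→ₗ[ℝ] Subalgebra.center ℝ (Grass Λ)) (M : Λ → Λ → ℝ),
      L (f M) = L (f fun i => Pi.single i 1) * (Matrix.of M).det := by
    intro L f M
    have := AlternatingMap.eq_smul_basis_det (Pi.basisFun ℝ Λ) (L.compAlternatingMap f)
    have h2 := congrArg (fun g => g M) this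
    simp only [Pi.basisFun_det] at h2
    simp only [LinearMap.compAlternatingMap_apply, ] at h2
    refine h2.trans ?_
    rw [show (⇑(Pi.basisFun ℝ Λ) : Λ → Λ → ℝ) = fun i => Pi.single i 1 by
      ext i : 1; simp]
    rfl
  let ψ : Subalgebra.center ℝ (Grass Λ) →ₗ[ℝ] ℝ :=
    fermiIntL ∘ₗ (Subalgebra.center ℝ (Grass Λ)).val.toLinearMap
  change ψ ((∏ i, xiEta i 0 (A i)) * ∏ i, xiEta i 1 (B i)) = _
  rw [← hf0 A, ← hf1 B]
  -- The two species are treated one at a time, with the factor of the other frozen.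
  have h1 := h (ψ ∘ₗ LinearMap.mulRight ℝ (f1 B)) f0 A
  have h2 := h (ψ ∘ₗ LinearMap.mulLeft ℝ (f0 fun i => Pi.single i 1)) f1 B
  simp only [LinearMap.comp_apply, LinearMap.mulRight_apply, LinearMap.mulLeft_apply] at h1 h2
  rw [h1, h2, hf0, hf1]
  have := fermiIntL_sites (Λ := Λ)
  rw [Fintype.prod_prod_type] at this
  simp only [Fin.prod_univ_two, Finset.prod_mul_distrib] at this
  change ψ ((∏ x, xiEta x 0 (Pi.single x 1)) * ∏ x, xiEta x 1 (Pi.single x 1)) = 1 at this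
  rw [this]
  ring

end Grassmann

end

end HoroH24

namespace HoroH24

noncomputable section

/-! ### Fermionic integrals of site products as sums of determinants -/

section SiteProduct

variable {Λ : Type*} [Fintype Λ] [DecidableEq Λ]

/-- The matrix `A` with the rows selected by `c` replaced by those of the identity matrix. -/
def replaceRows (A : Λ → Λ → ℝ) (c : Λ → Bool) : Λ → Λ → ℝ :=
  fun i => if c i then Pi.single i 1 else A i

/-- The entry of the triple `k` whose index is the number of `true`s. -/
def pick (k : Fin 3 → ℝ) (b : Bool × Bool) : ℝ :=
  match b with
  | (false, false) => k 0
  | (true, true) => k 2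
  | _ => k 1

/-- Since n_γ q_γ = 0, the factor 1 + q_γ is absorbed by n_γ; what remains is one term for each
choice, per γ, of n_γ or 1 + q_γ. -/
theorem site_identity {R : Type*} [CommRing R] {n0 n1 q0 q1 : R} (h0 : n0 * q0 = 0)
    (h1 : n1 * q1 = 0) (a b c : R) :
    (a + b * (n0 + n1) + c * (n0 * n1)) * ((1 + q0) * (1 + q1)) =
      c * (n0 * n1) + b * (n0 * (1 + q1)) + (b * ((1 + q0) * n1) + a * ((1 + q0) * (1 + q1))) := by
  linear_combination (b + b * q1 + c * n1 * (1 + q1)) * h0 + (b + b * q0 + c * n0) * h1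

/-- Choosing the nilpotent ξ_i^γ η_i^γ at site i puts the unit vector into row i of the
γ-determinant; otherwise row i of `A` stays. -/
theorem fermiIntL_site_prod (k : Λ → Fin 3 → ℝ) (A : Λ → Λ → ℝ) :
    fermiIntL ((∏ i, (algebraMap ℝ _ (k i 0) +
          algebraMap ℝ _ (k i 1) * (xiEta i 0 (Pi.single i 1) + xiEta i 1 (Pi.single i 1)) +
          algebraMap ℝ _ (k i 2) * (xiEta i 0 (Pi.single i 1) * xiEta i 1 (Pi.single i 1))) *
        ((1 + xiEta i 0 (A i)) * (1 + xiEta i 1 (A i))) :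
        Subalgebra.center ℝ (Grass Λ)) : Grass Λ) =
      ∑ c : Λ → Bool × Bool, (∏ i, pick (k i) (c i)) *
        ((Matrix.of (replaceRows A fun i => (c i).1)).det *
          (Matrix.of (replaceRows A fun i => (c i).2)).det) := by
  let f : Λ → Fin 2 → Bool → Subalgebra.center ℝ (Grass Λ) := fun i γ b =>
    algebraMap ℝ _ (if b then 0 else 1) + xiEta i γ (if b then Pi.single i 1 else A i)
  have hsite : ∀ i, (algebraMap ℝ _ (k i 0) +
          algebraMap ℝ _ (k i 1) * (xiEta i 0 (Pi.single i 1) + xiEta i 1 (Pi.single i 1)) +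
          algebraMap ℝ _ (k i 2) * (xiEta i 0 (Pi.single i 1) * xiEta i 1 (Pi.single i 1))) *
        ((1 + xiEta i 0 (A i)) * (1 + xiEta i 1 (A i))) =
      ∑ c : Bool × Bool, algebraMap ℝ _ (pick (k i) c) * (f i 0 c.1 * f i 1 c.2) := by
    intro i
    have h0 := xiEta_mul_self i 0 (Pi.single i 1) (A i)
    have h1 := xiEta_mul_self i 1 (Pi.single i 1) (A i)
    simp only [Fintype.sum_prod_type, Fintype.sum_bool, f, pick, if_true, if_false, map_zero,
      zero_add, map_one, Bool.false_eq_true]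
    exact site_identity h0 h1 _ _ _
  simp_rw [hsite]
  rw [Finset.prod_univ_sum, Fintype.piFinset_univ, AddSubmonoidClass.coe_finsetSum, map_sum]
  refine Finset.sum_congr rfl fun c _ => ?_
  rw [Finset.prod_mul_distrib, ← map_prod, ← Algebra.smul_def, Subalgebra.coe_smul, map_smul,
    smul_eq_mul]
  congr 1
  rw [← fermiIntL_prod_xiEta]
  have e : ∀ g : Fin 2 → Λ → Λ → ℝ, (∏ i, xiEta i 0 (g 0 i)) * ∏ i, xiEta i 1 (g 1 i) =
      (∏ b : Λ × Fin 2, xiEta b.1 b.2 (g b.2 b.1)) := by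
    intro g
    rw [Fintype.prod_prod_type, ← Finset.prod_mul_distrib]
    simp [Fin.prod_univ_two]
  have e' := e ![replaceRows A fun i => (c i).1, replaceRows A fun i => (c i).2]
  simp only [Matrix.cons_val_zero, Matrix.cons_val_one] at e'
  rw [e', ← fermiIntL_prod_add fun b => if ![(c b.1).1, (c b.1).2] b.2 then 0 else 1,
    Fintype.prod_prod_type]
  simp only [Fin.prod_univ_two, Matrix.cons_val_zero, Matrix.cons_val_one, f, replaceRows]
  congr!

end SiteProduct

/-! ### Bounds on determinants with replaced rows -/

section Minors

variable {ι : Type*} [Fintype ι] [DecidableEq ι]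

/-- If row i is a unit vector, both determinants equal the (i, i) cofactor. -/
theorem det_updateCol_single_of_row (M : Matrix ι ι ℝ) (i : ι) (h : M i = Pi.single i 1) :
    (M.updateCol i (Pi.single i 1)).det = M.det := by
  have h1 : (M.updateCol i (Pi.single i 1)).det = M.adjugate i i := by
    rw [← Matrix.det_transpose, ← Matrix.updateRow_transpose, ← Matrix.adjugate_apply,
      ← Matrix.adjugate_transpose, Matrix.transpose_apply]
  rw [h1, Matrix.adjugate_apply, ← h, Matrix.updateRow_eq_self]

/-- Rows in `S` and columns in `T` replaced by those of the identity matrix. -/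
def replaceRC (M : Matrix ι ι ℝ) (S T : Finset ι) : Matrix ι ι ℝ :=
  Matrix.of fun a b => if a ∈ S ∨ b ∈ T then (1 : Matrix ι ι ℝ) a b else M a b

/-- Allows a matrix with replaced rows to be exchanged for a symmetric one, to which positivity
applies. -/
theorem det_replaceRC (M : Matrix ι ι ℝ) (S T : Finset ι) (hTS : T ⊆ S) :
    (replaceRC M S T).det = (replaceRC M S ∅).det := by
  induction T using Finset.induction_on with
  | empty => rfl
  | insert i T hi ih =>
    rw [← ih fun x hx => hTS (Finset.mem_insert_of_mem hx),
      ← det_updateCol_single_of_row (replaceRC M S T) i]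
    · congr 1
      ext a b
      by_cases hb : b = i
      · subst hb
        simp [replaceRC, Matrix.one_apply, Pi.single_apply]
      · simp [replaceRC, hb]
    · ext b
      have : i ∈ S := hTS (Finset.mem_insert_self _ _)
      simp [replaceRC, this, Matrix.one_apply, Pi.single_apply, eq_comm]

/-- One index at a time: subtracting δ_i from the (i, i) entry leaves a positive semidefinite
matrix, and by linearity in row i its determinant is the old one minus δ_i times the determinant
with row i replaced. -/
theorem det_replaceRC_bound (M : Matrix ι ι ℝ) (hM : M.IsSymm) (δ : ι → ℝ)
    (hδ : ∀ i, 0 ≤ δ i) (hq : ∀ v i, δ i * v i ^ 2 ≤ v ⬝ᵥ M.mulVec v) (S : Finset ι) :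
    0 ≤ (replaceRC M S S).det ∧ (∏ i ∈ S, δ i) * (replaceRC M S S).det ≤ M.det := by
  have hquad : ∀ (S : Finset ι) (v : ι → ℝ), v ⬝ᵥ (replaceRC M S S).mulVec v =
      ∑ i ∈ S, v i ^ 2 + (fun i => if i ∈ S then 0 else v i) ⬝ᵥ
        M.mulVec (fun i => if i ∈ S then 0 else v i) := by
    intro S v
    simp only [dotProduct, Matrix.mulVec]
    rw [← Finset.sum_filter_add_sum_filter_not Finset.univ (· ∈ S)
      (fun i => v i * ∑ j, replaceRC M S S i j * v j)]
    congr 1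
    · rw [show Finset.univ.filter (· ∈ S) = S by ext; simp]
      refine Finset.sum_congr rfl fun i hi => ?_
      simp [replaceRC, hi, Matrix.one_apply, sq]
    · rw [Finset.sum_filter]
      refine Finset.sum_congr rfl fun i _ => ?_
      by_cases hi : i ∈ S
      · simp [hi]
      · simp only [hi, not_false_eq_true, if_true, if_false]
        congr 1
        refine Finset.sum_congr rfl fun j _ => ?_
        by_cases hj : j ∈ S
        · have : i ≠ j := fun h => hi (h ▸ hj)
          simp [replaceRC, hj, Matrix.one_apply, this]
        · simp [replaceRC, hi, hj]
  have hsymm : ∀ S, (replaceRC M S S).IsSymm := by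
    intro S
    ext a b
    simp only [Matrix.transpose_apply, replaceRC, Matrix.of_apply, Matrix.one_apply]
    rw [hM.apply]
    simp [or_comm, eq_comm]
  have hpsd : ∀ N : Matrix ι ι ℝ, N.IsSymm → (∀ v, 0 ≤ v ⬝ᵥ N.mulVec v) → 0 ≤ N.det := by
    intro N hN h
    refine (Matrix.PosSemidef.of_dotProduct_mulVec_nonneg ?_ fun x => ?_).det_nonneg
    · rwa [Matrix.IsHermitian, Matrix.conjTranspose_eq_transpose_of_trivial]
    · simpa using h x
  -- The case v = 0 is separated because over an empty index type `hq` has no index to be applied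
  -- to.
  have hq0 : ∀ v : ι → ℝ, (∀ i, v i = 0) ∨ 0 ≤ v ⬝ᵥ M.mulVec v := by
    intro v
    by_cases h : ∀ i, v i = 0
    · exact Or.inl h
    · push Not at h
      obtain ⟨i, _⟩ := h
      exact Or.inr ((mul_nonneg (hδ i) (sq_nonneg _)).trans (hq v i))
  have hM0 : ∀ v : ι → ℝ, 0 ≤ v ⬝ᵥ M.mulVec v := by
    intro v
    rcases hq0 v with h | h
    · rw [show v = 0 from funext h]; simp
    · exact h
  have hnn : ∀ S, 0 ≤ (replaceRC M S S).det := fun S => hpsd _ (hsymm S) fun v => by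
    rw [hquad]
    exact add_nonneg (Finset.sum_nonneg fun i _ => sq_nonneg _) (hM0 _)
  refine ⟨hnn S, ?_⟩
  induction S using Finset.induction_on with
  | empty =>
    rw [Finset.prod_empty, one_mul]
    exact le_of_eq (congrArg Matrix.det (by ext; simp [replaceRC]))
  | insert i S hi ih =>
    refine le_trans ?_ ih
    rw [Finset.prod_insert hi, mul_comm (δ i), mul_assoc]
    refine mul_le_mul_of_nonneg_left ?_ (Finset.prod_nonneg fun i _ => hδ i)
    set N := replaceRC M S S with hN
    have h1 : (replaceRC M (insert i S) (insert i S)).det = (N.updateRow i (Pi.single i 1)).det := by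
      rw [← det_updateCol_single_of_row (N.updateRow i (Pi.single i 1)) i (by simp)]
      congr 1
      ext a b
      by_cases ha : a = i
      · subst ha
        by_cases hb : b = a
        · subst hb; simp [replaceRC]
        · simp [replaceRC, hb, Matrix.one_apply, Ne.symm hb]
      · by_cases hb : b = i
        · subst hb; simp [replaceRC, Matrix.one_apply, Pi.single_apply]
        · simp [replaceRC, Matrix.updateRow_apply, ha, hb, hN]
    have h2 : (N.updateRow i (N i + (-δ i) • Pi.single i 1)).det =
        N.det - δ i * (N.updateRow i (Pi.single i 1)).det := by
      rw [Matrix.det_updateRow_add, Matrix.det_updateRow_smul, Matrix.updateRow_eq_self]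
      ring
    -- As i is not in S, the coordinate i still enters through the quadratic form of M, which
    -- dominates δ_i v_i².
    have h3 : 0 ≤ (N.updateRow i (N i + (-δ i) • Pi.single i 1)).det := by
      have hmat : N.updateRow i (N i + (-δ i) • Pi.single i 1) =
          N - δ i • Matrix.single i i 1 := by
        ext a b
        by_cases ha : a = i
        · subst ha
          by_cases hb : b = a
          · subst hb; simp; ring
          · simp [Ne.symm hb, hb]
        · simp [Matrix.updateRow_apply, ha, Ne.symm ha]
      rw [hmat]
      refine hpsd _ ?_ fun v => ?_
      · rw [Matrix.IsSymm, Matrix.transpose_sub, Matrix.transpose_smul, Matrix.transpose_single,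
          hsymm S]
      · rw [Matrix.sub_mulVec, dotProduct_sub, hquad]
        have : v ⬝ᵥ (δ i • Matrix.single i i (1 : ℝ)).mulVec v = δ i * v i ^ 2 := by
          rw [Matrix.smul_mulVec, dotProduct_smul, Matrix.single_mulVec]
          simp [dotProduct, Function.update_apply, sq]
        rw [this]
        have := hq (fun i => if i ∈ S then 0 else v i) i
        simp only [hi, if_false] at this
        have h' : 0 ≤ ∑ i ∈ S, v i ^ 2 := Finset.sum_nonneg fun i _ => sq_nonneg _
        linarith
    rw [h1]
    linarith

theorem det_replaceRows_bound (M : Matrix ι ι ℝ) (hM : M.IsSymm) (δ : ι → ℝ)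
    (hδ : ∀ i, 0 ≤ δ i) (hq : ∀ v i, δ i * v i ^ 2 ≤ v ⬝ᵥ M.mulVec v) (c : ι → Bool) :
    0 ≤ (Matrix.of (replaceRows (fun i j => M i j) c)).det ∧
      (∏ i, if c i then δ i else 1) * (Matrix.of (replaceRows (fun i j => M i j) c)).det
        ≤ M.det := by
  have h := det_replaceRC_bound M hM δ hδ hq (Finset.univ.filter fun i => c i)
  rw [det_replaceRC _ _ _ subset_rfl] at h
  have e : Matrix.of (replaceRows (fun i j => M i j) c) =
      replaceRC M (Finset.univ.filter fun i => c i) ∅ := by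
    ext a b
    by_cases ha : c a
    · simp [replaceRows, replaceRC, ha, Matrix.one_apply, Pi.single_apply, eq_comm (a := b)]
    · simp [replaceRows, replaceRC, ha]
  rw [e]
  rwa [Finset.prod_filter] at h

end Minors

end

end HoroH24

namespace HoroH24

noncomputable section

/-! ### Polynomials in square-zero elements -/

section Polynomials

/-- Write q = X^m u with u(0) ≠ 0. If m < n, dividing the bound by τ^m and letting τ → 0 forces u(0)
= 0. -/
theorem coeff_eq_zero_of_bound (q : Polynomial ℝ) (n : ℕ) (C r : ℝ) (hr : 0 < r)
    (h : ∀ τ, 0 < τ → τ ≤ r → |q.eval τ| ≤ C * τ ^ n) (k : ℕ) (hk : k < n) : q.coeff k = 0 := by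
  by_cases hq : q = 0
  · simp [hq]
  obtain ⟨u, hu, hdvd⟩ := Polynomial.exists_eq_pow_rootMultiplicity_mul_and_not_dvd q hq 0
  set m := q.rootMultiplicity 0
  rw [map_zero, sub_zero] at hu hdvd
  by_cases hm : m < n
  · exfalso
    apply hdvd
    rw [Polynomial.X_dvd_iff, Polynomial.coeff_zero_eq_eval_zero]
    have hlim : Filter.Tendsto (fun τ => |u.eval τ|) (nhdsWithin 0 (Set.Ioi 0))
        (nhds |u.eval 0|) :=
      ((continuous_abs.comp u.continuous).tendsto 0).mono_left nhdsWithin_le_nhds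
    have hlim2 : Filter.Tendsto (fun τ : ℝ => C * τ ^ (n - m)) (nhdsWithin 0 (Set.Ioi 0))
        (nhds 0) := by
      have : Filter.Tendsto (fun τ : ℝ => C * τ ^ (n - m)) (nhds 0) (nhds (C * 0 ^ (n - m))) :=
        Continuous.tendsto (by fun_prop) 0
      rw [zero_pow (by omega), mul_zero] at this
      exact this.mono_left nhdsWithin_le_nhds
    have hle : |u.eval 0| ≤ 0 := by
      refine le_of_tendsto_of_tendsto hlim hlim2 ?_
      filter_upwards [Ioc_mem_nhdsGT hr] with τ hτ
      have h1 := h τ hτ.1 hτ.2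
      rw [hu, Polynomial.eval_mul, Polynomial.eval_pow, Polynomial.eval_X, abs_mul, abs_pow,
        abs_of_pos hτ.1, show n = m + (n - m) by omega, pow_add] at h1
      have h2 : 0 < τ ^ m := pow_pos hτ.1 m
      exact le_of_mul_le_mul_left (h1.trans_eq (mul_left_comm _ _ _)) h2
    simpa using hle
  · rw [hu, mul_comm, Polynomial.coeff_mul_X_pow', if_neg (by omega)]

variable {σ : Type*} [Fintype σ]

theorem aeval_C_mul_X_of_isHomogeneous {p : MvPolynomial σ ℝ} {k : ℕ} (hp : p.IsHomogeneous k)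
    (v : σ → ℝ) : MvPolynomial.aeval (fun s => Polynomial.C (v s) * Polynomial.X) p =
      Polynomial.C (MvPolynomial.eval v p) * Polynomial.X ^ k := by
  rw [MvPolynomial.aeval_def, MvPolynomial.eval₂_eq', MvPolynomial.eval_eq', map_sum,
    Finset.sum_mul]
  refine Finset.sum_congr rfl fun d hd => ?_
  have hdeg : ∑ s, d s = k := by
    have := hp (MvPolynomial.mem_support_iff.1 hd)
    rw [← this, Finsupp.weight_apply, Finsupp.sum_fintype] <;> simp
  simp_rw [mul_pow]
  rw [Finset.prod_mul_distrib, Finset.prod_pow_eq_pow_sum, hdeg]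
  simp [mul_assoc, Polynomial.algebraMap_eq]

/-- The bound, read along rays, kills every homogeneous component of degree at most `Fintype.card
σ`. A monomial of larger degree repeats a variable, so it vanishes on square-zero elements. -/
theorem aeval_eq_zero_of_bound {R : Type*} [CommRing R] [Algebra ℝ R] (g : σ → R)
    (hg : ∀ s, g s ^ 2 = 0) (p : MvPolynomial σ ℝ) (C r : ℝ) (hr : 0 < r)
    (h : ∀ v : σ → ℝ, ‖v‖ ≤ r → |MvPolynomial.eval v p| ≤ C * ‖v‖ ^ (Fintype.card σ + 1)) :
    MvPolynomial.aeval g p = 0 := by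
  have hhom : ∀ k ≤ Fintype.card σ, MvPolynomial.homogeneousComponent k p = 0 := by
    intro k hk
    refine MvPolynomial.funext fun v => ?_
    rw [map_zero]
    let q : Polynomial ℝ := MvPolynomial.aeval (fun s => Polynomial.C (v s) * Polynomial.X) p
    have hq : ∀ τ, q.eval τ = MvPolynomial.eval (τ • v) p := by
      intro τ
      have : (Polynomial.evalRingHom τ).comp (MvPolynomial.aeval
          (fun s => Polynomial.C (v s) * Polynomial.X) :
          MvPolynomial σ ℝ →ₐ[ℝ] Polynomial ℝ).toRingHom = MvPolynomial.eval (τ • v) := by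
        refine MvPolynomial.ringHom_ext (fun c => by simp) fun s => ?_
        simp only [AlgHom.toRingHom_eq_coe, RingHom.coe_comp, RingHom.coe_coe,
          Function.comp_apply, MvPolynomial.aeval_X, Polynomial.coe_evalRingHom,
          Polynomial.eval_mul, Polynomial.eval_C, Polynomial.eval_X, MvPolynomial.eval_X,
          Pi.smul_apply, smul_eq_mul]
        ring
      exact congrArg (fun f => f p) this
    have hcoeff : q.coeff k = MvPolynomial.eval v (MvPolynomial.homogeneousComponent k p) := by
      have hqs : q = ∑ j ∈ Finset.range (p.totalDegree + 1),
          Polynomial.C (MvPolynomial.eval v (MvPolynomial.homogeneousComponent j p))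
            * Polynomial.X ^ j := by
        have e := congrArg (MvPolynomial.aeval (fun s => Polynomial.C (v s) * Polynomial.X))
          (MvPolynomial.sum_homogeneousComponent p)
        rw [map_sum] at e
        refine e.symm.trans ?_
        exact Finset.sum_congr rfl fun j _ => aeval_C_mul_X_of_isHomogeneous
          (MvPolynomial.homogeneousComponent_isHomogeneous j p) v
      rw [hqs, Polynomial.finsetSum_coeff]
      simp only [Polynomial.coeff_C_mul, Polynomial.coeff_X_pow]
      by_cases hkd : k < p.totalDegree + 1
      · rw [Finset.sum_eq_single k] <;> simp +contextual [eq_comm]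
        omega
      · rw [MvPolynomial.homogeneousComponent_eq_zero k p (by omega), map_zero]
        refine Finset.sum_eq_zero fun j hj => ?_
        have := Finset.mem_range.1 hj
        rw [if_neg (by omega), mul_zero]
    rw [← hcoeff]
    -- The denominator ‖v‖ + 1 keeps τv within distance r and also covers v = 0.
    refine coeff_eq_zero_of_bound q (Fintype.card σ + 1)
      (C * ‖v‖ ^ (Fintype.card σ + 1)) (r / (‖v‖ + 1)) (by positivity) (fun τ hτ hτr => ?_) k
      (by omega)
    have hn : ‖τ • v‖ = τ * ‖v‖ := by rw [norm_smul, Real.norm_eq_abs, abs_of_pos hτ]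
    have h1 := h (τ • v) (by
      rw [hn]
      rw [le_div_iff₀ (by positivity)] at hτr
      nlinarith [norm_nonneg v])
    rw [hq]
    refine h1.trans (le_of_eq ?_)
    rw [hn]; ring
  rw [MvPolynomial.aeval_def, MvPolynomial.eval₂_eq']
  refine Finset.sum_eq_zero fun d _ => ?_
  by_cases hd : d.degree ≤ Fintype.card σ
  · have : p.coeff d = 0 := by
      have := congrArg (MvPolynomial.coeff d) (hhom d.degree hd)
      rwa [MvPolynomial.coeff_homogeneousComponent, if_pos rfl, MvPolynomial.coeff_zero] at this
    rw [this, map_zero, zero_mul]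
  · obtain ⟨s, hs⟩ : ∃ s, 2 ≤ d s := by
      by_contra! hlt
      apply hd
      rw [Finsupp.degree_eq_sum]
      calc ∑ s, d s ≤ ∑ _s : σ, 1 := Finset.sum_le_sum fun s _ => by have := hlt s; omega
        _ = _ := by simp
    rw [Finset.prod_eq_zero (Finset.mem_univ s), mul_zero]
    rw [show d s = 2 + (d s - 2) by omega, pow_add, hg, zero_mul]

end Polynomials

/-! ### Uniform Taylor estimates -/

section Taylor

/-- Integral form of the remainder. The base points form a compact set; a closed thickening of it is
still compact and inside U, so the next derivative is bounded there. -/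
theorem exists_taylor_bound {X E : Type*} [TopologicalSpace X] [CompactSpace X]
    [NormedAddCommGroup E] [NormedSpace ℝ E] [ProperSpace E] (f : E → ℝ) (U : Set E)
    (hU : IsOpen U) (hf : ContDiffOn ℝ ∞ f U) (b : X → E) (hb : Continuous b)
    (hbU : ∀ x, b x ∈ U) (n : ℕ) :
    ∃ C r, 0 < r ∧ ∀ x v, ‖v‖ ≤ r →
      |f (b x + v) - ∑ k ∈ Finset.range (n + 1),
        (k.factorial : ℝ)⁻¹ * iteratedFDeriv ℝ k f (b x) (fun _ => v)| ≤ C * ‖v‖ ^ (n + 1) := by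
  have hS : IsCompact (Set.range b) := isCompact_range hb
  obtain ⟨δ, hδ, hδU⟩ := hS.exists_cthickening_subset_open hU (Set.range_subset_iff.2 hbU)
  have hcont : ContinuousOn (iteratedFDeriv ℝ (n + 1) f) U :=
    (hf.continuousOn_iteratedFDerivWithin (m := n + 1) (by exact_mod_cast le_top)
      hU.uniqueDiffOn).congr (iteratedFDerivWithin_of_isOpen (n + 1) hU).symm
  obtain ⟨B, hB⟩ := (hS.cthickening (r := δ)).exists_bound_of_continuousOn (hcont.mono hδU)
  refine ⟨((n.factorial : ℝ)⁻¹ * B), δ, hδ, fun x v hv => ?_⟩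
  have hmem : ∀ t ∈ Set.Icc (0 : ℝ) 1, b x + t • v ∈ Metric.cthickening δ (Set.range b) := by
    intro t ht
    refine Metric.mem_cthickening_of_dist_le _ (b x) δ _ (Set.mem_range_self x) ?_
    rw [dist_eq_norm, add_sub_cancel_left, norm_smul, Real.norm_eq_abs, abs_of_nonneg ht.1]
    nlinarith [norm_nonneg v, ht.2]
  have hT := map_add_eq_sum_add_integral_iteratedFDeriv (f := f) (x := b x) (y := v) (n := n)
    fun t ht => (hf.contDiffAt (hU.mem_nhds (hδU (hmem t ht)))).of_le (by exact_mod_cast le_top)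
  rw [hT]
  simp only [smul_eq_mul, add_sub_cancel_left]
  rw [abs_mul, abs_of_nonneg (by positivity : (0 : ℝ) ≤ (n.factorial : ℝ)⁻¹), mul_assoc]
  refine mul_le_mul_of_nonneg_left ?_ (by positivity)
  have := intervalIntegral.norm_integral_le_of_norm_le_const (a := 0) (b := 1)
    (C := B * ‖v‖ ^ (n + 1))
    (f := fun t : ℝ => (1 - t) ^ n * iteratedFDeriv ℝ (n + 1) f (b x + t • v) fun _ => v) ?_
  · simpa using this
  intro t ht
  rw [Set.uIoc_of_le zero_le_one] at ht
  have ht' : t ∈ Set.Icc (0 : ℝ) 1 := ⟨ht.1.le, ht.2⟩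
  have h1 := (iteratedFDeriv ℝ (n + 1) f (b x + t • v)).le_opNorm fun _ => v
  rw [Finset.prod_const, Finset.card_univ, Fintype.card_fin] at h1
  have h2 := hB _ (hmem t ht')
  have h3 : |1 - t| ^ n ≤ 1 := by
    refine pow_le_one₀ (abs_nonneg _) ?_
    rw [abs_le]; constructor <;> linarith [ht.1, ht.2]
  rw [norm_mul, Real.norm_eq_abs, abs_pow]
  calc |1 - t| ^ n * ‖iteratedFDeriv ℝ (n + 1) f (b x + t • v) fun _ => v‖
      ≤ 1 * (B * ‖v‖ ^ (n + 1)) := by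
        refine mul_le_mul h3 (h1.trans ?_) (norm_nonneg _) zero_le_one
        exact mul_le_mul_of_nonneg_right h2 (by positivity)
    _ = _ := one_mul _

theorem continuous_iteratedFDeriv_comp {X E : Type*} [TopologicalSpace X]
    [NormedAddCommGroup E] [NormedSpace ℝ E] (f : E → ℝ) (U : Set E)
    (hU : IsOpen U) (hf : ContDiffOn ℝ ∞ f U) (b : X → E) (hb : Continuous b)
    (hbU : ∀ x, b x ∈ U) (k : ℕ) : Continuous fun x => iteratedFDeriv ℝ k f (b x) := by
  have hcont : ContinuousOn (iteratedFDeriv ℝ k f) U :=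
    (hf.continuousOn_iteratedFDerivWithin (m := k) (by exact_mod_cast le_top)
      hU.uniqueDiffOn).congr (iteratedFDerivWithin_of_isOpen k hU).symm
  exact hcont.comp_continuous hb hbU

end Taylor

end

end HoroH24

namespace HoroH24

noncomputable section

/-! ### Calculus of jets: replacing even nilpotents by real parameters -/

section Jets

variable {Λ : Type*} [Fintype Λ] [DecidableEq Λ]

/-- The even nilpotent elements `ξ_i^γ η_i^γ` and `∑_j β_{ij} ξ_i^γ η_j^γ`. -/
def evenGen (β : Sym2 Λ → ℝ) : Gen Λ → Subalgebra.center ℝ (Grass Λ) :=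
  Sum.elim (fun a => xiEta a.1 a.2 (Pi.single a.1 1)) (fun a => xiEta a.1 a.2 fun j => β s(a.1, j))

theorem evenGen_sq (β : Sym2 Λ → ℝ) (g : Gen Λ) : evenGen β g ^ 2 = 0 := by
  rcases g with a | a <;> simp [evenGen, sq, xiEta_mul_self]

/-- Evaluation of polynomials at the even nilpotent elements. -/
def evenEval (β : Sym2 Λ → ℝ) :
    MvPolynomial (Gen Λ) ℝ →ₐ[ℝ] Subalgebra.center ℝ (Grass Λ) :=
  MvPolynomial.aeval (evenGen β)

theorem body_xiEta (i : Λ) (γ : Fin 2) (v : Λ → ℝ) : body (xiEta i γ v : Grass Λ) = 0 := by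
  rw [body, coe_xiEta, map_mul]
  simp [ExteriorAlgebra.algebraMapInv]

theorem body_evenEval (β : Sym2 Λ → ℝ) (p : MvPolynomial (Gen Λ) ℝ) :
    body (evenEval β p : Grass Λ) = MvPolynomial.eval 0 p := by
  let f : MvPolynomial (Gen Λ) ℝ →ₐ[ℝ] ℝ :=
    (ExteriorAlgebra.algebraMapInv (R := ℝ) (M := Gen Λ → ℝ)).comp
      ((Subalgebra.center ℝ (Grass Λ)).val.comp (evenEval β))
  have : f = MvPolynomial.aeval (0 : Gen Λ → ℝ) := by
    refine MvPolynomial.algHom_ext fun s => ?_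
    have h : body (evenGen β s : Grass Λ) = 0 := by
      rcases s with a | a <;> simp [evenGen, body_xiEta]
    simpa [f, evenEval] using! h
  have h := congrArg (fun g => g p) this
  simpa [f, MvPolynomial.aeval_def, MvPolynomial.eval₂_eq_eval_map] using! h

variable {X : Type*} [TopologicalSpace X]

/-- Specialisation of the coefficients of a family of polynomials. -/
def specialize {σ : Type*} (x : X) : MvPolynomial σ C(X, ℝ) →+* MvPolynomial σ ℝ :=
  MvPolynomial.map (ContinuousMap.evalAlgHom ℝ ℝ x : C(X, ℝ) →ₐ[ℝ] ℝ).toRingHom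

@[simp] theorem specialize_C {σ : Type*} (x : X) (c : C(X, ℝ)) :
    specialize (σ := σ) x (MvPolynomial.C c) = MvPolynomial.C (c x) := by
  simp [specialize]

@[simp] theorem specialize_X {σ : Type*} (x : X) (s : σ) :
    specialize (σ := σ) x (MvPolynomial.X s) = MvPolynomial.X s := by
  simp [specialize]

theorem continuous_eval_specialize {σ : Type*} (P : MvPolynomial σ C(X, ℝ)) :
    Continuous fun q : X × (σ → ℝ) => MvPolynomial.eval q.2 (specialize q.1 P) := by
  induction P using MvPolynomial.induction_on with
  | C c => simpa using! c.continuous.comp continuous_fst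
  | add p q hp hq => simpa using! hp.add hq
  | mul_X p s hp => simpa using! hp.mul ((continuous_apply s).comp continuous_snd)

theorem continuous_eval_specialize_const {σ : Type*} (P : MvPolynomial σ C(X, ℝ)) (v : σ → ℝ) :
    Continuous fun x => MvPolynomial.eval v (specialize x P) := by
  induction P using MvPolynomial.induction_on with
  | C c => simpa using! c.continuous
  | add p q hp hq => simpa using! hp.add hq
  | mul_X p s hp => simpa using! hp.mul continuous_const

/-- The family of elements `a x` is obtained by substituting the even nilpotent generators into
the jets at the origin of the family of functions `φ x`. -/
def IsJet (β : Sym2 Λ → ℝ) (a : X → Grass Λ) (φ : X → (Gen Λ → ℝ) → ℝ) : Prop :=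
  ∃ P : MvPolynomial (Gen Λ) C(X, ℝ), (∀ x, (evenEval β (specialize x P) : Grass Λ) = a x) ∧
    ∃ C r, 0 < r ∧ ∀ x v, ‖v‖ ≤ r →
      |φ x v - MvPolynomial.eval v (specialize x P)| ≤ C * ‖v‖ ^ (Fintype.card (Gen Λ) + 1)

variable {β : Sym2 Λ → ℝ} {a a' : X → Grass Λ} {φ φ' : X → (Gen Λ → ℝ) → ℝ}

theorem IsJet.congr (h : IsJet β a φ) (hφ : ∃ C r, 0 < r ∧ ∀ x v, ‖v‖ ≤ r →
    |φ' x v - φ x v| ≤ C * ‖v‖ ^ (Fintype.card (Gen Λ) + 1)) : IsJet β a φ' := by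
  obtain ⟨P, hP, C, r, hr, hb⟩ := h
  obtain ⟨C', r', hr', hb'⟩ := hφ
  refine ⟨P, hP, C' + C, min r' r, lt_min hr' hr, fun x v hv => ?_⟩
  have h1 := hb x v (hv.trans (min_le_right _ _))
  have h2 := hb' x v (hv.trans (min_le_left _ _))
  have := abs_sub_le (φ' x v) (φ x v) (MvPolynomial.eval v (specialize x P))
  linarith

theorem isJet_const (c : C(X, ℝ)) :
    IsJet β (fun x => algebraMap ℝ (Grass Λ) (c x)) (fun x _ => c x) := by
  refine ⟨MvPolynomial.C c, fun x => ?_, 0, 1, one_pos, fun x v _ => by simp⟩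
  rw [specialize_C, ← MvPolynomial.algebraMap_eq, AlgHom.commutes]
  rfl

theorem isJet_evenGen (g : Gen Λ) : IsJet (X := X) β (fun _ => (evenGen β g : Grass Λ))
    (fun _ v => v g) := by
  refine ⟨MvPolynomial.X g, fun x => ?_, 0, 1, one_pos, fun x v _ => by simp⟩
  simp [evenEval]

theorem IsJet.add (h : IsJet β a φ) (h' : IsJet β a' φ') :
    IsJet β (fun x => a x + a' x) (fun x v => φ x v + φ' x v) := by
  obtain ⟨P, hP, C, r, hr, hb⟩ := h
  obtain ⟨P', hP', C', r', hr', hb'⟩ := h'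
  refine ⟨P + P', fun x => by simp [hP, hP'], C + C', min r r', lt_min hr hr', fun x v hv => ?_⟩
  have h1 := hb x v (hv.trans (min_le_left _ _))
  have h2 := hb' x v (hv.trans (min_le_right _ _))
  rw [map_add, map_add, add_sub_add_comm, add_mul]
  exact (abs_add_le _ _).trans (add_le_add h1 h2)

/-- At v = 0 the error bound is zero, since its exponent is positive. -/
theorem IsJet.apply_zero (h : IsJet β a φ) (x : X) : φ x 0 = body (a x) := by
  obtain ⟨P, hP, C, r, hr, hb⟩ := h
  have h1 := hb x 0 (by simpa using hr.le)
  rw [norm_zero, zero_pow (by omega), mul_zero] at h1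
  rw [← hP, body_evenEval]
  exact sub_eq_zero.1 (abs_nonpos_iff.1 h1)

theorem IsJet.continuous_apply_zero (h : IsJet β a φ) : Continuous fun x => φ x 0 := by
  have h0 := h.apply_zero
  obtain ⟨P, hP, -⟩ := h
  have e : (fun x => φ x 0) = fun x => MvPolynomial.eval 0 (specialize x P) := by
    funext x
    rw [h0, ← hP, body_evenEval]
  rw [e]
  exact continuous_eval_specialize_const P 0

variable [CompactSpace X]

omit [DecidableEq Λ] in
theorem exists_bound_eval_specialize (P : MvPolynomial (Gen Λ) C(X, ℝ)) :
    ∃ B, 0 ≤ B ∧ ∀ x v, ‖v‖ ≤ 1 → |MvPolynomial.eval v (specialize x P)| ≤ B := by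
  have hK : IsCompact ((Set.univ : Set X) ×ˢ Metric.closedBall (0 : Gen Λ → ℝ) 1) :=
    isCompact_univ.prod (isCompact_closedBall 0 1)
  obtain ⟨B, hB⟩ := hK.exists_bound_of_continuousOn (continuous_eval_specialize P).continuousOn
  refine ⟨max B 0, le_max_right _ _, fun x v hv => (hB (x, v) ⟨trivial, ?_⟩).trans
    (le_max_left _ _)⟩
  simpa using hv

theorem IsJet.mul (h : IsJet β a φ) (h' : IsJet β a' φ') :
    IsJet β (fun x => a x * a' x) (fun x v => φ x v * φ' x v) := by
  obtain ⟨P, hP, C, r, hr, hb⟩ := h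
  obtain ⟨P', hP', C', r', hr', hb'⟩ := h'
  obtain ⟨B, hB0, hB⟩ := exists_bound_eval_specialize P
  obtain ⟨B', hB0', hB'⟩ := exists_bound_eval_specialize P'
  refine ⟨P * P', fun x => by simp [hP, hP'], |C| * (B' + |C'|) + B * |C'|, min 1 (min r r'),
    lt_min one_pos (lt_min hr hr'), fun x v hv => ?_⟩
  have hv1 := hv.trans (min_le_left _ _)
  have h1 := hb x v (hv.trans ((min_le_right _ _).trans (min_le_left _ _)))
  have h2 := hb' x v (hv.trans ((min_le_right _ _).trans (min_le_right _ _)))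
  have h3 := hB x v hv1
  have h4 := hB' x v hv1
  rw [map_mul, map_mul]
  set p := MvPolynomial.eval v (specialize x P)
  set p' := MvPolynomial.eval v (specialize x P')
  set N := ‖v‖ ^ (Fintype.card (Gen Λ) + 1)
  have hN : 0 ≤ N := by positivity
  have hN1 : N ≤ 1 := pow_le_one₀ (norm_nonneg v) hv1
  have h1' : |φ x v - p| ≤ |C| * N := h1.trans (mul_le_mul_of_nonneg_right (le_abs_self C) hN)
  have h2' : |φ' x v - p'| ≤ |C'| * N := h2.trans (mul_le_mul_of_nonneg_right (le_abs_self C') hN)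
  have h5 : |φ' x v| ≤ B' + |C'| := by
    have := abs_sub_abs_le_abs_sub (φ' x v) p'
    have : |C'| * N ≤ |C'| := mul_le_of_le_one_right (abs_nonneg _) hN1
    linarith
  have e : φ x v * φ' x v - p * p' = (φ x v - p) * φ' x v + p * (φ' x v - p') := by ring
  rw [e]
  refine (abs_add_le _ _).trans ?_
  rw [abs_mul, abs_mul, add_mul]
  refine add_le_add ?_ ?_
  · calc _ ≤ |C| * N * (B' + |C'|) := mul_le_mul h1' h5 (abs_nonneg _) (by positivity)
      _ = _ := by ring
  · calc _ ≤ B * (|C'| * N) := mul_le_mul h3 h2' (abs_nonneg _) hB0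
      _ = _ := by ring

theorem IsJet.const_smul (c : C(X, ℝ)) (h : IsJet β a φ) :
    IsJet β (fun x => c x • a x) (fun x v => c x * φ x v) := by
  simp_rw [Algebra.smul_def]
  exact (isJet_const c).mul h

theorem IsJet.neg (h : IsJet β a φ) : IsJet β (fun x => -a x) (fun x v => -φ x v) := by
  simpa using h.const_smul (-1)

theorem IsJet.sub (h : IsJet β a φ) (h' : IsJet β a' φ') :
    IsJet β (fun x => a x - a' x) (fun x v => φ x v - φ' x v) := by
  simp_rw [sub_eq_add_neg]
  exact h.add h'.neg

omit [CompactSpace X] in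
theorem IsJet.sum {κ : Type*} (s : Finset κ) {b : κ → X → Grass Λ}
    {ψ : κ → X → (Gen Λ → ℝ) → ℝ} (h : ∀ k, IsJet β (b k) (ψ k)) :
    IsJet β (fun x => ∑ k ∈ s, b k x) (fun x v => ∑ k ∈ s, ψ k x v) := by
  classical
  induction s using Finset.induction_on with
  | empty => simpa using isJet_const (X := X) (β := β) 0
  | insert k s hk ih => simpa [Finset.sum_insert hk] using (h k).add ih

theorem IsJet.list_prod {n : ℕ} {b : Fin n → X → Grass Λ}
    {ψ : Fin n → X → (Gen Λ → ℝ) → ℝ} (h : ∀ k, IsJet β (b k) (ψ k)) :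
    IsJet β (fun x => (List.ofFn fun k => b k x).prod) (fun x v => ∏ k, ψ k x v) := by
  induction n with
  | zero => simpa using isJet_const (X := X) (β := β) 1
  | succ n ih =>
    simp_rw [List.ofFn_succ, List.prod_cons, Fin.prod_univ_succ]
    exact (h 0).mul (ih fun k => h k.succ)

theorem IsJet.soul (h : IsJet β a φ) :
    IsJet β (fun x => HoroH24.soul (a x)) (fun x v => φ x v - φ x 0) := by
  have := h.sub (isJet_const (β := β) ⟨_, h.continuous_apply_zero⟩)
  simpa [HoroH24.soul, h.apply_zero] using this

/-- Increments are O(‖v‖), so a Taylor remainder in the increments becomes one of the same order in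
v. -/
theorem IsJet.lipschitz (h : IsJet β a φ) : ∃ L r, 0 ≤ L ∧ 0 < r ∧ ∀ x v, ‖v‖ ≤ r →
    |φ x v - φ x 0| ≤ L * ‖v‖ := by
  have h0 := h.apply_zero
  obtain ⟨P, hP, C, r, hr, hb⟩ := h
  have hlip : ∃ L, 0 ≤ L ∧ ∀ x v, ‖v‖ ≤ 1 → |MvPolynomial.eval v (specialize x P) -
      MvPolynomial.eval 0 (specialize x P)| ≤ L * ‖v‖ := by
    clear hb hP
    induction P using MvPolynomial.induction_on with
    | C c => exact ⟨0, le_rfl, fun x v _ => by simp⟩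
    | add p q hp hq =>
      obtain ⟨L, hL, hp⟩ := hp
      obtain ⟨L', hL', hq⟩ := hq
      refine ⟨L + L', by positivity, fun x v hv => ?_⟩
      rw [map_add, map_add, map_add, add_sub_add_comm, add_mul]
      exact (abs_add_le _ _).trans (add_le_add (hp x v hv) (hq x v hv))
    | mul_X p s _ =>
      obtain ⟨B, hB0, hB⟩ := exists_bound_eval_specialize p
      refine ⟨B, hB0, fun x v hv => ?_⟩
      simp only [map_mul, specialize_X, MvPolynomial.eval_X, Pi.zero_apply, mul_zero, sub_zero,
        abs_mul]
      exact mul_le_mul (hB x v hv) (norm_le_pi_norm v s) (abs_nonneg _) hB0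
  obtain ⟨L, hL, hlip⟩ := hlip
  refine ⟨|C| + L, min 1 r, by positivity, lt_min one_pos hr, fun x v hv => ?_⟩
  have hv1 := hv.trans (min_le_left _ _)
  have h1 := hb x v (hv.trans (min_le_right _ _))
  have h2 := hlip x v hv1
  have h3 : ‖v‖ ^ (Fintype.card (Gen Λ) + 1) ≤ ‖v‖ := by
    rw [pow_succ]
    exact mul_le_of_le_one_left (norm_nonneg v) (pow_le_one₀ (norm_nonneg v) hv1)
  have h4 : C * ‖v‖ ^ (Fintype.card (Gen Λ) + 1) ≤ |C| * ‖v‖ :=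
    mul_le_mul (le_abs_self C) h3 (by positivity) (abs_nonneg C)
  have h5 : φ x 0 = MvPolynomial.eval 0 (specialize x P) := by
    rw [h0, ← hP, body_evenEval]
  have := abs_sub_le (φ x v) (MvPolynomial.eval v (specialize x P)) (φ x 0)
  rw [← h5] at h2
  linarith

/-- The Taylor sum defining `applyMany` is a polynomial in souls, hence a jet of the Taylor
polynomial of f along the increments. That polynomial differs from f by a remainder of the
admissible order. -/
theorem IsJet.applyMany {κ : Type*} [Fintype κ] [DecidableEq κ] (f : (κ → ℝ) → ℝ)
    (U : Set (κ → ℝ)) (hU : IsOpen U) (hf : ContDiffOn ℝ ∞ f U) {b : κ → X → Grass Λ}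
    {ψ : κ → X → (Gen Λ → ℝ) → ℝ} (h : ∀ k, IsJet β (b k) (ψ k))
    (hψ : ∀ x, (fun k => ψ k x 0) ∈ U) :
    IsJet β (fun x => HoroH24.applyMany f fun k => b k x) (fun x v => f fun k => ψ k x v) := by
  have hc : Continuous fun x k => ψ k x 0 := continuous_pi fun k => (h k).continuous_apply_zero
  have hcoef : ∀ (n : ℕ) (j : Fin n → κ), Continuous fun x => (n.factorial : ℝ)⁻¹ *
      iteratedFDeriv ℝ n f (fun k => ψ k x 0) fun m => Pi.single (j m) 1 := fun n j =>
    continuous_const.mul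
      ((continuous_iteratedFDeriv_comp f U hU hf _ hc hψ n).eval_const _)
  have hjet : IsJet β (fun x => HoroH24.applyMany f fun k => b k x) (fun x v =>
      ∑ n ∈ Finset.range (Fintype.card (Gen Λ) + 1), ∑ j : Fin n → κ, ((n.factorial : ℝ)⁻¹ *
      iteratedFDeriv ℝ n f (fun k => ψ k x 0) fun m => Pi.single (j m) 1) *
        ∏ m, (ψ (j m) x v - ψ (j m) x 0)) := by
    have e : ∀ x, (fun k => body (b k x)) = fun k => ψ k x 0 :=
      fun x => funext fun k => ((h k).apply_zero x).symm
    simp_rw [HoroH24.applyMany, e]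
    refine IsJet.sum _ fun n => IsJet.sum _ fun j => ?_
    exact (IsJet.list_prod fun m => (h (j m)).soul).const_smul ⟨_, hcoef n j⟩
  obtain ⟨C, r, hr, hT⟩ := exists_taylor_bound f U hU hf _ hc hψ (Fintype.card (Gen Λ))
  choose L ρ hL hρ hlip using fun k => (h k).lipschitz
  have hlip' : ∀ x v, (∀ k, ‖v‖ ≤ ρ k) →
      ‖(fun k => ψ k x v - ψ k x 0)‖ ≤ (∑ k, L k) * ‖v‖ := by
    intro x v hv
    refine (pi_norm_le_iff_of_nonneg (mul_nonneg (Finset.sum_nonneg fun k _ => hL k)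
      (norm_nonneg v))).2 fun k => (hlip k x v (hv k)).trans ?_
    exact mul_le_mul_of_nonneg_right
      (Finset.single_le_sum (fun k _ => hL k) (Finset.mem_univ k)) (norm_nonneg v)
  -- A common radius for all components; any positive number serves if there are none.
  obtain ⟨ρ₀, hρ₀, hρ₀'⟩ : ∃ ρ₀ > 0, ∀ k, ρ₀ ≤ ρ k := by
    by_cases hne : Nonempty κ
    · obtain ⟨k, hk⟩ := Finite.exists_min ρ
      exact ⟨ρ k, hρ k, hk⟩
    · exact ⟨1, one_pos, fun k => (hne ⟨k⟩).elim⟩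
  have hLs : 0 ≤ ∑ k, L k := Finset.sum_nonneg fun k _ => hL k
  refine hjet.congr ⟨|C| * (∑ k, L k) ^ (Fintype.card (Gen Λ) + 1),
    min ρ₀ (r / (∑ k, L k + 1)), lt_min hρ₀ (by positivity), fun x v hv => ?_⟩
  have hl := hlip' x v fun k => (hv.trans (min_le_left _ _)).trans (hρ₀' k)
  have h1 := hT x (fun k => ψ k x v - ψ k x 0) (by
    have := hv.trans (min_le_right _ _)
    rw [le_div_iff₀ (by positivity)] at this
    nlinarith [norm_nonneg v])
  have e1 : (fun k => ψ k x 0) + (fun k => ψ k x v - ψ k x 0) = fun k => ψ k x v := by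
    ext k; simp
  -- Expanding the increment in the standard basis turns the multilinear derivative into the sum
  -- over index tuples in the definition of `applyMany`.
  have e2 : ∀ n, iteratedFDeriv ℝ n f (fun k => ψ k x 0) (fun _ k => ψ k x v - ψ k x 0) =
      ∑ j : Fin n → κ, (iteratedFDeriv ℝ n f (fun k => ψ k x 0) fun m => Pi.single (j m) 1) *
        ∏ m, (ψ (j m) x v - ψ (j m) x 0) := by
    intro n
    have : (fun k => ψ k x v - ψ k x 0) =
        ∑ k, (ψ k x v - ψ k x 0) • (Pi.single k 1 : κ → ℝ) := by
      ext k'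
      simp [Finset.sum_apply, Pi.single_apply]
    rw [this]
    have h2 := (iteratedFDeriv ℝ n f (fun k => ψ k x 0)).toMultilinearMap.map_sum
      (fun (_ : Fin n) k => (ψ k x v - ψ k x 0) • (Pi.single k 1 : κ → ℝ))
    refine h2.trans (Finset.sum_congr rfl fun j _ => ?_)
    rw [MultilinearMap.map_smul_univ, smul_eq_mul, mul_comm]
    rfl
  rw [e1] at h1
  simp_rw [e2, Finset.mul_sum, ← mul_assoc] at h1
  refine h1.trans ?_
  rw [mul_assoc, ← mul_pow]
  exact mul_le_mul (le_abs_self C) (pow_le_pow_left₀ (norm_nonneg _) hl _) (by positivity)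
    (abs_nonneg C)

theorem IsJet.applyOne (f : ℝ → ℝ) (U : Set ℝ) (hU : IsOpen U) (hf : ContDiffOn ℝ ∞ f U)
    (h : IsJet β a φ) (hφ : ∀ x, φ x 0 ∈ U) :
    IsJet β (fun x => HoroH24.applyOne f (a x)) (fun x v => f (φ x v)) := by
  have hc : Continuous fun x => φ x 0 := h.continuous_apply_zero
  have hcoef : ∀ n : ℕ, Continuous fun x => (n.factorial : ℝ)⁻¹ * iteratedDeriv n f (φ x 0) := by
    intro n
    simp_rw [iteratedDeriv_eq_iteratedFDeriv]
    exact continuous_const.mul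
      ((continuous_iteratedFDeriv_comp f U hU hf _ hc hφ n).eval_const _)
  have hjet : IsJet β (fun x => HoroH24.applyOne f (a x)) (fun x v =>
      ∑ n ∈ Finset.range (Fintype.card (Gen Λ) + 1), ((n.factorial : ℝ)⁻¹ *
      iteratedDeriv n f (φ x 0)) * ∏ _m : Fin n, (φ x v - φ x 0)) := by
    simp_rw [HoroH24.applyOne, ← h.apply_zero]
    refine IsJet.sum _ fun n => ?_
    have := (IsJet.list_prod fun _ : Fin n => h.soul).const_smul ⟨_, hcoef n⟩
    simpa [List.ofFn_const] using this
  obtain ⟨C, r, hr, hT⟩ := exists_taylor_bound f U hU hf _ hc hφ (Fintype.card (Gen Λ))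
  obtain ⟨L, ρ, hL, hρ, hlip⟩ := h.lipschitz
  refine hjet.congr ⟨|C| * L ^ (Fintype.card (Gen Λ) + 1),
    min ρ (r / (L + 1)), lt_min hρ (by positivity), fun x v hv => ?_⟩
  have hl := hlip x v (hv.trans (min_le_left _ _))
  have h1 := hT x (φ x v - φ x 0) (by
    have := hv.trans (min_le_right _ _)
    rw [le_div_iff₀ (by positivity)] at this
    rw [Real.norm_eq_abs]
    nlinarith [norm_nonneg v])
  simp_rw [iteratedFDeriv_apply_eq_iteratedDeriv_mul_prod, add_sub_cancel, smul_eq_mul,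
    mul_comm (∏ _i, _), ← mul_assoc] at h1
  refine h1.trans ?_
  rw [mul_assoc, ← mul_pow]
  exact mul_le_mul (le_abs_self C) (pow_le_pow_left₀ (norm_nonneg _) hl _) (by positivity)
    (abs_nonneg C)

end Jets

end

end HoroH24

namespace HoroH24

noncomputable section

open MeasureTheory

/-! ### Transfer of integral identities from real parameters to forms -/

section IntegralOfJets

variable {Λ : Type*} [Fintype Λ] [DecidableEq Λ]

/-- A family with continuous coefficients is a finite sum of fixed monomials, so integration acts on
the coefficients alone. -/
theorem integral_linear_specialize {σ X : Type*} [TopologicalSpace X] [CompactSpace X]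
    [MeasurableSpace X] [OpensMeasurableSpace X] (μ : Measure X) [IsFiniteMeasure μ]
    (P : MvPolynomial σ C(X, ℝ)) (ℓ : MvPolynomial σ ℝ →ₗ[ℝ] ℝ) :
    Integrable (fun x => ℓ (specialize x P)) μ ∧
    ∫ x, ℓ (specialize x P) ∂μ =
      ℓ (∑ m ∈ P.support, MvPolynomial.monomial m (∫ x, P.coeff m x ∂μ)) := by
  have hint : ∀ m, Integrable (fun x => P.coeff m x) μ := fun m =>
    Integrable.of_bound (P.coeff m).continuous.aestronglyMeasurable ‖P.coeff m‖
      (Filter.Eventually.of_forall fun x => (P.coeff m).norm_coe_le_norm x)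
  have hmon : ∀ (m : σ →₀ ℕ) (c : ℝ), ℓ (MvPolynomial.monomial m c) =
      c * ℓ (MvPolynomial.monomial m 1) := by
    intro m c
    rw [← smul_eq_mul, ← map_smul, MvPolynomial.smul_monomial, smul_eq_mul, mul_one]
  have e : (fun x => ℓ (specialize x P)) = fun x =>
      ∑ m ∈ P.support, P.coeff m x * ℓ (MvPolynomial.monomial m 1) := by
    funext x
    conv_lhs => rw [MvPolynomial.as_sum P, map_sum, map_sum]
    refine Finset.sum_congr rfl fun m _ => ?_
    rw [← hmon]
    congr 1
    rw [specialize, MvPolynomial.map_monomial]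
    rfl
  rw [e]
  refine ⟨integrable_finsetSum _ fun m _ => (hint m).mul_const _, ?_⟩
  rw [integral_finsetSum _ fun m _ => (hint m).mul_const _, map_sum]
  refine Finset.sum_congr rfl fun m _ => ?_
  rw [integral_mul_const]
  exact (hmon m _).symm

/-- Integrating the coefficients of both families gives two polynomials whose values differ by
O(‖v‖^{4|Λ|+1}), because the integrals of φ and φ' agree for small v. Hence the two polynomials
coincide on the even nilpotents. -/
theorem IsJet.integral_congr {X X' : Type*} [TopologicalSpace X] [CompactSpace X]
    [MeasurableSpace X] [OpensMeasurableSpace X] (μ : Measure X) [IsFiniteMeasure μ]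
    [TopologicalSpace X'] [CompactSpace X']
    [MeasurableSpace X'] [OpensMeasurableSpace X'] (μ' : Measure X') [IsFiniteMeasure μ']
    {β : Sym2 Λ → ℝ} {a : X → Grass Λ} {φ : X → (Gen Λ → ℝ) → ℝ}
    {a' : X' → Grass Λ} {φ' : X' → (Gen Λ → ℝ) → ℝ} (h : IsJet β a φ) (h' : IsJet β a' φ')
    (hφ : ∃ r, 0 < r ∧ ∀ v, ‖v‖ ≤ r → Integrable (fun x => φ x v) μ ∧
      Integrable (fun x => φ' x v) μ' ∧ ∫ x, φ x v ∂μ = ∫ x, φ' x v ∂μ') :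
    ∫ x, fermiIntL (a x) ∂μ = ∫ x, fermiIntL (a' x) ∂μ' := by
  obtain ⟨P, hP, C, r, hr, hb⟩ := h
  obtain ⟨P', hP', C', r', hr', hb'⟩ := h'
  obtain ⟨ρ, hρ, hφ⟩ := hφ
  let ℓ : MvPolynomial (Gen Λ) ℝ →ₗ[ℝ] ℝ := fermiIntL ∘ₗ
    (Subalgebra.center ℝ (Grass Λ)).val.toLinearMap ∘ₗ (evenEval β).toLinearMap
  have e : ∀ x, fermiIntL (a x) = ℓ (specialize x P) := fun x => by rw [← hP]; rfl
  have e' : ∀ x, fermiIntL (a' x) = ℓ (specialize x P') := fun x => by rw [← hP']; rfl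
  simp_rw [e, e']
  rw [(integral_linear_specialize μ P ℓ).2, (integral_linear_specialize μ' P' ℓ).2,
    ← sub_eq_zero, ← map_sub]
  set Q := ∑ m ∈ P.support, MvPolynomial.monomial m (∫ x, P.coeff m x ∂μ)
  set Q' := ∑ m ∈ P'.support, MvPolynomial.monomial m (∫ x, P'.coeff m x ∂μ')
  have key : evenEval β (Q - Q') = 0 := by
    refine aeval_eq_zero_of_bound _ (evenGen_sq β) _ (C * μ.real Set.univ + C' * μ'.real Set.univ)
      (min ρ (min r r')) (lt_min hρ (lt_min hr hr')) fun v hv => ?_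
    obtain ⟨hi, hi', heq⟩ := hφ v (hv.trans (min_le_left _ _))
    let E : MvPolynomial (Gen Λ) ℝ →ₗ[ℝ] ℝ := (MvPolynomial.aeval v).toLinearMap
    have hE : ∀ p, E p = MvPolynomial.eval v p := fun p => by
      simp [E, MvPolynomial.aeval_eq_eval]
    obtain ⟨j1, j2⟩ := integral_linear_specialize μ P E
    obtain ⟨j1', j2'⟩ := integral_linear_specialize μ' P' E
    have k1 : |∫ x, (φ x v - E (specialize x P)) ∂μ| ≤
        C * ‖v‖ ^ (Fintype.card (Gen Λ) + 1) * μ.real Set.univ := by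
      rw [← Real.norm_eq_abs]
      refine norm_integral_le_of_norm_le_const (Filter.Eventually.of_forall fun x => ?_)
      rw [hE]
      exact hb x v (hv.trans ((min_le_right _ _).trans (min_le_left _ _)))
    have k2 : |∫ x, (φ' x v - E (specialize x P')) ∂μ'| ≤
        C' * ‖v‖ ^ (Fintype.card (Gen Λ) + 1) * μ'.real Set.univ := by
      rw [← Real.norm_eq_abs]
      refine norm_integral_le_of_norm_le_const (Filter.Eventually.of_forall fun x => ?_)
      rw [hE]
      exact hb' x v (hv.trans ((min_le_right _ _).trans (min_le_right _ _)))
    rw [integral_sub hi j1, j2] at k1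
    rw [integral_sub hi' j1', j2', ← heq] at k2
    rw [← hE, map_sub]
    have : E Q - E Q' = (∫ x, φ x v ∂μ - E Q') - (∫ x, φ x v ∂μ - E Q) := by ring
    rw [this]
    refine (abs_sub _ _).trans ?_
    linarith
  change fermiIntL ((evenEval β (Q - Q') : Subalgebra.center ℝ (Grass Λ)) : Grass Λ) = 0
  rw [key]
  simp

end IntegralOfJets

/-! ### The horospherical substitution for real parameters -/

section ChangeOfVariables

variable {Λ : Type*} [Fintype Λ]

/-- Each coordinate is a bijection with inverse log(x + √(x² + w)). Its derivative is z = √(x² + w),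
which will cancel the factor 1/z of the model. -/
theorem integral_horospherical (w : Λ → ℝ) (hw : ∀ i, 0 < w i) (g : (Λ → ℝ) → ℝ) :
    ∫ x, g x = ∫ t : Λ → ℝ, (∏ i, (Real.exp (t i) + w i * Real.exp (-t i)) / 2) *
      g fun i => (Real.exp (t i) - w i * Real.exp (-t i)) / 2 := by
  classical
  let f : (Λ → ℝ) → (Λ → ℝ) := fun t i => (Real.exp (t i) - w i * Real.exp (-t i)) / 2
  let d : (Λ → ℝ) → Λ → ℝ := fun t i => (Real.exp (t i) + w i * Real.exp (-t i)) / 2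
  let f' : (Λ → ℝ) → (Λ → ℝ) →L[ℝ] (Λ → ℝ) := fun t =>
    ContinuousLinearMap.pi fun i => d t i • ContinuousLinearMap.proj i
  have h1 : ∀ i s, HasDerivAt (fun s => (Real.exp s - w i * Real.exp (-s)) / 2)
      ((Real.exp s + w i * Real.exp (-s)) / 2) s := by
    intro i s
    have h := ((Real.hasDerivAt_exp s).sub (((hasDerivAt_neg s).exp).const_mul (w i))).div_const 2
    exact h.congr_deriv (by ring)
  have hf' : ∀ t, HasFDerivAt f (f' t) t := by
    intro t
    refine hasFDerivAt_pi.2 fun i => ?_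
    have := (h1 i (t i)).comp_hasFDerivAt t (ContinuousLinearMap.proj (R := ℝ) (φ := fun _ : Λ => ℝ) i).hasFDerivAt
    exact this
  have hdet : ∀ t, (f' t).det = ∏ i, d t i := by
    intro t
    have : ((f' t : (Λ → ℝ) →L[ℝ] (Λ → ℝ)) : (Λ → ℝ) →ₗ[ℝ] (Λ → ℝ)) =
        Matrix.toLin' (Matrix.diagonal (d t)) := by
      ext v i
      simp [f', Matrix.mulVec_diagonal]
    rw [ContinuousLinearMap.det, this, LinearMap.det_toLin', Matrix.det_diagonal]
  have hdpos : ∀ t i, 0 < d t i := fun t i => by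
    have := hw i
    simp only [d]
    positivity
  have hinj : Function.Injective f := by
    intro t t' h
    funext i
    have hmono : StrictMono fun s => (Real.exp s - w i * Real.exp (-s)) / 2 :=
      strictMono_of_deriv_pos fun s => by
        rw [(h1 i s).deriv]
        have := hw i
        positivity
    exact hmono.injective (congrFun h i)
  have hsurj : f '' Set.univ = Set.univ := by
    rw [Set.image_univ, Set.range_eq_univ]
    intro x
    refine ⟨fun i => Real.log (x i + √(x i ^ 2 + w i)), funext fun i => ?_⟩
    have hs : 0 < x i ^ 2 + w i := by have := hw i; positivity
    have hlt : |x i| < √(x i ^ 2 + w i) := by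
      rw [← Real.sqrt_sq_eq_abs]
      exact Real.sqrt_lt_sqrt (sq_nonneg _) (by linarith [hw i])
    have hpos : 0 < x i + √(x i ^ 2 + w i) := by linarith [neg_abs_le (x i)]
    simp only [f]
    rw [Real.exp_neg, Real.exp_log hpos]
    field_simp
    nlinarith [Real.sq_sqrt hs.le]
  have := integral_image_eq_integral_abs_det_fderiv_smul volume MeasurableSet.univ
    (fun t _ => (hf' t).hasFDerivWithinAt) hinj.injOn g
  rw [hsurj, setIntegral_univ, setIntegral_univ] at this
  rw [this]
  refine integral_congr_ae (Filter.Eventually.of_forall fun t => ?_)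
  simp only [smul_eq_mul]
  rw [hdet, abs_of_pos (Finset.prod_pos fun i _ => hdpos t i)]

end ChangeOfVariables

end

end HoroH24

namespace HoroH24

noncomputable section

open MeasureTheory

/-! ### Jets of the forms of the model -/

section ModelJets

variable {Λ : Type*} [Fintype Λ] [DecidableEq Λ]

theorem IsJet.of_eq {X : Type*} [TopologicalSpace X] {β : Sym2 Λ → ℝ} {a a' : X → Grass Λ}
    {φ φ' : X → (Gen Λ → ℝ) → ℝ} (h : IsJet β a φ) (ha : ∀ x, a' x = a x)
    (hφ : ∀ x v, φ' x v = φ x v) : IsJet β a' φ' := by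
  obtain rfl : a' = a := funext ha
  obtain rfl : φ' = φ := funext fun x => funext (hφ x)
  exact h

/-- The real counterpart of `2 ξ_i^1 η_i^1 + 2 ξ_i^2 η_i^2`. -/
def pairSum (v : Gen Λ → ℝ) (i : Λ) : ℝ := 2 * (v (Sum.inl (i, 0)) + v (Sum.inl (i, 1)))

/-- The real counterpart of `z_i`. -/
def realZ (x y : Λ → ℝ) (v : Gen Λ → ℝ) (i : Λ) : ℝ := √(1 + x i ^ 2 + y i ^ 2 - pairSum v i)

/-- The real counterpart of the action. -/
def realAction (β : Sym2 Λ → ℝ) (h x y z : Λ → ℝ) (v : Gen Λ → ℝ) : ℝ :=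
  (1 / 2) * ∑ i, ∑ j, β s(i, j) *
      (x i ^ 2 + y i ^ 2 - pairSum v i - z i ^ 2 - (x i * x j + y i * y j - z i * z j))
    + ∑ b, v (Sum.inr b) + ∑ i, h i * (z i - 1)

omit [Fintype Λ] in
theorem eta_mul_xi (i j : Λ) (γ : Fin 2) : eta i γ * xi j γ = -(xi j γ * eta i γ) :=
  ι_mul_swap _ _

theorem coe_evenGen_inl (β : Sym2 Λ → ℝ) (i : Λ) (γ : Fin 2) :
    (evenGen β (Sum.inl (i, γ)) : Grass Λ) = xi i γ * eta i γ := by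
  simp [evenGen, coe_xiEta_single]

theorem coe_evenGen_inr (β : Sym2 Λ → ℝ) (i : Λ) (γ : Fin 2) :
    (evenGen β (Sum.inr (i, γ)) : Grass Λ) = ∑ j, β s(i, j) • (xi i γ * eta j γ) := by
  simp only [evenGen, Sum.elim_inr, coe_xiEta, etaVec_apply, map_sum, map_smul, Finset.mul_sum,
    mul_smul_comm]
  rfl

/-- The double sum runs over ordered pairs and β is symmetric, so ξ_i η_j and ξ_j η_i contribute
equally and combine into the second family of `evenGen`. This makes the action a function of those
generators. -/
theorem action_eq (β : Sym2 Λ → ℝ) (h : Λ → ℝ) (p : Config Λ) :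
    action β h p = (1 / 2 : ℝ) • ∑ i, ∑ j, β s(i, j) • (xf i p ^ 2 + yf i p ^ 2
        - (2 : ℝ) • (∑ γ, (evenGen β (Sum.inl (i, γ)) : Grass Λ)) - zf i p * zf i p
        - (xf i p * xf j p + yf i p * yf j p - zf i p * zf j p))
      + ∑ b : Λ × Fin 2, (evenGen β (Sum.inr b) : Grass Λ) + ∑ i, h i • (zf i p - 1) := by
  have hd : ∀ i j, dotf i i p - dotf i j p = (xf i p ^ 2 + yf i p ^ 2
        - (2 : ℝ) • (∑ γ, (evenGen β (Sum.inl (i, γ)) : Grass Λ)) - zf i p * zf i p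
        - (xf i p * xf j p + yf i p * yf j p - zf i p * zf j p))
        + ((∑ γ, xi i γ * eta j γ) + ∑ γ, xi j γ * eta i γ) := by
    intro i j
    simp only [dotf, coe_evenGen_inl, eta_mul_xi, Fin.sum_univ_two, two_smul, sq]
    abel
  rw [action]
  simp_rw [hd, smul_add, Finset.sum_add_distrib, smul_add]
  have hs : ∑ i, ∑ j, β s(i, j) • (∑ γ, xi j γ * eta i γ) =
      ∑ i, ∑ j, β s(i, j) • (∑ γ, xi i γ * eta j γ) := by
    rw [Finset.sum_comm]
    simp_rw [Sym2.eq_swap]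
  have hl : ∑ b : Λ × Fin 2, (evenGen β (Sum.inr b) : Grass Λ) =
      ∑ i, ∑ j, β s(i, j) • (∑ γ, xi i γ * eta j γ) := by
    rw [Fintype.sum_prod_type]
    refine Finset.sum_congr rfl fun i _ => ?_
    simp_rw [coe_evenGen_inr, Finset.smul_sum]
    rw [Finset.sum_comm]
  rw [hs, hl, ← add_smul]
  norm_num

variable {X : Type*} [TopologicalSpace X] [CompactSpace X] {β : Sym2 Λ → ℝ} {h : Λ → ℝ}
  {p : X → Config Λ}

omit [CompactSpace X] in
theorem isJet_xf (hp : Continuous p) (i : Λ) :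
    IsJet β (fun q => xf i (p q)) (fun q _ => (p q).1 i) :=
  isJet_const ⟨fun q => (p q).1 i, by fun_prop⟩

omit [CompactSpace X] in
theorem isJet_yf (hp : Continuous p) (i : Λ) :
    IsJet β (fun q => yf i (p q)) (fun q _ => (p q).2 i) :=
  isJet_const ⟨fun q => (p q).2 i, by fun_prop⟩

theorem isJet_zf (hp : Continuous p) (i : Λ) :
    IsJet β (fun q => zf i (p q)) (fun q v => realZ (p q).1 (p q).2 v i) := by
  refine IsJet.applyOne Real.sqrt (Set.Ioi 0) isOpen_Ioi
    (fun x hx => (Real.contDiffAt_sqrt (ne_of_gt hx)).contDiffWithinAt)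
    (a := fun q => 1 + xf i (p q) ^ 2 + yf i (p q) ^ 2 + ∑ γ : Fin 2, (-2 : ℝ) • (xi i γ * eta i γ))
    (φ := fun q v => 1 + (p q).1 i ^ 2 + (p q).2 i ^ 2 - pairSum v i) ?_ ?_
  · have h1 := ((isJet_const (X := X) (β := β) 1).add ((isJet_xf hp i).mul (isJet_xf hp i))).add
      ((isJet_yf hp i).mul (isJet_yf hp i))
    have h2 := IsJet.sum Finset.univ fun γ : Fin 2 =>
      (isJet_evenGen (X := X) (β := β) (Sum.inl (i, γ))).const_smul (ContinuousMap.const X (-2))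
    refine (h1.add h2).of_eq (fun q => ?_) (fun q v => ?_)
    · simp [coe_evenGen_inl, sq]
    · simp [pairSum, sq]
      ring
  · intro q
    simp only [pairSum, Set.mem_Ioi, Pi.zero_apply]
    nlinarith [sq_nonneg ((p q).1 i), sq_nonneg ((p q).2 i)]

theorem isJet_action (hp : Continuous p) :
    IsJet β (fun q => action β h (p q))
      (fun q v => realAction β h (p q).1 (p q).2 (realZ (p q).1 (p q).2 v) v) := by
  have h1 : ∀ i j, _ := fun i j => ((((((isJet_xf (β := β) hp i).mul (isJet_xf hp i)).add
      ((isJet_yf hp i).mul (isJet_yf hp i))).sub ((IsJet.sum Finset.univ fun γ : Fin 2 =>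
      isJet_evenGen (X := X) (β := β) (Sum.inl (i, γ))).const_smul (ContinuousMap.const X 2))).sub
      ((isJet_zf hp i).mul (isJet_zf hp i))).sub ((((isJet_xf hp i).mul (isJet_xf hp j)).add
      ((isJet_yf hp i).mul (isJet_yf hp j))).sub
      ((isJet_zf hp i).mul (isJet_zf hp j)))).const_smul (ContinuousMap.const X (β s(i, j)))
  have h2 := (IsJet.sum Finset.univ fun i => IsJet.sum Finset.univ fun j =>
    h1 i j).const_smul (ContinuousMap.const X (1 / 2))
  have h3 := IsJet.sum Finset.univ fun b : Λ × Fin 2 =>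
    isJet_evenGen (X := X) (β := β) (Sum.inr b)
  have h4 := IsJet.sum Finset.univ fun i => ((isJet_zf (β := β) hp i).sub
    (isJet_const (X := X) 1)).const_smul (ContinuousMap.const X (h i))
  refine ((h2.add h3).add h4).of_eq (fun q => ?_) (fun q v => ?_)
  · rw [action_eq]
    simp [sq]
  · simp [realAction, pairSum, sq]

theorem isJet_integrand (hp : Continuous p) {obs : Config Λ → Grass Λ}
    {f : (Λ → ℝ) → (Λ → ℝ) → ℝ} (hobs : IsJet β (fun q => obs (p q))
      (fun q v => f (fun i => (p q).1 i + realZ (p q).1 (p q).2 v i) (p q).2)) :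
    IsJet β (fun q => applyMany (fun v : Λ → ℝ => ∏ i, (v i)⁻¹) (fun i => zf i (p q)) *
        (obs (p q) * applyOne Real.exp (-action β h (p q))))
      (fun q v => (∏ i, (realZ (p q).1 (p q).2 v i)⁻¹) *
        (f (fun i => (p q).1 i + realZ (p q).1 (p q).2 v i) (p q).2 *
        Real.exp (-realAction β h (p q).1 (p q).2 (realZ (p q).1 (p q).2 v) v))) := by
  refine IsJet.mul ?_ (hobs.mul ?_)
  · refine IsJet.applyMany (fun v : Λ → ℝ => ∏ i, (v i)⁻¹) {v | ∀ i, 0 < v i} ?_ ?_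
      (fun i => isJet_zf hp i) ?_
    · simp only [Set.ofPred_forall]
      exact isOpen_iInter_of_finite fun i => isOpen_lt continuous_const (continuous_apply i)
    · intro v hv
      refine ContDiffAt.contDiffWithinAt ?_
      refine contDiffAt_prod fun i _ => ?_
      exact (contDiff_apply ℝ ℝ i).contDiffAt.inv (hv i).ne'
    · intro q i
      refine Real.sqrt_pos.2 ?_
      simp only [pairSum, Pi.zero_apply]
      nlinarith [sq_nonneg ((p q).1 i), sq_nonneg ((p q).2 i)]
  · exact IsJet.applyOne Real.exp Set.univ isOpen_univ Real.contDiff_exp.contDiffOn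
      (isJet_action hp).neg fun q => trivial

theorem isJet_obsT (hp : Continuous p) {F : (Λ → ℝ) → ℝ} (hF : ContDiff ℝ ∞ F) :
    IsJet β (fun q => obsT F (p q))
      (fun q v => F (fun i => (p q).1 i + realZ (p q).1 (p q).2 v i)) :=
  IsJet.applyMany F Set.univ isOpen_univ hF.contDiffOn
    (fun i => (isJet_xf hp i).add (isJet_zf hp i)) fun _ => trivial

theorem isJet_obsTS (hp : Continuous p) {F : (Λ ⊕ Λ → ℝ) → ℝ} (hF : ContDiff ℝ ∞ F) :
    IsJet β (fun q => obsTS F (p q))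
      (fun q v => F (Sum.elim (fun i => (p q).1 i + realZ (p q).1 (p q).2 v i) (p q).2)) := by
  have := IsJet.applyMany (β := β) F Set.univ isOpen_univ hF.contDiffOn
    (b := fun k q => (Sum.elim (fun i => xf i (p q) + zf i (p q)) (fun i => yf i (p q)) : _) k)
    (ψ := fun k q v =>
      (Sum.elim (fun i => (p q).1 i + realZ (p q).1 (p q).2 v i) (p q).2 : Λ ⊕ Λ → ℝ) k)
    (fun k => by
      rcases k with i | i
      · exact (isJet_xf hp i).add (isJet_zf hp i)
      · exact isJet_yf hp i) fun _ => trivial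
  exact this

end ModelJets

end

end HoroH24

namespace HoroH24

noncomputable section

open MeasureTheory

/-! ### Forms in horospherical coordinates -/

section HorosphericalJets

variable {Λ : Type*} [Fintype Λ] [DecidableEq Λ]

/-- The diagonal entries `∑_j β_{ij} e^{t_j - t_i} + h_i e^{-t_i}`. -/
def horoDiag (β : Sym2 Λ → ℝ) (h t : Λ → ℝ) (i : Λ) : ℝ :=
  ∑ j, β s(i, j) * Real.exp (t j - t i) + h i * Real.exp (-t i)

/-- The matrix `e^{-t} (-Δ_{β(t),h(t)}) e^{-t}`. -/
def horoMat (β : Sym2 Λ → ℝ) (h t : Λ → ℝ) : Λ → Λ → ℝ :=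
  fun i => horoDiag β h t i • (Pi.single i 1 : Λ → ℝ) - fun j => β s(i, j)

/-- The purely bosonic part of the action in the coordinates `(t, y)`. -/
def horoRest (β : Sym2 Λ → ℝ) (h t y : Λ → ℝ) : ℝ :=
  (1 / 2) * ∑ i, ∑ j, β s(i, j) * (-1 - y i * y j + (1 / 2) *
      (Real.exp (t i - t j) * (1 + y j ^ 2) + Real.exp (t j - t i) * (1 + y i ^ 2)))
    + ∑ i, h i * ((Real.exp (t i) + (1 + y i ^ 2) * Real.exp (-t i)) / 2 - 1)

-- The products of two factors w cancel, since z² - x² = w and z_i z_j - x_i x_j is linear in w_i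
-- and w_j. The result is affine in v, which is why the exponential factorises over the generators.
omit [DecidableEq Λ] in
theorem realAction_horospherical (β : Sym2 Λ → ℝ) (h t y : Λ → ℝ) (v : Gen Λ → ℝ) :
    realAction β h (fun i => (Real.exp (t i) - (1 + y i ^ 2 - pairSum v i) * Real.exp (-t i)) / 2) y
      (fun i => (Real.exp (t i) + (1 + y i ^ 2 - pairSum v i) * Real.exp (-t i)) / 2) v =
    horoRest β h t y - ∑ b : Λ × Fin 2,
      (horoDiag β h t b.1 * v (Sum.inl b) - v (Sum.inr b)) := by
  have h1 : ∀ i j, ((Real.exp (t i) - (1 + y i ^ 2 - pairSum v i) * Real.exp (-t i)) / 2) ^ 2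
      + y i ^ 2 - pairSum v i
      - ((Real.exp (t i) + (1 + y i ^ 2 - pairSum v i) * Real.exp (-t i)) / 2) ^ 2 -
      ((Real.exp (t i) - (1 + y i ^ 2 - pairSum v i) * Real.exp (-t i)) / 2 *
      ((Real.exp (t j) - (1 + y j ^ 2 - pairSum v j) * Real.exp (-t j)) / 2) + y i * y j -
      (Real.exp (t i) + (1 + y i ^ 2 - pairSum v i) * Real.exp (-t i)) / 2 *
      ((Real.exp (t j) + (1 + y j ^ 2 - pairSum v j) * Real.exp (-t j)) / 2)) =
      (-1 - y i * y j + (1 / 2) * (Real.exp (t i - t j) * (1 + y j ^ 2) +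
        Real.exp (t j - t i) * (1 + y i ^ 2))) - (1 / 2) * (Real.exp (t i - t j) * pairSum v j)
        - (1 / 2) * (Real.exp (t j - t i) * pairSum v i) := by
    intro i j
    have hi : Real.exp (t i) * Real.exp (-t i) = 1 := by rw [← Real.exp_add]; simp
    rw [sub_eq_add_neg (t i), sub_eq_add_neg (t j), Real.exp_add, Real.exp_add]
    linear_combination (-(1 + y i ^ 2 - pairSum v i)) * hi
  simp only [realAction, horoRest]
  simp_rw [h1, mul_sub, Finset.sum_sub_distrib]
  have hs : ∑ i, ∑ j, β s(i, j) * ((1 / 2) * (Real.exp (t i - t j) * pairSum v j)) =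
      ∑ i, ∑ j, β s(i, j) * ((1 / 2) * (Real.exp (t j - t i) * pairSum v i)) := by
    rw [Finset.sum_comm]
    simp_rw [Sym2.eq_swap]
  have hd : ∑ b : Λ × Fin 2, horoDiag β h t b.1 * v (Sum.inl b) =
      (∑ i, ∑ j, β s(i, j) * ((1 / 2) * (Real.exp (t j - t i) * pairSum v i))) +
      ∑ i, h i * (Real.exp (-t i) * pairSum v i / 2) := by
    rw [Fintype.sum_prod_type, ← Finset.sum_add_distrib]
    refine Finset.sum_congr rfl fun i _ => ?_
    rw [Fin.sum_univ_two, ← mul_add]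
    have : v (Sum.inl (i, 0)) + v (Sum.inl (i, 1)) = pairSum v i / 2 := by rw [pairSum]; ring
    rw [this, horoDiag, add_mul, Finset.sum_mul]
    congr 1
    · exact Finset.sum_congr rfl fun j _ => by ring
    · ring
  have hh : ∑ i, h i * ((Real.exp (t i) + (1 + y i ^ 2 - pairSum v i) * Real.exp (-t i)) / 2) =
      (∑ i, h i * ((Real.exp (t i) + (1 + y i ^ 2) * Real.exp (-t i)) / 2)) -
      ∑ i, h i * (Real.exp (-t i) * pairSum v i / 2) := by
    rw [← Finset.sum_sub_distrib]
    exact Finset.sum_congr rfl fun i _ => by ring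
  rw [hs, hd, hh]
  ring

omit [DecidableEq Λ] in
theorem applyOne_of_soul_sq (f : ℝ → ℝ) (a : Grass Λ) [Nonempty Λ] (h : soul a ^ 2 = 0) :
    applyOne f a = algebraMap ℝ _ (f (body a)) + deriv f (body a) • soul a := by
  -- Nonemptiness of Λ guarantees that the truncation order 4|Λ| reaches the terms that are kept.
  have hc : 2 ≤ Fintype.card (Gen Λ) + 1 := by
    have := Fintype.card_pos (α := Λ)
    simp only [Fintype.card_sum, Fintype.card_prod, Fintype.card_fin]
    omega
  rw [applyOne, ← Finset.sum_subset (Finset.range_mono hc)]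
  · simp [Finset.sum_range_succ, Algebra.algebraMap_eq_smul_one]
  · intro k _ hk
    rw [Finset.mem_range, not_lt] at hk
    rw [pow_eq_zero_of_le hk h, smul_zero]

omit [DecidableEq Λ] in
theorem applyOne_of_soul_cube (f : ℝ → ℝ) (a : Grass Λ) [Nonempty Λ] (h : soul a ^ 3 = 0) :
    applyOne f a = algebraMap ℝ _ (f (body a)) + deriv f (body a) • soul a
      + (iteratedDeriv 2 f (body a) / 2) • soul a ^ 2 := by
  have hc : 3 ≤ Fintype.card (Gen Λ) + 1 := by
    have := Fintype.card_pos (α := Λ)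
    simp only [Fintype.card_sum, Fintype.card_prod, Fintype.card_fin]
    omega
  rw [applyOne, ← Finset.sum_subset (Finset.range_mono hc)]
  · simp [Finset.sum_range_succ, Algebra.algebraMap_eq_smul_one, div_eq_inv_mul]
  · intro k _ hk
    rw [Finset.mem_range, not_lt] at hk
    rw [pow_eq_zero_of_le hk h, smul_zero]

omit [Fintype Λ] [DecidableEq Λ] in
theorem body_add (a b : Grass Λ) : body (a + b) = body a + body b := map_add _ _ _

omit [Fintype Λ] [DecidableEq Λ] in
theorem body_smul (c : ℝ) (a : Grass Λ) : body (c • a) = c * body a := by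
  simp [body]

omit [Fintype Λ] [DecidableEq Λ] in
theorem body_algebraMap (c : ℝ) : body (algebraMap ℝ (Grass Λ) c) = c := by
  simp [body]

variable {X : Type*} [TopologicalSpace X] [CompactSpace X] {β : Sym2 Λ → ℝ} {h : Λ → ℝ}
  {t : X → Λ → ℝ}

omit [CompactSpace X] in
theorem IsJet.finset_prod {κ : Type*} (s : Finset κ) {c : κ → X → Subalgebra.center ℝ (Grass Λ)}
    {ψ : κ → X → (Gen Λ → ℝ) → ℝ} [CompactSpace X]
    (hc : ∀ k, IsJet β (fun x => (c k x : Grass Λ)) (ψ k)) :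
    IsJet β (fun x => ((∏ k ∈ s, c k x : Subalgebra.center ℝ (Grass Λ)) : Grass Λ))
      (fun x v => ∏ k ∈ s, ψ k x v) := by
  classical
  induction s using Finset.induction_on with
  | empty => simpa using isJet_const (X := X) (β := β) 1
  | insert k s hk ih => simpa [Finset.prod_insert hk] using (hc k).mul ih

/-- The value and the first two derivatives, along the fibres of the change of variables, of a
function of `x_i`. -/
def cutJet (θ : ℝ → ℝ) (t y : ℝ) : Fin 3 → ℝ :=
  ![θ ((Real.exp t - (1 + y ^ 2) * Real.exp (-t)) / 2),
    deriv θ ((Real.exp t - (1 + y ^ 2) * Real.exp (-t)) / 2) * Real.exp (-t),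
    iteratedDeriv 2 θ ((Real.exp t - (1 + y ^ 2) * Real.exp (-t)) / 2) * Real.exp (-t) ^ 2]

theorem add_sq_of_mul_self {R : Type*} [CommRing R] {a b : R} (ha : a * a = 0) (hb : b * b = 0) :
    (a + b) ^ 2 = 2 * (a * b) := by
  linear_combination ha + hb

theorem add_cube_of_mul_self {R : Type*} [CommRing R] {a b : R} (ha : a * a = 0)
    (hb : b * b = 0) : (a + b) ^ 3 = 0 := by
  linear_combination (a + 3 * b) * ha + (b + 3 * a) * hb

/-- In the new coordinates x equals its body plus e^{-t}(n_0 + n_1) with n_γ = ξ^γ η^γ. The cube of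
n_0 + n_1 vanishes, and its square 2 n_0 n_1 cancels the factor 1/2 of the second Taylor term. -/
theorem isJet_cutoff [Nonempty Λ] (ht : Continuous t) (θ : ℝ → ℝ) (hθ : ContDiff ℝ ∞ θ) (y : ℝ)
    (i : Λ) : IsJet β (fun q =>
      ((algebraMap ℝ _ (cutJet θ (t q i) y 0) + algebraMap ℝ _ (cutJet θ (t q i) y 1) *
        (xiEta i 0 (Pi.single i 1) + xiEta i 1 (Pi.single i 1)) +
        algebraMap ℝ _ (cutJet θ (t q i) y 2) *
        (xiEta i 0 (Pi.single i 1) * xiEta i 1 (Pi.single i 1)) :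
        Subalgebra.center ℝ (Grass Λ)) : Grass Λ))
      (fun q v => θ ((Real.exp (t q i) - (1 + y ^ 2 - pairSum v i) * Real.exp (-t q i)) / 2)) := by
  set x0 : X → ℝ := fun q => (Real.exp (t q i) - (1 + y ^ 2) * Real.exp (-t q i)) / 2 with hx0
  set n : Subalgebra.center ℝ (Grass Λ) := xiEta i 0 (Pi.single i 1) + xiEta i 1 (Pi.single i 1)
    with hn
  have hn2 : n ^ 2 = 2 * (xiEta i 0 (Pi.single i 1) * xiEta i 1 (Pi.single i 1)) := by
    have h0 := xiEta_mul_self i 0 (Pi.single i 1) (Pi.single i 1)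
    have h1 := xiEta_mul_self i 1 (Pi.single i 1) (Pi.single i 1)
    exact add_sq_of_mul_self h0 h1
  have hn3 : n ^ 3 = 0 := by
    have h0 := xiEta_mul_self i 0 (Pi.single i 1) (Pi.single i 1)
    have h1 := xiEta_mul_self i 1 (Pi.single i 1) (Pi.single i 1)
    exact add_cube_of_mul_self h0 h1
  have hjet : IsJet β (fun q => algebraMap ℝ (Grass Λ) (x0 q) + Real.exp (-t q i) • (n : Grass Λ))
      (fun q v => (Real.exp (t q i) - (1 + y ^ 2 - pairSum v i) * Real.exp (-t q i)) / 2) := by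
    have h1 := ((isJet_evenGen (X := X) (β := β) (Sum.inl (i, 0))).add
      (isJet_evenGen (X := X) (β := β) (Sum.inl (i, 1)))).const_smul
        ⟨fun q => Real.exp (-t q i), by fun_prop⟩
    refine ((isJet_const ⟨x0, by fun_prop⟩).add h1).of_eq (fun q => ?_) fun q v => ?_
    · simp [hn, evenGen]
    · simp [hx0, pairSum]
      ring
  refine (hjet.applyOne θ Set.univ isOpen_univ hθ.contDiffOn fun _ => trivial).of_eq
    (fun q => ?_) fun q v => rfl
  have hb : body (algebraMap ℝ (Grass Λ) (x0 q) + Real.exp (-t q i) • (n : Grass Λ)) = x0 q := by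
    rw [body_add, body_smul, body_algebraMap, hn, Subalgebra.coe_add, body_add, body_xiEta,
      body_xiEta]
    ring
  have hs : soul (algebraMap ℝ (Grass Λ) (x0 q) + Real.exp (-t q i) • (n : Grass Λ)) =
      Real.exp (-t q i) • (n : Grass Λ) := by
    rw [soul, hb]; abel
  have hn2' : (n : Grass Λ) ^ 2 = 2 *
      ((xiEta i 0 (Pi.single i 1) : Grass Λ) * (xiEta i 1 (Pi.single i 1) : Grass Λ)) := by
    have := congrArg Subtype.val hn2
    simpa using! this
  have hn3' : (n : Grass Λ) ^ 3 = 0 := by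
    have := congrArg Subtype.val hn3
    simpa using! this
  rw [applyOne_of_soul_cube θ _ (by rw [hs, smul_pow, hn3', smul_zero]), hb, hs, smul_pow, hn2']
  have h2 : ∀ a : Grass Λ, 2 * a = (2 : ℝ) • a := fun a => by rw [two_mul, two_smul]
  simp only [cutJet, Subalgebra.coe_add, Subalgebra.coe_algebraMap,
    ← Algebra.smul_def, h2, smul_smul, Matrix.cons_val_zero, Matrix.cons_val_one,
    Matrix.cons_val_two, Matrix.tail_cons, Matrix.head_cons]
  rw [show iteratedDeriv 2 θ (x0 q) / 2 * (Real.exp (-t q i) ^ 2 * 2) =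
    iteratedDeriv 2 θ (x0 q) * Real.exp (-t q i) ^ 2 by ring]
  rfl

/-- The exponent becomes ξ_b paired with a row of `horoMat`, which squares to zero, so its
exponential is linear. -/
theorem isJet_exp_site [Nonempty Λ] (ht : Continuous t) (b : Λ × Fin 2) :
    IsJet β (fun q => ((1 + xiEta b.1 b.2 (horoMat β h (t q) b.1) :
      Subalgebra.center ℝ (Grass Λ)) : Grass Λ))
      (fun q v => Real.exp (horoDiag β h (t q) b.1 * v (Sum.inl b) - v (Sum.inr b))) := by
  have hc : Continuous fun q => horoDiag β h (t q) b.1 := by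
    unfold horoDiag; fun_prop
  have hjet := ((isJet_evenGen (X := X) (β := β) (Sum.inl b)).const_smul ⟨_, hc⟩).sub
    (isJet_evenGen (X := X) (β := β) (Sum.inr b))
  refine (hjet.applyOne Real.exp Set.univ isOpen_univ Real.contDiff_exp.contDiffOn
    fun _ => trivial).of_eq (fun q => ?_) fun q v => rfl
  have e : horoDiag β h (t q) b.1 • (evenGen β (Sum.inl b) : Grass Λ) -
      (evenGen β (Sum.inr b) : Grass Λ) = (xiEta b.1 b.2 (horoMat β h (t q) b.1) : Grass Λ) := by
    rw [horoMat, map_sub, map_smul]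
    rfl
  have hb : body (xiEta b.1 b.2 (horoMat β h (t q) b.1) : Grass Λ) = 0 := body_xiEta _ _ _
  have hs : soul (xiEta b.1 b.2 (horoMat β h (t q) b.1) : Grass Λ) =
      (xiEta b.1 b.2 (horoMat β h (t q) b.1) : Grass Λ) := by
    rw [soul, hb, map_zero, sub_zero]
  have hsq := congrArg Subtype.val
    (xiEta_mul_self b.1 b.2 (horoMat β h (t q) b.1) (horoMat β h (t q) b.1))
  change _ = applyOne Real.exp (horoDiag β h (t q) b.1 • (evenGen β (Sum.inl b) : Grass Λ) -
      (evenGen β (Sum.inr b) : Grass Λ))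
  rw [e, applyOne_of_soul_sq _ _ (by rw [hs, sq]; exact hsq), hb, hs]
  simp

end HorosphericalJets

end

end HoroH24

namespace HoroH24

noncomputable section

open MeasureTheory

/-! ### The change of variables in the presence of cutoffs -/

section CutoffIdentity

attribute [local instance] Measure.Subtype.measureSpace

variable {Λ : Type*} [Fintype Λ] [DecidableEq Λ]

/-- The form integrated in `[obs]_{β,h}`, before the fermionic integration. -/
def integrandForm (β : Sym2 Λ → ℝ) (h : Λ → ℝ) (obs : Config Λ → Grass Λ) (p : Config Λ) :
    Grass Λ :=
  applyMany (fun v : Λ → ℝ => ∏ i, (v i)⁻¹) (fun i => zf i p) *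
    (obs p * applyOne Real.exp (-action β h p))

/-- The fermionic integral that remains, in horospherical coordinates, in the presence of the
cutoffs `θ i`. -/
def cutBerezin (β : Sym2 Λ → ℝ) (h y : Λ → ℝ) (θ : Λ → ℝ → ℝ) (t : Λ → ℝ) : ℝ :=
  ∑ c : Λ → Bool × Bool, (∏ i, pick (cutJet (θ i) (t i) (y i)) (c i)) *
        ((Matrix.of (replaceRows (horoMat β h t) fun i => (c i).1)).det *
          (Matrix.of (replaceRows (horoMat β h t) fun i => (c i).2)).det)

/-- The cutoff vanishes on a neighbourhood, hence so do the derivatives that enter `cutJet`. -/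
theorem cutBerezin_eq_zero {β : Sym2 Λ → ℝ} {h y t : Λ → ℝ} {θ : Λ → ℝ → ℝ} {R : ℝ} (i : Λ)
    (hR : ∀ x, R < |x| → θ i x = 0)
    (hi : R < |(Real.exp (t i) - (1 + y i ^ 2) * Real.exp (-t i)) / 2|) :
    cutBerezin β h y θ t = 0 := by
  have hev : θ i =ᶠ[nhds ((Real.exp (t i) - (1 + y i ^ 2) * Real.exp (-t i)) / 2)]
      fun _ => 0 := by
    filter_upwards [(isOpen_lt continuous_const continuous_abs).mem_nhds hi] with x hx
    exact hR x hx
  have hk : ∀ n, cutJet (θ i) (t i) (y i) n = 0 := by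
    intro n
    have h2 := (hev.iteratedDeriv 2).eq_of_nhds
    have h1 := hev.deriv_eq
    have h0 := hev.eq_of_nhds
    rw [iteratedDeriv_const] at h2
    fin_cases n <;> simp [cutJet, h0, h1, h2]
  refine Finset.sum_eq_zero fun c _ => ?_
  rw [Finset.prod_eq_zero (Finset.mem_univ i), zero_mul]
  rcases c i with ⟨_ | _, _ | _⟩ <;> simp [pick, hk]

omit [Fintype Λ] [DecidableEq Λ] in
theorem realZ_horospherical (t y : Λ → ℝ) (v : Gen Λ → ℝ) (i : Λ)
    (hw : 0 < 1 + y i ^ 2 - pairSum v i) :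
    realZ (fun i => (Real.exp (t i) - (1 + y i ^ 2 - pairSum v i) * Real.exp (-t i)) / 2) y v i =
      (Real.exp (t i) + (1 + y i ^ 2 - pairSum v i) * Real.exp (-t i)) / 2 := by
  have hi : Real.exp (t i) * Real.exp (-t i) = 1 := by rw [← Real.exp_add]; simp
  rw [realZ, Real.sqrt_eq_iff_mul_self_eq_of_pos (by positivity)]
  linear_combination (1 + y i ^ 2 - pairSum v i) * hi

/-- For fixed y the cutoffs confine x and t to closed balls, uniformly in small v. The real
substitution holds for each such v, so `IsJet.integral_congr` applies, and the horospherical side is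
evaluated by `fermiIntL_site_prod`. -/
theorem integral_cutoff_form [Nonempty Λ] (β : Sym2 Λ → ℝ) (h y : Λ → ℝ)
    (obs : Config Λ → Grass Λ) (f : (Λ → ℝ) → ℝ) (hf : Continuous f)
    (hobs : ∀ R, IsJet β (fun q : Metric.closedBall (0 : Λ → ℝ) R => obs (q.1, y))
      (fun q v => f fun i => q.1 i + realZ q.1 y v i))
    (θ : Λ → ℝ → ℝ) (hθ : ∀ i, ContDiff ℝ ∞ (θ i)) (R : ℝ)
    (hR : ∀ i x, R < |x| → θ i x = 0) :
    ∫ x : Λ → ℝ, (∏ i, θ i (x i)) * fermiIntL (integrandForm β h obs (x, y)) =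
      ∫ t : Λ → ℝ, f (fun i => Real.exp (t i)) * Real.exp (-horoRest β h t y) *
        cutBerezin β h y θ t := by
  classical
  set X := Metric.closedBall (0 : Λ → ℝ) R
  -- Upper bound for w = 1 + y_i² - n at every site when |n| ≤ 1/2; the lower bound is 1/2.
  set W : ℝ := 3 / 2 + ∑ i, y i ^ 2 with hW
  have hWy : ∀ i, y i ^ 2 ≤ ∑ i, y i ^ 2 := fun i =>
    Finset.single_le_sum (f := fun i => y i ^ 2) (fun i _ => sq_nonneg (y i)) (Finset.mem_univ i)
  have hW0 : 0 < W := by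
    have := Finset.sum_nonneg fun i (_ : i ∈ Finset.univ) => sq_nonneg (y i)
    linarith
  -- Chosen so that |t_i| > log M forces |x_i| > R: one of e^{t_i} and e^{-t_i} exceeds M while the
  -- other is at most 1, and 1/2 ≤ w ≤ W.
  set M : ℝ := 4 * |R| + 2 * W + 4 with hM
  have hM0 : 0 < M := by positivity
  set T := Real.log M with hT
  have hexpT : Real.exp T = M := Real.exp_log hM0
  have hT0 : 0 ≤ T := Real.log_nonneg (by rw [hM]; linarith [abs_nonneg R])
  set X' := Metric.closedBall (0 : Λ → ℝ) T
  have hpair : ∀ (v : Gen Λ → ℝ) (i : Λ), ‖v‖ ≤ 1 / 8 → |pairSum v i| ≤ 1 / 2 := by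
    intro v i hv
    have h0 := (norm_le_pi_norm v (Sum.inl (i, 0))).trans hv
    have h1 := (norm_le_pi_norm v (Sum.inl (i, 1))).trans hv
    rw [Real.norm_eq_abs, abs_le] at h0 h1
    rw [pairSum, abs_le]
    constructor <;> linarith [h0.1, h0.2, h1.1, h1.2]
  have houtX : ∀ x : Λ → ℝ, x ∉ X → ∏ i, θ i (x i) = 0 := by
    intro x hx
    obtain ⟨i, hi⟩ : ∃ i, R < |x i| := by
      by_contra! hle
      exact hx (by
        rw [mem_closedBall_zero_iff]
        exact (pi_norm_le_iff_of_nonempty _).2 hle)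
    exact Finset.prod_eq_zero (Finset.mem_univ i) (hR i _ hi)
  have houtX' : ∀ t : Λ → ℝ, t ∉ X' → ∃ i, ∀ n, |n| ≤ 1 / 2 →
      R < |(Real.exp (t i) - (1 + y i ^ 2 - n) * Real.exp (-t i)) / 2| := by
    intro t ht
    obtain ⟨i, hi⟩ : ∃ i, T < |t i| := by
      by_contra! hle
      exact ht (by
        rw [mem_closedBall_zero_iff]
        exact (pi_norm_le_iff_of_nonempty _).2 hle)
    refine ⟨i, fun n hn => ?_⟩
    rw [abs_le] at hn
    have hw1 : 1 / 2 ≤ 1 + y i ^ 2 - n := by linarith [sq_nonneg (y i), hn.2]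
    have hw2 : 1 + y i ^ 2 - n ≤ W := by linarith [hWy i, hn.1]
    have hR' := le_abs_self R
    rcases lt_abs.1 hi with hi | hi
    · have h1 : M < Real.exp (t i) := by rw [← hexpT]; exact Real.exp_lt_exp.2 hi
      have h2 : Real.exp (-t i) ≤ 1 := Real.exp_le_one_iff.2 (by linarith)
      have h3 : (1 + y i ^ 2 - n) * Real.exp (-t i) ≤ W * 1 :=
        mul_le_mul hw2 h2 (Real.exp_pos _).le hW0.le
      refine lt_of_lt_of_le ?_ (le_abs_self _)
      linarith [abs_nonneg R]
    · have h1 : M < Real.exp (-t i) := by rw [← hexpT]; exact Real.exp_lt_exp.2 hi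
      have h2 : Real.exp (t i) ≤ 1 := Real.exp_le_one_iff.2 (by linarith)
      have h3 : 1 / 2 * Real.exp (-t i) ≤ (1 + y i ^ 2 - n) * Real.exp (-t i) :=
        mul_le_mul_of_nonneg_right hw1 (Real.exp_pos _).le
      refine lt_of_lt_of_le ?_ (neg_le_abs _)
      linarith [abs_nonneg R]
  have : CompactSpace X := isCompact_iff_compactSpace.1 (isCompact_closedBall _ _)
  have : CompactSpace X' := isCompact_iff_compactSpace.1 (isCompact_closedBall _ _)
  have hmX : MeasurableSet X := Metric.isClosed_closedBall.measurableSet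
  have hmX' : MeasurableSet X' := Metric.isClosed_closedBall.measurableSet
  have hsub : ∀ (S : Set (Λ → ℝ)) (_ : MeasurableSet S) (g : (Λ → ℝ) → ℝ),
      (∀ x ∉ S, g x = 0) → ∫ x : S, g x = ∫ x, g x := by
    intro S hS g hg
    rw [← setIntegral_eq_integral_of_forall_compl_eq_zero hg]
    exact integral_subtype_comap hS g
  have : IsFiniteMeasure (volume : Measure X) := ⟨by
    rw [Measure.Subtype.volume_univ hmX.nullMeasurableSet]
    exact measure_closedBall_lt_top⟩
  have : IsFiniteMeasure (volume : Measure X') := ⟨by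
    rw [Measure.Subtype.volume_univ hmX'.nullMeasurableSet]
    exact measure_closedBall_lt_top⟩
  -- the jets of the two families
  have hJ : IsJet β (fun q : X => (∏ i, θ i (q.1 i)) • integrandForm β h obs (q.1, y))
      (fun q v => (∏ i, θ i (q.1 i)) * ((∏ i, (realZ q.1 y v i)⁻¹) *
        (f (fun i => q.1 i + realZ q.1 y v i) *
        Real.exp (-realAction β h q.1 y (realZ q.1 y v) v)))) := by
    have hp : Continuous fun q : X => ((q.1, y) : Config Λ) := by fun_prop
    have h1 := isJet_integrand (β := β) (h := h) hp (obs := obs) (f := fun u _ => f u) (hobs R)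
    exact h1.const_smul ⟨fun q : X => ∏ i, θ i (q.1 i), continuous_finsetProd _ fun i _ =>
      (hθ i).continuous.comp ((continuous_apply i).comp continuous_subtype_val)⟩
  have hJ' : IsJet β (fun q : X' => (f (fun i => Real.exp (q.1 i)) *
        Real.exp (-horoRest β h q.1 y)) •
      ((∏ i, (algebraMap ℝ _ (cutJet (θ i) (q.1 i) (y i) 0) +
          algebraMap ℝ _ (cutJet (θ i) (q.1 i) (y i) 1) *
            (xiEta i 0 (Pi.single i 1) + xiEta i 1 (Pi.single i 1)) +
          algebraMap ℝ _ (cutJet (θ i) (q.1 i) (y i) 2) *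
            (xiEta i 0 (Pi.single i 1) * xiEta i 1 (Pi.single i 1))) *
        ((1 + xiEta i 0 (horoMat β h q.1 i)) * (1 + xiEta i 1 (horoMat β h q.1 i))) :
        Subalgebra.center ℝ (Grass Λ)) : Grass Λ))
      (fun q v => (f (fun i => Real.exp (q.1 i)) * Real.exp (-horoRest β h q.1 y)) *
        ((∏ i, θ i ((Real.exp (q.1 i) - (1 + y i ^ 2 - pairSum v i) * Real.exp (-q.1 i)) / 2)) *
        Real.exp (∑ b : Λ × Fin 2,
          (horoDiag β h q.1 b.1 * v (Sum.inl b) - v (Sum.inr b))))) := by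
    have ht : Continuous fun q : X' => q.1 := continuous_subtype_val
    have h1 := fun i => (isJet_cutoff (β := β) ht (θ i) (hθ i) (y i) i).mul
      ((isJet_exp_site (β := β) (h := h) ht (i, 0)).mul (isJet_exp_site (h := h) ht (i, 1)))
    have h2 := IsJet.finset_prod (β := β) (X := X') Finset.univ (c := fun i q =>
      (algebraMap ℝ _ (cutJet (θ i) (q.1 i) (y i) 0) +
          algebraMap ℝ _ (cutJet (θ i) (q.1 i) (y i) 1) *
            (xiEta i 0 (Pi.single i 1) + xiEta i 1 (Pi.single i 1)) +
          algebraMap ℝ _ (cutJet (θ i) (q.1 i) (y i) 2) *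
            (xiEta i 0 (Pi.single i 1) * xiEta i 1 (Pi.single i 1))) *
        ((1 + xiEta i 0 (horoMat β h q.1 i)) * (1 + xiEta i 1 (horoMat β h q.1 i)))) h1
    have hcont : Continuous fun q : X' => f (fun i => Real.exp (q.1 i)) *
        Real.exp (-horoRest β h q.1 y) := by
      refine Continuous.comp (g := fun t : Λ → ℝ => f (fun i => Real.exp (t i)) *
        Real.exp (-horoRest β h t y)) ?_ continuous_subtype_val
      unfold horoRest
      exact (hf.comp (by fun_prop)).mul (by fun_prop)
    refine (h2.const_smul ⟨_, hcont⟩).of_eq (fun q => rfl) fun q v => ?_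
    simp only [ContinuousMap.coe_mk]
    rw [Real.exp_sum, Fintype.prod_prod_type, ← Finset.prod_mul_distrib]
    simp only [Fin.prod_univ_two]
  -- Radius 1/8 gives |`pairSum`| ≤ 1/2, hence w ≥ 1/2 > 0.
  have key := hJ.integral_congr volume volume hJ' ⟨1 / 8, by norm_num, fun v hv => ?_⟩
  · simp only [map_smul, smul_eq_mul, fermiIntL_site_prod] at key
    rw [hsub X hmX (fun x => (∏ i, θ i (x i)) * fermiIntL (integrandForm β h obs (x, y)))
      fun x hx => by rw [houtX x hx, zero_mul]] at key
    refine key.trans (hsub X' hmX' (fun t => f (fun i => Real.exp (t i)) *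
      Real.exp (-horoRest β h t y) * cutBerezin β h y θ t) fun t ht => ?_)
    obtain ⟨i, hi⟩ := houtX' t ht
    have hi := hi 0 (by norm_num)
    rw [sub_zero] at hi
    rw [cutBerezin_eq_zero i (hR i) hi, mul_zero]
  · have hw : ∀ i, 0 < 1 + y i ^ 2 - pairSum v i := fun i => by
      have := (abs_le.1 (hpair v i hv)).2
      nlinarith [sq_nonneg (y i)]
    have hzpos : ∀ (x : Λ → ℝ) i, 0 < realZ x y v i := fun x i =>
      Real.sqrt_pos.2 (by linarith [hw i, sq_nonneg (x i)])
    have hzc : Continuous fun x : Λ → ℝ => realZ x y v := by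
      unfold realZ
      fun_prop
    have hzc' : ∀ i, Continuous fun x : Λ → ℝ => realZ x y v i := fun i =>
      (continuous_apply i).comp hzc
    refine ⟨?_, ?_, ?_⟩
    · refine Continuous.integrable_of_hasCompactSupport ?_ (HasCompactSupport.of_compactSpace _)
      refine Continuous.comp (g := fun x : Λ → ℝ => (∏ i, θ i (x i)) * ((∏ i, (realZ x y v i)⁻¹) *
        (f (fun i => x i + realZ x y v i) *
        Real.exp (-realAction β h x y (realZ x y v) v)))) ?_ continuous_subtype_val
      refine Continuous.mul (continuous_finsetProd _ fun i _ =>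
        (hθ i).continuous.comp (continuous_apply i)) (Continuous.mul ?_ (Continuous.mul ?_ ?_))
      · exact continuous_finsetProd _ fun i _ => (hzc' i).inv₀ fun x => (hzpos x i).ne'
      · exact hf.comp (continuous_pi fun i => (continuous_apply i).add (hzc' i))
      · unfold realAction
        fun_prop
    · refine Continuous.integrable_of_hasCompactSupport ?_ (HasCompactSupport.of_compactSpace _)
      refine Continuous.comp (g := fun t : Λ → ℝ =>
        (f (fun i => Real.exp (t i)) * Real.exp (-horoRest β h t y)) *
        ((∏ i, θ i ((Real.exp (t i) - (1 + y i ^ 2 - pairSum v i) * Real.exp (-t i)) / 2)) *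
        Real.exp (∑ b : Λ × Fin 2,
          (horoDiag β h t b.1 * v (Sum.inl b) - v (Sum.inr b))))) ?_ continuous_subtype_val
      refine Continuous.mul (Continuous.mul (hf.comp (by fun_prop)) ?_) (Continuous.mul ?_ ?_)
      · unfold horoRest; fun_prop
      · exact continuous_finsetProd _ fun i _ => (hθ i).continuous.comp (by fun_prop)
      · unfold horoDiag; fun_prop
    · rw [hsub X hmX (fun x => (∏ i, θ i (x i)) * ((∏ i, (realZ x y v i)⁻¹) *
        (f (fun i => x i + realZ x y v i) *
        Real.exp (-realAction β h x y (realZ x y v) v)))) fun x hx => by rw [houtX x hx, zero_mul],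
        hsub X' hmX' (fun t => (f (fun i => Real.exp (t i)) * Real.exp (-horoRest β h t y)) *
        ((∏ i, θ i ((Real.exp (t i) - (1 + y i ^ 2 - pairSum v i) * Real.exp (-t i)) / 2)) *
        Real.exp (∑ b : Λ × Fin 2,
          (horoDiag β h t b.1 * v (Sum.inl b) - v (Sum.inr b))))) fun t ht => ?_,
        integral_horospherical (fun i => 1 + y i ^ 2 - pairSum v i) hw]
      · refine integral_congr_ae (Filter.Eventually.of_forall fun t => ?_)
        have hz : (realZ (fun i => (Real.exp (t i) - (1 + y i ^ 2 - pairSum v i) *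
            Real.exp (-t i)) / 2) y v) = fun i =>
            (Real.exp (t i) + (1 + y i ^ 2 - pairSum v i) * Real.exp (-t i)) / 2 :=
          funext fun i => realZ_horospherical t y v i (hw i)
        have hxz : (fun i => (Real.exp (t i) - (1 + y i ^ 2 - pairSum v i) * Real.exp (-t i)) / 2 +
            (Real.exp (t i) + (1 + y i ^ 2 - pairSum v i) * Real.exp (-t i)) / 2) =
            fun i => Real.exp (t i) := funext fun i => by ring
        -- The Jacobian of the substitution against the factors 1/z_i.
        have hcancel : (∏ i, (Real.exp (t i) + (1 + y i ^ 2 - pairSum v i) *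
            Real.exp (-t i)) / 2) * (∏ i, ((Real.exp (t i) + (1 + y i ^ 2 - pairSum v i) *
            Real.exp (-t i)) / 2)⁻¹) = 1 := by
          rw [← Finset.prod_mul_distrib]
          refine Finset.prod_eq_one fun i _ => mul_inv_cancel₀ ?_
          have := hw i
          positivity
        simp only [hz, realAction_horospherical, hxz]
        rw [neg_sub, sub_eq_add_neg, Real.exp_add]
        linear_combination ((∏ i, θ i ((Real.exp (t i) - (1 + y i ^ 2 - pairSum v i) *
          Real.exp (-t i)) / 2)) * (f (fun i => Real.exp (t i)) *
          (Real.exp (∑ b : Λ × Fin 2, (horoDiag β h t b.1 * v (Sum.inl b) - v (Sum.inr b))) *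
          Real.exp (-horoRest β h t y)))) * hcancel
      · obtain ⟨i, hi⟩ := houtX' t ht
        rw [Finset.prod_eq_zero (Finset.mem_univ i) (hR i _ (hi _ (hpair v i hv))), zero_mul,
          mul_zero]

end CutoffIdentity

end

end HoroH24

namespace HoroH24

noncomputable section

open MeasureTheory

/-! ### Cutoffs with small logarithmic derivatives -/

section Cutoffs

/-- The transition is locally constant off [0, 1], so only a compact interval matters. -/
theorem exists_bound_deriv_smoothTransition :
    ∃ A : ℝ, 0 < A ∧ ∀ s, |deriv Real.smoothTransition s| ≤ A ∧
      |deriv (deriv Real.smoothTransition) s| ≤ A := by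
  set f := Real.smoothTransition with hf
  have hf2 : ContDiff ℝ 2 f := Real.smoothTransition.contDiff
  have hd : Continuous (deriv f) := hf2.continuous_deriv (by norm_num)
  have hdd : Continuous (deriv (deriv f)) := by
    have := hf2.continuous_iteratedDeriv 2 le_rfl
    rwa [iteratedDeriv_succ, iteratedDeriv_one] at this
  obtain ⟨A1, h1⟩ := (isCompact_Icc (a := (0 : ℝ)) (b := 1)).exists_bound_of_continuousOn
    hd.continuousOn
  obtain ⟨A2, h2⟩ := (isCompact_Icc (a := (0 : ℝ)) (b := 1)).exists_bound_of_continuousOn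
    hdd.continuousOn
  have h0 : ∀ s, s ∉ Set.Icc (0 : ℝ) 1 → ∃ c : ℝ, f =ᶠ[nhds s] fun _ => c := by
    intro s hs
    rw [Set.mem_Icc, not_and_or, not_le, not_le] at hs
    rcases hs with hs | hs
    · refine ⟨0, ?_⟩
      filter_upwards [isOpen_Iio.mem_nhds hs] with x hx
      exact Real.smoothTransition.zero_of_nonpos (le_of_lt hx)
    · refine ⟨1, ?_⟩
      filter_upwards [isOpen_Ioi.mem_nhds hs] with x hx
      exact Real.smoothTransition.one_of_one_le (le_of_lt hx)
  refine ⟨max (max A1 A2) 1, by positivity, fun s => ?_⟩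
  by_cases hs : s ∈ Set.Icc (0 : ℝ) 1
  · exact ⟨(h1 s hs).trans ((le_max_left _ _).trans (le_max_left _ _)),
      (h2 s hs).trans ((le_max_right _ _).trans (le_max_left _ _))⟩
  · obtain ⟨c, hc⟩ := h0 s hs
    have e1 : deriv f =ᶠ[nhds s] fun _ => 0 := by
      have := hc.deriv
      simpa using this
    rw [e1.eq_of_nhds, e1.deriv_eq]
    simp

theorem deriv_log_one_add_sq (x : ℝ) :
    HasDerivAt (fun x : ℝ => Real.log (1 + x ^ 2)) (2 * x / (1 + x ^ 2)) x := by
  have h : HasDerivAt (fun x : ℝ => 1 + x ^ 2) (2 * x) x := by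
    simpa using (hasDerivAt_pow 2 x).const_add 1
  exact h.log (by positivity)

/-- Smooth cutoffs with logarithmically slow decay. -/
theorem exists_slow_cutoff (C m : ℝ) : ∃ (θ : ℝ → ℝ) (R : ℝ), 0 ≤ R ∧ ContDiff ℝ ∞ θ ∧
    (∀ x, |θ x| ≤ 1) ∧ (∀ x, |x| ≤ m → θ x = 1) ∧ (∀ x, R < |x| → θ x = 0) ∧
    (∀ x, C * (1 + |x|) * |deriv θ x| ≤ 1) ∧
    ∀ x, (C * (1 + |x|)) ^ 2 * |iteratedDeriv 2 θ x| ≤ 1 := by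
  obtain ⟨A, hA, hbd⟩ := exists_bound_deriv_smoothTransition
  set f := Real.smoothTransition with hf
  set K : ℝ := max |C| 1 with hK
  have hK1 : 1 ≤ K := le_max_right _ _
  set L := Real.log (1 + m ^ 2) with hL
  have hL0 : 0 ≤ L := Real.log_nonneg (by nlinarith [sq_nonneg m])
  -- The constant 13 is 3² + 4, from the bounds `hr1` and `hr2` that enter the second derivative.
  -- The summand L gives εL ≤ 1, so that θ = 1 for |x| ≤ m; the summand 1 gives ε ≤ 1.
  set ε : ℝ := (13 * A * K ^ 2 + L + 1)⁻¹ with hε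
  have hε0 : 0 < ε := by positivity
  have hε1 : ε * (13 * A * K ^ 2 + L + 1) = 1 := inv_mul_cancel₀ (by positivity)
  have hεle : ε ≤ 1 := by
    have : 0 ≤ ε * (13 * A * K ^ 2 + L) := by positivity
    linarith
  have hεA : 13 * A * ε * K ^ 2 ≤ 1 := by
    have : 0 ≤ ε * (L + 1) := by positivity
    linarith
  -- The transition goes from 1 to 0 while ε log(1 + x²) grows from 1 to 2. Hence (1 + |x|)|θ'| is
  -- of order ε for all x, and θ vanishes beyond e^{1/ε}.
  set g : ℝ → ℝ := fun x => 2 - ε * Real.log (1 + x ^ 2) with hg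
  have hsm : ContDiff ℝ ∞ f := Real.smoothTransition.contDiff
  have hgs : ContDiff ℝ ∞ g := by
    refine contDiff_const.sub (contDiff_const.mul (ContDiff.log (by fun_prop) fun x => ?_))
    positivity
  have hg1 : ∀ x, HasDerivAt g (-(ε * (2 * x / (1 + x ^ 2)))) x := fun x => by
    simpa using ((deriv_log_one_add_sq x).const_mul ε).const_sub 2
  have hfd : Differentiable ℝ f := hsm.differentiable (by norm_num)
  have hfd' : Differentiable ℝ (deriv f) :=
    (Real.smoothTransition.contDiff (n := 2)).differentiable_deriv_two
  have hθ1 : ∀ x, HasDerivAt (f ∘ g) (deriv f (g x) * (-(ε * (2 * x / (1 + x ^ 2))))) x :=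
    fun x => (hfd (g x)).hasDerivAt.comp x (hg1 x)
  have hd1 : deriv (f ∘ g) = fun x => deriv f (g x) * (-(ε * (2 * x / (1 + x ^ 2)))) :=
    funext fun x => (hθ1 x).deriv
  have hq : ∀ x : ℝ, HasDerivAt (fun x : ℝ => -(ε * (2 * x / (1 + x ^ 2))))
      (-(ε * ((2 * (1 + x ^ 2) - 2 * x * (2 * x)) / (1 + x ^ 2) ^ 2))) x := fun x => by
    have h1 : HasDerivAt (fun x : ℝ => 1 + x ^ 2) (2 * x) x := by
      simpa using (hasDerivAt_pow 2 x).const_add 1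
    have h2 : HasDerivAt (fun x : ℝ => 2 * x) 2 x := by
      simpa using (hasDerivAt_id x).const_mul 2
    exact ((h2.div h1 (by positivity)).const_mul ε).neg
  have hd2 : ∀ x, iteratedDeriv 2 (f ∘ g) x =
      deriv (deriv f) (g x) * (-(ε * (2 * x / (1 + x ^ 2)))) * (-(ε * (2 * x / (1 + x ^ 2)))) +
      deriv f (g x) * (-(ε * ((2 * (1 + x ^ 2) - 2 * x * (2 * x)) / (1 + x ^ 2) ^ 2))) := by
    intro x
    rw [iteratedDeriv_succ, iteratedDeriv_one, hd1]
    exact ((((hfd' (g x)).hasDerivAt.comp x (hg1 x)).mul (hq x))).deriv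
  have hCx2 : ∀ x : ℝ, (C * (1 + |x|)) ^ 2 ≤ (K * (1 + |x|)) ^ 2 := fun x => by
    rw [mul_pow, mul_pow, ← sq_abs C]
    gcongr
    exact le_max_left _ _
  have hr1 : ∀ x : ℝ, (1 + |x|) * |2 * x / (1 + x ^ 2)| ≤ 3 := fun x => by
    rw [abs_div, abs_mul, abs_of_pos (show (0 : ℝ) < 1 + x ^ 2 by positivity), ← sq_abs x,
      abs_two, ← mul_div_assoc, div_le_iff₀ (by positivity)]
    nlinarith [sq_nonneg (|x| - 1)]
  have hr2 : ∀ x : ℝ, (1 + |x|) ^ 2 *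
      |(2 * (1 + x ^ 2) - 2 * x * (2 * x)) / (1 + x ^ 2) ^ 2| ≤ 4 := fun x => by
    have e : |2 * (1 + x ^ 2) - 2 * x * (2 * x)| ≤ 2 * (1 + x ^ 2) := by
      rw [abs_le]; constructor <;> nlinarith [sq_nonneg x]
    rw [abs_div, abs_of_pos (show (0 : ℝ) < (1 + x ^ 2) ^ 2 by positivity), ← mul_div_assoc,
      div_le_iff₀ (by positivity)]
    have e2 : (1 + |x|) ^ 2 ≤ 2 * (1 + x ^ 2) := by
      rw [← sq_abs x]; nlinarith [sq_nonneg (|x| - 1)]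
    calc _ ≤ (2 * (1 + x ^ 2)) * (2 * (1 + x ^ 2)) := by gcongr
      _ = _ := by ring
  refine ⟨f ∘ g, Real.exp ε⁻¹, (Real.exp_pos _).le, hsm.comp hgs, fun x => ?_, fun x hx => ?_,
    fun x hx => ?_, fun x => ?_, fun x => ?_⟩
  · rw [Function.comp, abs_of_nonneg (Real.smoothTransition.nonneg _)]
    exact Real.smoothTransition.le_one _
  · refine Real.smoothTransition.one_of_one_le ?_
    have h1 : Real.log (1 + x ^ 2) ≤ L := by
      refine Real.log_le_log (by positivity) ?_
      have := sq_le_sq' (by linarith [abs_le.1 hx]) (abs_le.1 hx).2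
      linarith
    have h2 : ε * Real.log (1 + x ^ 2) ≤ ε * L := by gcongr
    have : 0 ≤ ε * (13 * A * K ^ 2 + 1) := by positivity
    simp only [hg]
    linarith
  · refine Real.smoothTransition.zero_of_nonpos ?_
    have h1 : Real.exp ε⁻¹ ^ 2 ≤ 1 + x ^ 2 := by
      rw [← sq_abs x]
      have := pow_le_pow_left₀ (Real.exp_pos ε⁻¹).le hx.le 2
      linarith
    have h2 := Real.log_le_log (by positivity) h1
    rw [Real.log_pow, Real.log_exp] at h2
    have h3 : ε * (2 * ε⁻¹) ≤ ε * Real.log (1 + x ^ 2) := by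
      gcongr
      exact_mod_cast h2
    have h4 : ε * ε⁻¹ = 1 := mul_inv_cancel₀ hε0.ne'
    simp only [hg]
    linarith
  · rw [hd1]
    simp only [abs_mul, abs_neg, abs_of_pos hε0]
    calc C * (1 + |x|) * (|deriv f (g x)| * (ε * |2 * x / (1 + x ^ 2)|))
        ≤ K * (1 + |x|) * (A * (ε * |2 * x / (1 + x ^ 2)|)) := by
          gcongr
          · exact (le_abs_self C).trans (le_max_left _ _)
          · exact (hbd _).1
      _ = A * ε * K * ((1 + |x|) * |2 * x / (1 + x ^ 2)|) := by ring
      _ ≤ A * ε * K * 3 := by gcongr; exact hr1 x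
      _ ≤ A * ε * (K * K) * 13 := by
          gcongr
          · exact le_mul_of_one_le_left (by positivity) hK1
          · norm_num
      _ ≤ 1 := by linarith
  · rw [hd2]
    set a := deriv f (g x)
    set b := deriv (deriv f) (g x)
    set p := 2 * x / (1 + x ^ 2)
    set q := (2 * (1 + x ^ 2) - 2 * x * (2 * x)) / (1 + x ^ 2) ^ 2
    have ha : |a| ≤ A := (hbd _).1
    have hb : |b| ≤ A := (hbd _).2
    have h1 : |b * -(ε * p) * -(ε * p) + a * -(ε * q)| ≤
        A * (ε * |p|) * (ε * |p|) + A * (ε * |q|) := by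
      refine (abs_add_le _ _).trans ?_
      simp only [abs_mul, abs_neg, abs_of_pos hε0]
      gcongr
    calc _ ≤ (K * (1 + |x|)) ^ 2 * (A * (ε * |p|) * (ε * |p|) + A * (ε * |q|)) := by
          gcongr ?_ * ?_
          exact hCx2 x
      _ = A * ε * K ^ 2 * (ε * ((1 + |x|) * |p|) ^ 2 + (1 + |x|) ^ 2 * |q|) := by ring
      _ ≤ A * ε * K ^ 2 * (1 * 3 ^ 2 + 4) := by
          gcongr
          · exact hr1 x
          · exact hr2 x
      _ ≤ 1 := by linarith

end Cutoffs

end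

end HoroH24

namespace HoroH24

noncomputable section

open MeasureTheory

/-! ### Coercivity of the horospherical matrix -/

section Coercivity

variable {Λ : Type*} [Fintype Λ] [DecidableEq Λ] {β : Sym2 Λ → ℝ} {h : Λ → ℝ}

theorem horoMat_apply (t : Λ → ℝ) (i j : Λ) :
    horoMat β h t i j = (if i = j then horoDiag β h t i else 0) - β s(i, j) := by
  simp [horoMat, Pi.single_apply, eq_comm (a := j)]

theorem isSymm_horoMat (t : Λ → ℝ) : (Matrix.of (horoMat β h t)).IsSymm := by
  ext i j
  simp only [Matrix.transpose_apply, Matrix.of_apply, horoMat_apply, Sym2.eq_swap (a := j),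
    eq_comm (a := j)]
  split_ifs with hij
  · rw [hij]
  · rfl

omit [Fintype Λ] [DecidableEq Λ] in
theorem exp_mul_sub_sq (t v : Λ → ℝ) (i j : Λ) : Real.exp (t i + t j) *
    (v i * Real.exp (-t i) - v j * Real.exp (-t j)) ^ 2 =
    Real.exp (t j - t i) * v i ^ 2 + Real.exp (t i - t j) * v j ^ 2 - 2 * (v i * v j) := by
  have hi : Real.exp (t i) * Real.exp (-t i) = 1 := by rw [← Real.exp_add]; simp
  have hj : Real.exp (t j) * Real.exp (-t j) = 1 := by rw [← Real.exp_add]; simp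
  rw [Real.exp_add, sub_eq_add_neg (t j), sub_eq_add_neg (t i), Real.exp_add, Real.exp_add]
  linear_combination (Real.exp (t j) * Real.exp (-t i) * v i ^ 2 - 2 * v i * v j) * hi +
    (Real.exp (t i) * Real.exp (-t j) * v j ^ 2 -
      2 * v i * v j * (Real.exp (t i) * Real.exp (-t i))) * hj

omit [Fintype Λ] [DecidableEq Λ] in
theorem exp_mul_sq (t v : Λ → ℝ) (i : Λ) :
    Real.exp (t i) * (v i * Real.exp (-t i)) ^ 2 = Real.exp (-t i) * v i ^ 2 := by
  have hi : Real.exp (t i) * Real.exp (-t i) = 1 := by rw [← Real.exp_add]; simp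
  linear_combination (v i ^ 2 * Real.exp (-t i)) * hi

/-- With u = e^{-t}v this is the Dirichlet form of the weights β_{ij} e^{t_i+t_j} plus the killing
term h_i e^{t_i}; diagonal weights drop out. -/
theorem horoMat_quadratic (t v : Λ → ℝ) :
    v ⬝ᵥ (Matrix.of (horoMat β h t)).mulVec v =
      (1 / 2) * ∑ i, ∑ j, β s(i, j) * (Real.exp (t i + t j) *
        (v i * Real.exp (-t i) - v j * Real.exp (-t j)) ^ 2) +
      ∑ i, h i * (Real.exp (t i) * (v i * Real.exp (-t i)) ^ 2) := by
  have hsw : ∑ i, ∑ j, β s(i, j) * (Real.exp (t i - t j) * v j ^ 2) =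
      ∑ i, ∑ j, β s(i, j) * (Real.exp (t j - t i) * v i ^ 2) := by
    rw [Finset.sum_comm]
    simp only [Sym2.eq_swap]
  have hl : v ⬝ᵥ (Matrix.of (horoMat β h t)).mulVec v = ∑ i, (horoDiag β h t i * v i ^ 2 -
      ∑ j, β s(i, j) * (v i * v j)) := by
    rw [dotProduct]
    refine Finset.sum_congr rfl fun i _ => ?_
    simp only [Matrix.mulVec, dotProduct, Matrix.of_apply, horoMat_apply, sub_mul, ite_mul,
      zero_mul, Finset.sum_sub_distrib, Finset.sum_ite_eq, Finset.mem_univ, if_true, mul_sub,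
      Finset.mul_sum]
    congr 1
    · ring
    · exact Finset.sum_congr rfl fun j _ => by ring
  rw [hl]
  simp only [exp_mul_sub_sq, exp_mul_sq, mul_sub, mul_add, Finset.sum_sub_distrib, Finset.sum_add_distrib, hsw,
    horoDiag, add_mul, Finset.sum_mul, mul_assoc]
  have e : ∑ i, ∑ j, β s(i, j) * (2 * (v i * v j)) = 2 * ∑ i, ∑ j, β s(i, j) * (v i * v j) := by
    simp only [Finset.mul_sum]
    exact Finset.sum_congr rfl fun i _ => Finset.sum_congr rfl fun j _ => by ring
  rw [e]
  ring

theorem horoMat_edge_le (hβ : ∀ e, 0 ≤ β e) (hh : ∀ i, 0 ≤ h i) (t v : Λ → ℝ) {i j : Λ}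
    (hij : i ≠ j) : β s(i, j) * (Real.exp (t i + t j) *
        (v i * Real.exp (-t i) - v j * Real.exp (-t j)) ^ 2) ≤
      v ⬝ᵥ (Matrix.of (horoMat β h t)).mulVec v := by
  rw [horoMat_quadratic]
  set g : Λ → Λ → ℝ := fun i j => β s(i, j) * (Real.exp (t i + t j) *
        (v i * Real.exp (-t i) - v j * Real.exp (-t j)) ^ 2) with hg
  have hg0 : ∀ i j, 0 ≤ g i j := fun i j => mul_nonneg (hβ _) (by positivity)
  have hsym : g j i = g i j := by
    simp only [hg, Sym2.eq_swap (a := j), add_comm (t j)]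
    ring
  have h1 : ∑ k ∈ {i, j}, ∑ l, g k l ≤ ∑ k, ∑ l, g k l :=
    Finset.sum_le_sum_of_subset_of_nonneg (Finset.subset_univ _)
      fun k _ _ => Finset.sum_nonneg fun l _ => hg0 k l
  rw [Finset.sum_pair hij] at h1
  have h2 := Finset.single_le_sum (f := g i) (fun l _ => hg0 i l) (Finset.mem_univ j)
  have h3 := Finset.single_le_sum (f := g j) (fun l _ => hg0 j l) (Finset.mem_univ i)
  have h4 : 0 ≤ ∑ i, h i * (Real.exp (t i) * (v i * Real.exp (-t i)) ^ 2) :=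
    Finset.sum_nonneg fun i _ => mul_nonneg (hh i) (by positivity)
  change g i j ≤ 1 / 2 * ∑ k, ∑ l, g k l + _
  linarith

theorem horoMat_site_le (hβ : ∀ e, 0 ≤ β e) (hh : ∀ i, 0 ≤ h i) (t v : Λ → ℝ) (i : Λ) :
    h i * (Real.exp (t i) * (v i * Real.exp (-t i)) ^ 2) ≤
      v ⬝ᵥ (Matrix.of (horoMat β h t)).mulVec v := by
  rw [horoMat_quadratic]
  have h1 : 0 ≤ ∑ i, ∑ j, β s(i, j) * (Real.exp (t i + t j) *
        (v i * Real.exp (-t i) - v j * Real.exp (-t j)) ^ 2) :=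
    Finset.sum_nonneg fun i _ => Finset.sum_nonneg fun j _ => mul_nonneg (hβ _) (by positivity)
  have h2 := Finset.single_le_sum
    (f := fun i => h i * (Real.exp (t i) * (v i * Real.exp (-t i)) ^ 2))
    (fun l _ => mul_nonneg (hh l) (by positivity)) (Finset.mem_univ i)
  linarith

theorem horoMat_quadratic_nonneg (hβ : ∀ e, 0 ≤ β e) (hh : ∀ i, 0 ≤ h i) (t v : Λ → ℝ) :
    0 ≤ v ⬝ᵥ (Matrix.of (horoMat β h t)).mulVec v := by
  rw [horoMat_quadratic]
  refine add_nonneg (mul_nonneg (by norm_num) (Finset.sum_nonneg fun i _ => Finset.sum_nonneg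
    fun j _ => mul_nonneg (hβ _) (by positivity))) (Finset.sum_nonneg fun i _ =>
      mul_nonneg (hh i) (by positivity))

/-- Each replaced row carries a factor δ_i from the derivatives of the cutoff, which is what
`det_replaceRows_bound` needs. So each of the 4^|Λ| terms is at most (det M)². -/
theorem abs_cutBerezin_le (t y δ : Λ → ℝ) (θ : Λ → ℝ → ℝ) (hδ : ∀ i, 0 ≤ δ i)
    (hq : ∀ v i, δ i * v i ^ 2 ≤ v ⬝ᵥ (Matrix.of (horoMat β h t)).mulVec v)
    (h0 : ∀ i, |cutJet (θ i) (t i) (y i) 0| ≤ 1) (h1 : ∀ i, |cutJet (θ i) (t i) (y i) 1| ≤ δ i)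
    (h2 : ∀ i, |cutJet (θ i) (t i) (y i) 2| ≤ δ i ^ 2) :
    |cutBerezin β h y θ t| ≤ 4 ^ Fintype.card Λ * (Matrix.of (horoMat β h t)).det ^ 2 := by
  have hb := det_replaceRows_bound (Matrix.of (horoMat β h t)) (isSymm_horoMat t) δ hδ hq
  have hcard : ((Finset.univ : Finset (Λ → Bool × Bool)).card : ℝ) = 4 ^ Fintype.card Λ := by
    simp [Finset.card_univ]
  rw [← hcard, ← nsmul_eq_mul]
  refine (Finset.abs_sum_le_sum_abs _ _).trans (Finset.sum_le_card_nsmul _ _ _ fun c _ => ?_)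
  have hpick : ∀ i, |pick (cutJet (θ i) (t i) (y i)) (c i)| ≤
      (if (c i).1 then δ i else 1) * (if (c i).2 then δ i else 1) := by
    intro i
    rcases c i with ⟨_ | _, _ | _⟩
    · simpa [pick] using h0 i
    · simpa [pick] using h1 i
    · simpa [pick] using h1 i
    · simpa [pick, sq] using h2 i
  have hprod : |∏ i, pick (cutJet (θ i) (t i) (y i)) (c i)| ≤
      (∏ i, if (c i).1 then δ i else 1) * ∏ i, if (c i).2 then δ i else 1 := by
    rw [Finset.abs_prod, ← Finset.prod_mul_distrib]
    exact Finset.prod_le_prod (fun i _ => abs_nonneg _) fun i _ => hpick i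
  have hb1 := hb fun i => (c i).1
  have hb2 := hb fun i => (c i).2
  simp only [Matrix.of_apply] at hb1 hb2
  change 0 ≤ (Matrix.of (replaceRows (horoMat β h t) _)).det ∧ _ at hb1
  change 0 ≤ (Matrix.of (replaceRows (horoMat β h t) _)).det ∧ _ at hb2
  rw [abs_mul, abs_mul, abs_of_nonneg hb1.1, abs_of_nonneg hb2.1]
  have hp : ∀ b : Λ → Bool, 0 ≤ ∏ i, if b i then δ i else 1 := fun b =>
    Finset.prod_nonneg fun i _ => by split_ifs; exacts [hδ i, zero_le_one]
  calc _ ≤ ((∏ i, if (c i).1 then δ i else 1) * ∏ i, if (c i).2 then δ i else 1) *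
        ((Matrix.of (replaceRows (horoMat β h t) fun i => (c i).1)).det *
          (Matrix.of (replaceRows (horoMat β h t) fun i => (c i).2)).det) :=
        mul_le_mul_of_nonneg_right hprod (mul_nonneg hb1.1 hb2.1)
    _ = ((∏ i, if (c i).1 then δ i else 1) *
          (Matrix.of (replaceRows (horoMat β h t) fun i => (c i).1)).det) *
        ((∏ i, if (c i).2 then δ i else 1) *
          (Matrix.of (replaceRows (horoMat β h t) fun i => (c i).2)).det) := by ring
    _ ≤ (Matrix.of (horoMat β h t)).det * (Matrix.of (horoMat β h t)).det :=
        mul_le_mul hb1.2 hb2.2 (mul_nonneg (hp _) hb2.1)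
          ((mul_nonneg (hp _) hb1.1).trans hb1.2)
    _ = _ := by ring

-- At fixed y a bound on x bounds t from both sides, so that on the support of a cutoff the weights
-- are under control.
omit [Fintype Λ] [DecidableEq Λ] in
theorem exp_le_of_horospherical (t y : ℝ) :
    Real.exp t ≤ (2 + y ^ 2) * (1 + |(Real.exp t - (1 + y ^ 2) * Real.exp (-t)) / 2|) ∧
    Real.exp (-t) ≤ (2 + y ^ 2) * (1 + |(Real.exp t - (1 + y ^ 2) * Real.exp (-t)) / 2|) := by
  have hab : Real.exp t * Real.exp (-t) = 1 := by rw [← Real.exp_add]; simp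
  have ha := Real.exp_pos t
  have hb := Real.exp_pos (-t)
  set a := Real.exp t
  set b := Real.exp (-t)
  set x := (a - (1 + y ^ 2) * b) / 2 with hx
  have h1 := le_abs_self x
  have h2 := neg_le_abs x
  have hy := sq_nonneg y
  have h3 : 0 ≤ y ^ 2 * |x| := by positivity
  rcases le_total a 1 with h | h
  · have : 0 ≤ y ^ 2 * b := by positivity
    constructor <;> nlinarith
  · have hb1 : b ≤ 1 := by nlinarith
    have : y ^ 2 * b ≤ y ^ 2 * 1 := by gcongr
    constructor <;> nlinarith

end Coercivity

end

end HoroH24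

namespace HoroH24

noncomputable section

open MeasureTheory

/-! ### Choice and removal of the cutoffs -/

section CutoffRemoval

variable {Λ : Type*} [Fintype Λ] [DecidableEq Λ] {β : Sym2 Λ → ℝ} {h : Λ → ℝ}

omit [Fintype Λ] [DecidableEq Λ] in
theorem exists_adj_dist_eq {G : SimpleGraph Λ} (hG : G.Connected) {r i : Λ} {d : ℕ}
    (hd : G.dist i r = d + 1) : ∃ p, G.Adj i p ∧ G.dist p r = d := by
  obtain ⟨w, hw⟩ := hG.exists_walk_length_eq_dist i r
  cases w with
  | nil => simp at hd
  | @cons _ p _ hadj w' =>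
    refine ⟨p, hadj, ?_⟩
    have h1 := SimpleGraph.dist_le w'
    rw [SimpleGraph.Walk.length_cons] at hw
    have h2 := hG.dist_triangle (u := i) (v := p) (w := r)
    rw [SimpleGraph.dist_eq_one_iff_adj.2 hadj] at h2
    omega

/-- Coercivity at a vertex is inherited from a neighbour nearer to a root r with h_r > 0, at a cost
depending on e^{±t} at that neighbour. On the neighbour's cutoff support this cost is bounded, so
the cutoffs can be chosen in order of distance from r, each slow enough for the constants created
before it. -/
theorem exists_cutoff_family (hβ : ∀ e, 0 ≤ β e) (hh : ∀ i, 0 ≤ h i)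
    (hconn : (weightGraph β).Connected) (hpos : ∃ i, 0 < h i) (y : Λ → ℝ) (m : ℝ) :
    ∃ (θ : Λ → ℝ → ℝ) (R : ℝ), (∀ i, ContDiff ℝ ∞ (θ i)) ∧ (∀ i x, |θ i x| ≤ 1) ∧
      (∀ i x, |x| ≤ m → θ i x = 1) ∧ (∀ i x, R < |x| → θ i x = 0) ∧
      ∀ t, |cutBerezin β h y θ t| ≤
        4 ^ Fintype.card Λ * (Matrix.of (horoMat β h t)).det ^ 2 := by
  obtain ⟨r, hr⟩ := hpos
  choose Θ Rad hRad hsm hle hone hzero hd1 hd2 using fun C => exists_slow_cutoff C m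
  set K : ℝ := 2 + ∑ i, y i ^ 2 with hK
  -- Dominates 1/β_e for every edge; pairs of weight zero contribute 0 since 0⁻¹ = 0.
  set B : ℝ := ∑ e, (β e)⁻¹ with hB
  have hKy : ∀ i, 2 + y i ^ 2 ≤ K := fun i => by
    have := Finset.single_le_sum (f := fun i => y i ^ 2) (fun i _ => sq_nonneg (y i))
      (Finset.mem_univ i)
    linarith
  have hK0 : 0 < K := by linarith [hKy r, sq_nonneg (y r)]
  have hBe : ∀ e, (β e)⁻¹ ≤ B := fun e =>
    Finset.single_le_sum (f := fun e => (β e)⁻¹) (fun e _ => inv_nonneg.2 (hβ e))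
      (Finset.mem_univ e)
  have hB0 : 0 ≤ B := Finset.sum_nonneg fun e _ => inv_nonneg.2 (hβ e)
  -- C_d is the coercivity constant at distance d in `hcoer`. The recursion records one step along
  -- an edge, using the radius of the cutoff at level d.
  let C : ℕ → ℝ := fun n => Nat.rec (h r)⁻¹
    (fun _ c => 2 * K ^ 2 * (1 + Rad c) ^ 2 * c + 2 * K * (1 + Rad c) * B) n
  have hC : ∀ n, C (n + 1) = 2 * K ^ 2 * (1 + Rad (C n)) ^ 2 * C n + 2 * K * (1 + Rad (C n)) * B :=
    fun n => rfl
  have hC0 : ∀ n, 0 < C n := by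
    intro n
    induction n with
    | zero => exact inv_pos.2 hr
    | succ n ih =>
      rw [hC]
      have := hRad (C n)
      positivity
  set lvl : Λ → ℕ := fun i => (weightGraph β).dist i r
  refine ⟨fun i => Θ (C (lvl i)), ∑ i, Rad (C (lvl i)), fun i => hsm _, fun i => hle _,
    fun i => hone _, fun i x hx => ?_, fun t => ?_⟩
  · exact hzero _ _ (lt_of_le_of_lt (Finset.single_le_sum (f := fun i => Rad (C (lvl i)))
      (fun i _ => hRad _) (Finset.mem_univ i)) hx)
  set x : Λ → ℝ := fun i => (Real.exp (t i) - (1 + y i ^ 2) * Real.exp (-t i)) / 2 with hx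
  -- Outside the support of one cutoff everything vanishes; otherwise all |x_i| are bounded by their
  -- radii.
  by_cases hout : ∃ i, Rad (C (lvl i)) < |x i|
  · obtain ⟨i, hi⟩ := hout
    have : cutBerezin β h y (fun i => Θ (C (lvl i))) t = 0 :=
      cutBerezin_eq_zero (R := Rad (C (lvl i))) i (fun x hx => hzero _ _ hx) hi
    rw [this, abs_zero]
    positivity
  push Not at hout
  have hexp : ∀ i, Real.exp (t i) ≤ K * (1 + |x i|) ∧ Real.exp (-t i) ≤ K * (1 + |x i|) := by
    intro i
    have h1 := exp_le_of_horospherical (t i) (y i)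
    have h2 : (2 + y i ^ 2) * (1 + |x i|) ≤ K * (1 + |x i|) :=
      mul_le_mul_of_nonneg_right (hKy i) (by positivity)
    exact ⟨h1.1.trans h2, h1.2.trans h2⟩
  have hcoer : ∀ (v : Λ → ℝ) (d : ℕ) (i : Λ), lvl i = d →
      Real.exp (t i) * (v i * Real.exp (-t i)) ^ 2 ≤
        C d * (1 + |x i|) * (v ⬝ᵥ (Matrix.of (horoMat β h t)).mulVec v) := by
    intro v d
    have hQ := horoMat_quadratic_nonneg hβ hh t v
    set Q := v ⬝ᵥ (Matrix.of (horoMat β h t)).mulVec v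
    induction d with
    | zero =>
      intro i hi
      have : i = r := (hconn.dist_eq_zero_iff).1 hi
      subst this
      have h1 := horoMat_site_le hβ hh t v i
      rw [← le_div_iff₀' hr, div_eq_inv_mul] at h1
      refine h1.trans ?_
      change (h i)⁻¹ * Q ≤ (h i)⁻¹ * (1 + |x i|) * Q
      refine mul_le_mul_of_nonneg_right ?_ hQ
      exact le_mul_of_one_le_right (inv_pos.2 hr).le (by linarith [abs_nonneg (x i)])
    | succ d ih =>
      intro i hi
      obtain ⟨p, hadj, hp⟩ := exists_adj_dist_eq hconn hi
      rw [weightGraph, SimpleGraph.fromEdgeSet_adj] at hadj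
      have hb : 0 < β s(i, p) := lt_of_le_of_ne (hβ _) (Ne.symm hadj.1)
      have hip := horoMat_edge_le hβ hh t v hadj.2
      rw [← le_div_iff₀' hb, div_eq_inv_mul] at hip
      have hip2 : Real.exp (t i + t p) * (v i * Real.exp (-t i) - v p * Real.exp (-t p)) ^ 2 ≤
          B * Q := hip.trans (mul_le_mul_of_nonneg_right (hBe _) hQ)
      have hp2 := ih p hp
      have hxp : 1 + |x p| ≤ 1 + Rad (C d) := by
        have := hout p
        rw [show lvl p = d from hp] at this
        linarith
      set ρ := 1 + Rad (C d)
      have hρ : 0 ≤ ρ := by linarith [abs_nonneg (x p)]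
      set ui := v i * Real.exp (-t i)
      set up := v p * Real.exp (-t p)
      have hinv : Real.exp (-t p) * Real.exp (t p) = 1 := by rw [← Real.exp_add]; simp
      have hep : Real.exp (-t p) ≤ K * ρ :=
        (hexp p).2.trans (mul_le_mul_of_nonneg_left hxp hK0.le)
      have hup : up ^ 2 ≤ K * ρ * (C d * ρ * Q) := by
        calc up ^ 2 = Real.exp (-t p) * (Real.exp (t p) * up ^ 2) := by
              linear_combination -(up ^ 2) * hinv
          _ ≤ K * ρ * (C d * ρ * Q) := by
              refine mul_le_mul hep (hp2.trans ?_) (by positivity) (by positivity)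
              have := (hC0 d).le
              gcongr
      have hdiff : Real.exp (t i) * (ui - up) ^ 2 ≤ K * ρ * (B * Q) := by
        calc Real.exp (t i) * (ui - up) ^ 2 =
              Real.exp (-t p) * (Real.exp (t i + t p) * (ui - up) ^ 2) := by
              rw [Real.exp_add]
              linear_combination -(Real.exp (t i) * (ui - up) ^ 2) * hinv
          _ ≤ _ := mul_le_mul hep hip2 (by positivity) (by positivity)
      -- Splits u_i into the neighbour's value, controlled by induction, and a difference,
      -- controlled by the edge term.
      have hsq : ui ^ 2 ≤ 2 * up ^ 2 + 2 * (ui - up) ^ 2 := by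
        nlinarith [sq_nonneg (ui - 2 * up)]
      have hC0d := (hC0 d).le
      calc Real.exp (t i) * ui ^ 2 ≤ Real.exp (t i) * (2 * up ^ 2 + 2 * (ui - up) ^ 2) := by
            gcongr
        _ = 2 * (Real.exp (t i) * up ^ 2) + 2 * (Real.exp (t i) * (ui - up) ^ 2) := by ring
        _ ≤ 2 * (K * (1 + |x i|) * (K * ρ * (C d * ρ * Q))) + 2 * (K * ρ * (B * Q)) := by
            gcongr
            exact (hexp i).1
        _ ≤ 2 * (K * (1 + |x i|) * (K * ρ * (C d * ρ * Q))) +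
              2 * (K * ρ * (B * Q)) * (1 + |x i|) := by
            exact add_le_add le_rfl
              (le_mul_of_one_le_right (by positivity) (by linarith [abs_nonneg (x i)]))
        _ = C (d + 1) * (1 + |x i|) * Q := by
            rw [hC]
            ring
  have hden : ∀ i, 0 < C (lvl i) * (1 + |x i|) := fun i =>
    mul_pos (hC0 _) (by linarith [abs_nonneg (x i)])
  -- This δ_i is `hcoer` rewritten. Its factor e^{-t_i} matches the one in `cutJet`, and the rest
  -- matches the derivative bounds of the slow cutoff with parameter C.
  refine abs_cutBerezin_le t y (fun i => Real.exp (-t i) / (C (lvl i) * (1 + |x i|))) _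
    (fun i => div_nonneg (Real.exp_pos _).le (hden i).le) (fun v i => ?_) (fun i => hle _ _)
    (fun i => ?_) fun i => ?_
  · have h1 := hcoer v (lvl i) i rfl
    have h2 : Real.exp (-t i) / (C (lvl i) * (1 + |x i|)) * v i ^ 2 =
        (Real.exp (t i) * (v i * Real.exp (-t i)) ^ 2) / (C (lvl i) * (1 + |x i|)) := by
      have hinv : Real.exp (-t i) * Real.exp (t i) = 1 := by rw [← Real.exp_add]; simp
      rw [div_mul_eq_mul_div]
      congr 1
      linear_combination -(v i ^ 2 * Real.exp (-t i)) * hinv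
    rw [h2, div_le_iff₀' (hden i)]
    exact h1
  · have h1 := hd1 (C (lvl i)) (x i)
    change |deriv (Θ (C (lvl i))) (x i) * Real.exp (-t i)| ≤ _
    rw [abs_mul, abs_of_pos (Real.exp_pos _), le_div_iff₀ (hden i)]
    calc _ = C (lvl i) * (1 + |x i|) * |deriv (Θ (C (lvl i))) (x i)| * Real.exp (-t i) := by ring
      _ ≤ 1 * Real.exp (-t i) := by gcongr
      _ = _ := one_mul _
  · have h1 := hd2 (C (lvl i)) (x i)
    change |iteratedDeriv 2 (Θ (C (lvl i))) (x i) * Real.exp (-t i) ^ 2| ≤ _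
    rw [abs_mul, abs_of_pos (by positivity : 0 < Real.exp (-t i) ^ 2), div_pow,
      le_div_iff₀ (pow_pos (hden i) 2)]
    calc _ = (C (lvl i) * (1 + |x i|)) ^ 2 * |iteratedDeriv 2 (Θ (C (lvl i))) (x i)| *
          Real.exp (-t i) ^ 2 := by ring
      _ ≤ 1 * Real.exp (-t i) ^ 2 := by gcongr
      _ = _ := one_mul _

theorem continuous_horoMat : Continuous fun t : Λ → ℝ => Matrix.of (horoMat β h t) := by
  refine continuous_matrix fun i j => ?_
  simp only [Matrix.of_apply, horoMat_apply, horoDiag]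
  split_ifs <;> fun_prop

omit [DecidableEq Λ] in
theorem continuous_horoRest : Continuous fun q : (Λ → ℝ) × (Λ → ℝ) => horoRest β h q.1 q.2 := by
  unfold horoRest
  fun_prop

theorem continuous_cutBerezin (y : Λ → ℝ) {θ : Λ → ℝ → ℝ} (hθ : ∀ i, ContDiff ℝ ∞ (θ i)) :
    Continuous (cutBerezin β h y θ) := by
  have hjet : ∀ i n, Continuous fun t : Λ → ℝ => cutJet (θ i) (t i) (y i) n := by
    intro i n
    have h1 := (hθ i).continuous_deriv (by norm_num)
    have h2 := (hθ i).continuous_iteratedDeriv 2 (WithTop.coe_le_coe.2 le_top)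
    have h0 := (hθ i).continuous
    fin_cases n
    · exact h0.comp (by fun_prop)
    · exact (h1.comp (by fun_prop)).mul (by fun_prop)
    · exact (h2.comp (by fun_prop)).mul (by fun_prop)
  have hrep : ∀ c : Λ → Bool, Continuous fun t : Λ → ℝ =>
      (Matrix.of (replaceRows (horoMat β h t) c)).det := by
    intro c
    refine Continuous.matrix_det (continuous_matrix fun i j => ?_)
    simp only [Matrix.of_apply, replaceRows]
    split_ifs
    · exact continuous_const
    · exact continuous_horoMat.matrix_elem i j
  refine continuous_finsetSum _ fun c _ => Continuous.mul (continuous_finsetProd _ fun i _ => ?_)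
    ((hrep _).mul (hrep _))
  rcases c i with ⟨_ | _, _ | _⟩
  exacts [hjet i 0, hjet i 1, hjet i 1, hjet i 2]

/-- Near x the cutoffs are constantly 1, so only the term without replaced rows survives. -/
theorem cutBerezin_eq_det_sq (t y : Λ → ℝ) {θ : Λ → ℝ → ℝ} {m : ℝ}
    (hone : ∀ i x, |x| ≤ m → θ i x = 1)
    (ht : ∀ i, |(Real.exp (t i) - (1 + y i ^ 2) * Real.exp (-t i)) / 2| < m) :
    cutBerezin β h y θ t = (Matrix.of (horoMat β h t)).det ^ 2 := by
  have hk : ∀ i, cutJet (θ i) (t i) (y i) = ![1, 0, 0] := by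
    intro i
    have hev : θ i =ᶠ[nhds ((Real.exp (t i) - (1 + y i ^ 2) * Real.exp (-t i)) / 2)]
        fun _ => 1 := by
      filter_upwards [(isOpen_lt continuous_abs continuous_const).mem_nhds (ht i)] with x hx
      exact hone i x (le_of_lt hx)
    have h2 := (hev.iteratedDeriv 2).eq_of_nhds
    have h1 := hev.deriv_eq
    have h0 := hev.eq_of_nhds
    rw [iteratedDeriv_const] at h2
    simp [cutJet, h0, h1, h2]
  rw [cutBerezin, Finset.sum_eq_single fun _ => (false, false)]
  · simp [hk, pick, sq]
    rfl
  · intro c _ hc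
    obtain ⟨i, hi⟩ : ∃ i, c i ≠ (false, false) := by
      by_contra! hall
      exact hc (funext hall)
    rw [Finset.prod_eq_zero (Finset.mem_univ i), zero_mul]
    rw [hk]
    rcases hci : c i with ⟨_ | _, _ | _⟩ <;> simp_all [pick]
  · simp

/-- Dominated convergence on both sides as m → ∞: the integrand itself dominates on the left, and
4^|Λ| times the limiting integrand on the right. -/
theorem integral_form_eq (hβ : ∀ e, 0 ≤ β e) (hh : ∀ i, 0 ≤ h i)
    (hconn : (weightGraph β).Connected) (hpos : ∃ i, 0 < h i) (y : Λ → ℝ)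
    (obs : Config Λ → Grass Λ) (f : (Λ → ℝ) → ℝ) (hf : Continuous f)
    (hobs : ∀ R, IsJet β (fun q : Metric.closedBall (0 : Λ → ℝ) R => obs (q.1, y))
      (fun q v => f fun i => q.1 i + realZ q.1 y v i))
    (hL : Integrable fun x : Λ → ℝ => fermiIntL (integrandForm β h obs (x, y)))
    (hR : Integrable fun t : Λ → ℝ => f (fun i => Real.exp (t i)) *
      Real.exp (-horoRest β h t y) * (Matrix.of (horoMat β h t)).det ^ 2) :
    ∫ x : Λ → ℝ, fermiIntL (integrandForm β h obs (x, y)) =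
      ∫ t : Λ → ℝ, f (fun i => Real.exp (t i)) * Real.exp (-horoRest β h t y) *
        (Matrix.of (horoMat β h t)).det ^ 2 := by
  have : Nonempty Λ := hconn.nonempty
  choose θ R hsm hle hone hzero hbd using fun m : ℕ =>
    exists_cutoff_family hβ hh hconn hpos y (m : ℝ)
  have key := fun m => integral_cutoff_form β h y obs f hf hobs (θ m) (hsm m) (R m) (hzero m)
  have hbig : ∀ x : Λ → ℝ, ∀ᶠ m : ℕ in Filter.atTop, ∀ i, |x i| < m := by
    intro x
    obtain ⟨n, hn⟩ := exists_nat_gt ‖x‖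
    filter_upwards [Filter.eventually_ge_atTop n] with m hm i
    calc |x i| = ‖x i‖ := (Real.norm_eq_abs _).symm
      _ ≤ ‖x‖ := norm_le_pi_norm x i
      _ < n := hn
      _ ≤ m := by exact_mod_cast hm
  have hprodc : ∀ m, Continuous fun x : Λ → ℝ => ∏ i, θ m i (x i) := fun m =>
    continuous_finsetProd _ fun i _ => (hsm m i).continuous.comp (continuous_apply i)
  have hprodle : ∀ m (x : Λ → ℝ), |∏ i, θ m i (x i)| ≤ 1 := fun m x => by
    rw [Finset.abs_prod]
    exact Finset.prod_le_one (fun i _ => abs_nonneg _) fun i _ => hle m i _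
  have hfc : Continuous fun t : Λ → ℝ => f (fun i => Real.exp (t i)) *
      Real.exp (-horoRest β h t y) := by
    refine (hf.comp (by fun_prop)).mul (Real.continuous_exp.comp ?_)
    exact (continuous_horoRest.comp (continuous_id.prodMk continuous_const)).neg
  have lim1 : Filter.Tendsto (fun m : ℕ => ∫ x : Λ → ℝ, (∏ i, θ m i (x i)) *
      fermiIntL (integrandForm β h obs (x, y))) Filter.atTop
      (nhds (∫ x : Λ → ℝ, fermiIntL (integrandForm β h obs (x, y)))) := by
    refine tendsto_integral_of_dominated_convergence _
      (fun m => (hprodc m).aestronglyMeasurable.mul hL.1) hL.norm (fun m => ?_) ?_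
    · refine Filter.Eventually.of_forall fun x => ?_
      rw [norm_mul]
      exact mul_le_of_le_one_left (norm_nonneg _) (hprodle m x)
    · refine Filter.Eventually.of_forall fun x => ?_
      refine tendsto_const_nhds.congr' ?_
      filter_upwards [hbig x] with m hm
      rw [Finset.prod_eq_one fun i _ => hone m i _ (hm i).le, one_mul]
  have lim2 : Filter.Tendsto (fun m : ℕ => ∫ t : Λ → ℝ, f (fun i => Real.exp (t i)) *
      Real.exp (-horoRest β h t y) * cutBerezin β h y (θ m) t) Filter.atTop
      (nhds (∫ t : Λ → ℝ, f (fun i => Real.exp (t i)) * Real.exp (-horoRest β h t y) *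
        (Matrix.of (horoMat β h t)).det ^ 2)) := by
    refine tendsto_integral_of_dominated_convergence _
      (fun m => (hfc.mul (continuous_cutBerezin y (hsm m))).aestronglyMeasurable)
      (hR.norm.const_mul (4 ^ Fintype.card Λ)) (fun m => ?_) ?_
    · refine Filter.Eventually.of_forall fun t => ?_
      rw [norm_mul, norm_mul (f (fun i => Real.exp (t i)) * Real.exp (-horoRest β h t y)),
        mul_left_comm]
      refine mul_le_mul_of_nonneg_left ?_ (norm_nonneg _)
      rw [Real.norm_eq_abs, Real.norm_of_nonneg (sq_nonneg (Matrix.det _))]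
      exact hbd m t
    · refine Filter.Eventually.of_forall fun t => ?_
      refine tendsto_const_nhds.congr' ?_
      filter_upwards [hbig fun i =>
        (Real.exp (t i) - (1 + y i ^ 2) * Real.exp (-t i)) / 2] with m hm
      rw [cutBerezin_eq_det_sq t y (hone m) hm]
  simp only [key] at lim1
  exact tendsto_nhds_unique lim1 lim2

end CutoffRemoval

end

end HoroH24

namespace HoroH24

noncomputable section

open MeasureTheory

/-! ### Linear substitutions and Gaussian integrals -/

section LinearSubstitution

variable {ι : Type*} [Fintype ι] [DecidableEq ι]

theorem integral_comp_mulVec {M : Matrix ι ι ℝ} (hM : M.det ≠ 0) {g : (ι → ℝ) → ℝ}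
    (hg : Continuous g) : ∫ v, g (M.mulVec v) = |M.det|⁻¹ * ∫ v, g v := by
  have hc : Continuous (Matrix.toLin' M) := LinearMap.continuous_on_pi _
  have := integral_map (μ := volume) hc.aemeasurable
    (f := g) hg.aestronglyMeasurable
  rw [Real.map_matrix_volume_pi_eq_smul_volume_pi hM, integral_smul_measure,
    ENNReal.toReal_ofReal (abs_nonneg _), abs_inv, smul_eq_mul] at this
  exact this.symm

theorem integrable_comp_mulVec {M : Matrix ι ι ℝ} (hM : M.det ≠ 0) {g : (ι → ℝ) → ℝ}
    (hg : Continuous g) : Integrable (fun v => g (M.mulVec v)) ↔ Integrable g := by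
  have hc : Continuous (Matrix.toLin' M) := LinearMap.continuous_on_pi _
  have := integrable_map_measure (μ := volume) (f := Matrix.toLin' M) (g := g)
    hg.aestronglyMeasurable hc.aemeasurable
  rw [Real.map_matrix_volume_pi_eq_smul_volume_pi hM,
    integrable_smul_measure (by simpa using hM) ENNReal.ofReal_ne_top] at this
  exact this.symm

omit [DecidableEq ι] in
theorem exp_half_dotProduct (v : ι → ℝ) :
    Real.exp (-(1 / 2) * (v ⬝ᵥ v)) = ∏ i, Real.exp (-(1 / 2) * v i ^ 2) := by
  rw [← Real.exp_sum, dotProduct, Finset.mul_sum]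
  simp only [sq]

-- Writing M = B*B, the map v ↦ Bv reduces to a product of one-dimensional Gaussians.
open scoped MatrixOrder in
theorem gaussian_matrix_integral {M : Matrix ι ι ℝ} (hM : M.PosDef) :
    Integrable (fun v : ι → ℝ => Real.exp (-(1 / 2) * (v ⬝ᵥ M.mulVec v))) ∧
    ∫ v : ι → ℝ, Real.exp (-(1 / 2) * (v ⬝ᵥ M.mulVec v)) =
      Real.sqrt (2 * Real.pi) ^ Fintype.card ι * (Real.sqrt M.det)⁻¹ := by
  obtain ⟨B, rfl⟩ := CStarAlgebra.nonneg_iff_eq_star_mul_self.mp hM.posSemidef.nonneg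
  have hdet : (star B * B).det = B.det ^ 2 := by
    rw [Matrix.det_mul, Matrix.star_eq_conjTranspose, Matrix.det_conjTranspose]
    simp [sq]
  have hB : B.det ≠ 0 := by
    intro h0
    have := hM.det_pos
    rw [hdet, h0] at this
    norm_num at this
  have hq : ∀ v : ι → ℝ, v ⬝ᵥ (star B * B).mulVec v = B.mulVec v ⬝ᵥ B.mulVec v := by
    intro v
    rw [← Matrix.mulVec_mulVec, Matrix.dotProduct_mulVec, Matrix.star_eq_conjTranspose,
      Matrix.vecMul_conjTranspose]
    simp
  have hg : Continuous fun v : ι → ℝ => Real.exp (-(1 / 2) * (v ⬝ᵥ v)) := by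
    unfold dotProduct
    fun_prop
  have h1 : Integrable fun x : ℝ => Real.exp (-(1 / 2) * x ^ 2) :=
    integrable_exp_neg_mul_sq (by norm_num)
  have h2 : ∫ x : ℝ, Real.exp (-(1 / 2) * x ^ 2) = Real.sqrt (2 * Real.pi) := by
    rw [integral_gaussian]
    congr 1
    ring
  simp only [hq]
  rw [integrable_comp_mulVec hB hg, integral_comp_mulVec hB hg]
  simp only [exp_half_dotProduct]
  refine ⟨Integrable.fintype_prod fun _ => h1, ?_⟩
  rw [integral_fintype_prod_volume_eq_pow fun x : ℝ => Real.exp (-(1 / 2) * x ^ 2), h2, hdet,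
    Real.sqrt_sq_eq_abs, mul_comm]

theorem det_diagonal_exp (t : ι → ℝ) :
    (Matrix.diagonal fun i => Real.exp (t i)).det = Real.exp (∑ i, t i) := by
  rw [Matrix.det_diagonal, Real.exp_sum]

theorem integral_exp_smul (t : ι → ℝ) {g : (ι → ℝ) → ℝ} (hg : Continuous g) :
    ∫ s : ι → ℝ, Real.exp (∑ i, t i) * g (fun i => Real.exp (t i) * s i) = ∫ y, g y := by
  have h := integral_comp_mulVec (M := Matrix.diagonal fun i => Real.exp (t i))
    (by rw [det_diagonal_exp]; positivity) hg
  rw [det_diagonal_exp, abs_of_pos (Real.exp_pos _)] at h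
  have e : ∀ s, (Matrix.diagonal fun i => Real.exp (t i)).mulVec s =
      fun i => Real.exp (t i) * s i := fun s => funext fun i => Matrix.mulVec_diagonal _ _ _
  simp only [e] at h
  rw [integral_const_mul, h, ← mul_assoc, mul_inv_cancel₀ (Real.exp_pos _).ne', one_mul]

theorem integrable_exp_smul (t : ι → ℝ) {g : (ι → ℝ) → ℝ} (hg : Continuous g) :
    Integrable (fun s : ι → ℝ => Real.exp (∑ i, t i) * g (fun i => Real.exp (t i) * s i)) ↔
      Integrable g := by
  have h := integrable_comp_mulVec (M := Matrix.diagonal fun i => Real.exp (t i))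
    (by rw [det_diagonal_exp]; positivity) hg
  have e : ∀ s, (Matrix.diagonal fun i => Real.exp (t i)).mulVec s =
      fun i => Real.exp (t i) * s i := fun s => funext fun i => Matrix.mulVec_diagonal _ _ _
  simp only [e] at h
  rw [← h, integrable_const_mul_iff (Real.exp_pos _).ne'.isUnit]

end LinearSubstitution

/-! ### The horospherical densities in terms of the matrix M -/

section Densities

variable {Λ : Type*} [Fintype Λ] [DecidableEq Λ] {β : Sym2 Λ → ℝ} {h : Λ → ℝ}

/-- A null vector has e^{-t}v equal to zero where h is positive and equal at the ends of every edge,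
so by connectedness it is zero. -/
theorem posDef_horoMat (hβ : ∀ e, 0 ≤ β e) (hh : ∀ i, 0 ≤ h i)
    (hconn : (weightGraph β).Connected) (hpos : ∃ i, 0 < h i) (t : Λ → ℝ) :
    (Matrix.of (horoMat β h t)).PosDef := by
  have hsymm := isSymm_horoMat (β := β) (h := h) t
  refine Matrix.PosDef.of_dotProduct_mulVec_pos ?_ fun v hv => ?_
  · rw [Matrix.IsHermitian, Matrix.conjTranspose_eq_transpose_of_trivial]
    exact hsymm
  rw [star_trivial]
  refine lt_of_le_of_ne (horoMat_quadratic_nonneg hβ hh t v) fun h0 => hv ?_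
  obtain ⟨r, hr⟩ := hpos
  have hz : ∀ i, v i * Real.exp (-t i) = 0 := by
    intro i
    obtain ⟨w⟩ := hconn.preconnected i r
    induction w with
    | nil =>
      rename_i u
      have h1 := horoMat_site_le hβ hh t v u
      rw [← h0] at h1
      have h2 : (v u * Real.exp (-t u)) ^ 2 ≤ 0 := by
        by_contra hlt
        push Not at hlt
        have : 0 < h u * (Real.exp (t u) * (v u * Real.exp (-t u)) ^ 2) := by positivity
        linarith
      exact pow_eq_zero_iff (two_ne_zero) |>.1 (le_antisymm h2 (sq_nonneg _))
    | cons hadj _ ih =>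
      rename_i a b c _
      rw [weightGraph, SimpleGraph.fromEdgeSet_adj] at hadj
      have hb : 0 < β s(a, b) := lt_of_le_of_ne (hβ _) (Ne.symm hadj.1)
      have h1 := horoMat_edge_le hβ hh t v hadj.2
      rw [← h0, ih hr, sub_zero] at h1
      have h2 : (v a * Real.exp (-t a)) ^ 2 ≤ 0 := by
        by_contra hlt
        push Not at hlt
        have : 0 < β s(a, b) * (Real.exp (t a + t b) * (v a * Real.exp (-t a)) ^ 2) := by
          positivity
        linarith
      exact pow_eq_zero_iff (two_ne_zero) |>.1 (le_antisymm h2 (sq_nonneg _))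
  funext i
  exact (mul_eq_zero.1 (hz i)).resolve_right (Real.exp_pos _).ne'

/-- A diagonal weight enters `horoDiag` with factor e^0 and is subtracted again in `horoMat`, so it
disappears as in `negLap`. -/
theorem negLap_eq (t : Λ → ℝ) : negLap β h t =
    Matrix.diagonal (fun i => Real.exp (t i)) * Matrix.of (horoMat β h t) *
      Matrix.diagonal (fun i => Real.exp (t i)) := by
  ext i j
  rw [Matrix.mul_diagonal, Matrix.diagonal_mul, Matrix.of_apply, horoMat_apply, negLap,
    Matrix.of_apply]
  split_ifs with hij
  · subst hij
    have hi : Real.exp (t i) * Real.exp (-t i) = 1 := by rw [← Real.exp_add]; simp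
    have e : ∑ j, β s(i, j) * Real.exp (t i + t j) =
        (∑ j, β s(i, j) * Real.exp (t j - t i)) * (Real.exp (t i) * Real.exp (t i)) := by
      rw [Finset.sum_mul]
      refine Finset.sum_congr rfl fun j _ => ?_
      rw [mul_assoc, ← Real.exp_add, ← Real.exp_add]
      ring_nf
    have e2 := Finset.add_sum_erase Finset.univ (fun j => β s(i, j) * Real.exp (t i + t j))
      (Finset.mem_univ i)
    rw [e] at e2
    simp only [Real.exp_add] at e2 ⊢
    rw [horoDiag]
    linear_combination e2 - h i * Real.exp (t i) * hi
  · rw [Real.exp_add]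
    ring

theorem det_negLap (t : Λ → ℝ) : (negLap β h t).det =
    Real.exp (2 * ∑ i, t i) * (Matrix.of (horoMat β h t)).det := by
  rw [negLap_eq, Matrix.det_mul, Matrix.det_mul, det_diagonal_exp, two_mul, Real.exp_add]
  ring

omit [DecidableEq Λ] in
theorem horoRest_zero (t : Λ → ℝ) : horoRest β h t 0 =
    (1 / 2) * ∑ i, ∑ j, β s(i, j) * (Real.cosh (t i - t j) - 1) +
      ∑ i, h i * (Real.cosh (t i) - 1) := by
  rw [horoRest]
  congr 2
  · refine Finset.sum_congr rfl fun i _ => Finset.sum_congr rfl fun j _ => ?_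
    rw [Real.cosh_eq, neg_sub]
    simp only [Pi.zero_apply]
    ring
  · funext i
    rw [Real.cosh_eq]
    simp

/-- The bosonic quadratic form in y has the same matrix as the fermions, which is why y integrates
to a power of the same determinant. -/
theorem horoRest_eq_add (t y : Λ → ℝ) : horoRest β h t y =
    horoRest β h t 0 + (1 / 2) * (y ⬝ᵥ (Matrix.of (horoMat β h t)).mulVec y) := by
  have h1 : ∀ i j, β s(i, j) * (-1 - y i * y j + (1 / 2) *
      (Real.exp (t i - t j) * (1 + y j ^ 2) + Real.exp (t j - t i) * (1 + y i ^ 2))) =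
      β s(i, j) * (-1 - (0 : Λ → ℝ) i * (0 : Λ → ℝ) j + (1 / 2) *
      (Real.exp (t i - t j) * (1 + (0 : Λ → ℝ) j ^ 2) +
        Real.exp (t j - t i) * (1 + (0 : Λ → ℝ) i ^ 2))) +
      (1 / 2) * (β s(i, j) * (Real.exp (t i + t j) *
        (y i * Real.exp (-t i) - y j * Real.exp (-t j)) ^ 2)) := fun i j => by
    rw [exp_mul_sub_sq]
    simp only [Pi.zero_apply]
    ring
  have h2 : ∀ i, h i * ((Real.exp (t i) + (1 + y i ^ 2) * Real.exp (-t i)) / 2 - 1) =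
      h i * ((Real.exp (t i) + (1 + (0 : Λ → ℝ) i ^ 2) * Real.exp (-t i)) / 2 - 1) +
      (1 / 2) * (h i * (Real.exp (t i) * (y i * Real.exp (-t i)) ^ 2)) := fun i => by
    rw [exp_mul_sq]
    simp only [Pi.zero_apply]
    ring
  rw [horoMat_quadratic, horoRest, horoRest]
  simp only [h1, h2, Finset.sum_add_distrib, ← Finset.mul_sum]
  ring

theorem horoTS_eq (t s : Λ → ℝ) : horoTS β h t s =
    horoRest β h t (fun i => Real.exp (t i) * s i) - 2 * Real.log (negLap β h t).det +
      3 * ∑ i, t i := by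
  rw [horoRest_eq_add, horoMat_quadratic, horoRest_zero, horoTS]
  have hi : ∀ i, Real.exp (t i) * s i * Real.exp (-t i) = s i := fun i => by
    rw [mul_right_comm, ← Real.exp_add, add_neg_cancel, Real.exp_zero, one_mul]
  have h1 : ∀ i j, β s(i, j) *
      (Real.cosh (t i - t j) + (1 / 2) * Real.exp (t i + t j) * (s i - s j) ^ 2 - 1) =
      β s(i, j) * (Real.cosh (t i - t j) - 1) +
      (1 / 2) * (β s(i, j) * (Real.exp (t i + t j) * (s i - s j) ^ 2)) := fun i j => by ring
  have h2 : ∀ i, h i * (Real.cosh (t i) + (1 / 2) * Real.exp (t i) * s i ^ 2 - 1) =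
      h i * (Real.cosh (t i) - 1) + (1 / 2) * (h i * (Real.exp (t i) * s i ^ 2)) :=
    fun i => by ring
  simp only [hi, h1, h2, Finset.sum_add_distrib, ← Finset.mul_sum]
  ring

/-- From det(-Δ)² comes e^{4Σt}; against e^{-3Σt} this leaves e^{Σt}, the Jacobian of y = e^t s. -/
theorem exp_neg_horoTS (hβ : ∀ e, 0 ≤ β e) (hh : ∀ i, 0 ≤ h i)
    (hconn : (weightGraph β).Connected) (hpos : ∃ i, 0 < h i) (t s : Λ → ℝ) :
    Real.exp (-horoTS β h t s) = Real.exp (∑ i, t i) *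
      (Real.exp (-horoRest β h t (fun i => Real.exp (t i) * s i)) *
        (Matrix.of (horoMat β h t)).det ^ 2) := by
  have hd := (posDef_horoMat hβ hh hconn hpos t).det_pos
  rw [horoTS_eq, det_negLap, Real.log_mul (Real.exp_pos _).ne' hd.ne', Real.log_exp]
  set D := (Matrix.of (horoMat β h t)).det
  set E := horoRest β h t fun i => Real.exp (t i) * s i
  rw [show -(E - 2 * (2 * ∑ i, t i + Real.log D) + 3 * ∑ i, t i) =
    ∑ i, t i + (-E + (Real.log D + Real.log D)) by ring, Real.exp_add, Real.exp_add, Real.exp_add,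
    Real.exp_log hd, sq]

/-- Here the power 3/2 of det(-Δ) gives e^{3Σt}, which cancels e^{-3Σt} exactly. -/
theorem exp_neg_horoT (hβ : ∀ e, 0 ≤ β e) (hh : ∀ i, 0 ≤ h i)
    (hconn : (weightGraph β).Connected) (hpos : ∃ i, 0 < h i) (t : Λ → ℝ) :
    Real.exp (-horoT β h t) = Real.exp (-horoRest β h t 0) *
      ((Matrix.of (horoMat β h t)).det * Real.sqrt (Matrix.of (horoMat β h t)).det) := by
  have hd := (posDef_horoMat hβ hh hconn hpos t).det_pos
  rw [horoT, ← horoRest_zero, det_negLap, Real.log_mul (Real.exp_pos _).ne' hd.ne', Real.log_exp]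
  set D := (Matrix.of (horoMat β h t)).det
  set E := horoRest β h t 0
  have hs : Real.sqrt D = Real.exp (Real.log D / 2) := by
    rw [← Real.log_sqrt hd.le, Real.exp_log (Real.sqrt_pos.2 hd)]
  rw [show -(E - 3 / 2 * (2 * ∑ i, t i + Real.log D) + 3 * ∑ i, t i) =
    -E + (Real.log D + Real.log D / 2) by ring, Real.exp_add, Real.exp_add,
    Real.exp_log hd, hs]

end Densities

/-! ### Reduction of the expectations to bosonic integrals -/

section Reduction

variable {Λ : Type*} [Fintype Λ] [DecidableEq Λ] {β : Sym2 Λ → ℝ} {h : Λ → ℝ}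

/-- Fubini with y outermost: the substitution leaves y fixed, and almost every slice is integrable
on both sides. -/
theorem expect_eq_integral (hβ : ∀ e, 0 ≤ β e) (hh : ∀ i, 0 ≤ h i)
    (hconn : (weightGraph β).Connected) (hpos : ∃ i, 0 < h i)
    (obs : Config Λ → Grass Λ) (f : (Λ → ℝ) → (Λ → ℝ) → ℝ) (hf : ∀ y, Continuous fun u => f u y)
    (hobs : ∀ y R, IsJet β (fun q : Metric.closedBall (0 : Λ → ℝ) R => obs (q.1, y))
      (fun q v => f (fun i => q.1 i + realZ q.1 y v i) y))
    (hL : Integrable (integrand β h obs))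
    (hR : Integrable fun q : (Λ → ℝ) × (Λ → ℝ) => f (fun i => Real.exp (q.1 i)) q.2 *
      Real.exp (-horoRest β h q.1 q.2) * (Matrix.of (horoMat β h q.1)).det ^ 2) :
    expect β h obs = ((2 * Real.pi) ^ Fintype.card Λ)⁻¹ *
      ∫ q : (Λ → ℝ) × (Λ → ℝ), f (fun i => Real.exp (q.1 i)) q.2 *
        Real.exp (-horoRest β h q.1 q.2) * (Matrix.of (horoMat β h q.1)).det ^ 2 := by
  have hL' : Integrable fun p : Config Λ => fermiIntL (integrandForm β h obs p) := by
    have hc : ((2 * Real.pi) ^ Fintype.card Λ)⁻¹ ≠ 0 := by positivity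
    exact (integrable_const_mul_iff hc.isUnit _).1 hL
  have h1 : expect β h obs = ((2 * Real.pi) ^ Fintype.card Λ)⁻¹ *
      ∫ p : Config Λ, fermiIntL (integrandForm β h obs p) :=
    integral_const_mul _ _
  rw [h1]
  congr 1
  rw [Measure.volume_eq_prod] at hL' hR ⊢
  rw [integral_prod_symm _ hL', integral_prod_symm _ hR]
  refine integral_congr_ae ?_
  filter_upwards [hL'.prod_left_ae, hR.prod_left_ae] with y hy1 hy2
  exact integral_form_eq hβ hh hconn hpos y obs (fun u => f u y) (hf y) (hobs y) hy1 hy2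

theorem expect_obsTS (hβ : ∀ e, 0 ≤ β e) (hh : ∀ i, 0 ≤ h i)
    (hconn : (weightGraph β).Connected) (hpos : ∃ i, 0 < h i) (F : (Λ ⊕ Λ → ℝ) → ℝ)
    (hF : ContDiff ℝ ∞ F) (hL : Integrable (integrand β h (obsTS F)))
    (hR : Integrable (fun q : (Λ → ℝ) × (Λ → ℝ) =>
        F (Sum.elim (fun i => Real.exp (q.1 i)) (fun i => Real.exp (q.1 i) * q.2 i)) *
          Real.exp (-horoTS β h q.1 q.2))) :
    expect β h (obsTS F) =
        ∫ q : (Λ → ℝ) × (Λ → ℝ),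
          F (Sum.elim (fun i => Real.exp (q.1 i)) (fun i => Real.exp (q.1 i) * q.2 i)) *
            Real.exp (-horoTS β h q.1 q.2) *
              ((2 * Real.pi) ^ Fintype.card Λ)⁻¹ := by
  set G : (Λ → ℝ) × (Λ → ℝ) → ℝ := fun q => F (Sum.elim (fun i => Real.exp (q.1 i)) q.2) *
      Real.exp (-horoRest β h q.1 q.2) * (Matrix.of (horoMat β h q.1)).det ^ 2 with hG
  have hel : Continuous fun q : (Λ → ℝ) × (Λ → ℝ) =>
      (Sum.elim (fun i => Real.exp (q.1 i)) q.2 : Λ ⊕ Λ → ℝ) := by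
    refine continuous_pi fun k => ?_
    rcases k with i | i <;> simp only [Sum.elim_inl, Sum.elim_inr] <;> fun_prop
  have hGc : Continuous G := ((hF.continuous.comp hel).mul
    (Real.continuous_exp.comp continuous_horoRest.neg)).mul
    ((continuous_horoMat.comp continuous_fst).matrix_det.pow 2)
  have hGt : ∀ t, Continuous fun y => G (t, y) := fun t =>
    hGc.comp (continuous_const.prodMk continuous_id)
  have hK : ∀ t s, F (Sum.elim (fun i => Real.exp (t i)) (fun i => Real.exp (t i) * s i)) *
      Real.exp (-horoTS β h t s) =
      Real.exp (∑ i, t i) * G (t, fun i => Real.exp (t i) * s i) := by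
    intro t s
    rw [exp_neg_horoTS hβ hh hconn hpos, hG]
    ring
  simp only [hK] at hR ⊢
  have hR' := hR
  rw [Measure.volume_eq_prod, integrable_prod_iff hR.1] at hR
  -- The assumed integrability in (t, s) is carried over to (t, y) fibre by fibre.
  have hGint : Integrable G := by
    rw [Measure.volume_eq_prod, integrable_prod_iff hGc.aestronglyMeasurable]
    refine ⟨?_, ?_⟩
    · filter_upwards [hR.1] with t ht
      exact (integrable_exp_smul t (hGt t)).1 ht
    · refine hR.2.congr (Filter.Eventually.of_forall fun t => ?_)
      simp only [norm_mul, Real.norm_of_nonneg (Real.exp_pos _).le]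
      exact integral_exp_smul t (hGt t).norm
  rw [expect_eq_integral hβ hh hconn hpos (obsTS F) (fun u y => F (Sum.elim u y)) ?_ ?_ hL hGint,
    integral_mul_const, mul_comm]
  · congr 1
    rw [Measure.volume_eq_prod] at hGint hR' ⊢
    rw [integral_prod _ hGint, integral_prod _ hR']
    exact integral_congr_ae (Filter.Eventually.of_forall fun t =>
      (integral_exp_smul t (hGt t)).symm)
  · intro y
    refine hF.continuous.comp (continuous_pi fun k => ?_)
    rcases k with i | i <;> simp only [Sum.elim_inl, Sum.elim_inr] <;> fun_prop
  · intro y R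
    have : CompactSpace (Metric.closedBall (0 : Λ → ℝ) R) :=
      isCompact_iff_compactSpace.1 (isCompact_closedBall _ _)
    exact isJet_obsTS (p := fun q : Metric.closedBall (0 : Λ → ℝ) R => (q.1, y)) (by fun_prop) hF

/-- Stated for any form with the right jets, so that it serves both `obsT F` and the constant form
1. Half of the powers of √(2π) are used by the Gaussian integral in y. -/
theorem expect_eq_integral_horoT (hβ : ∀ e, 0 ≤ β e) (hh : ∀ i, 0 ≤ h i)
    (hconn : (weightGraph β).Connected) (hpos : ∃ i, 0 < h i) (obs : Config Λ → Grass Λ)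
    (F : (Λ → ℝ) → ℝ) (hF : Continuous F)
    (hobs : ∀ y R, IsJet β (fun q : Metric.closedBall (0 : Λ → ℝ) R => obs (q.1, y))
      (fun q v => F (fun i => q.1 i + realZ q.1 y v i)))
    (hL : Integrable (integrand β h obs))
    (hR : Integrable (fun t : Λ → ℝ =>
        F (fun i => Real.exp (t i)) * Real.exp (-horoT β h t))) :
    expect β h obs =
        ∫ t : Λ → ℝ, F (fun i => Real.exp (t i)) * Real.exp (-horoT β h t) *
          (Real.sqrt (2 * Real.pi) ^ Fintype.card Λ)⁻¹ := by
  set G : (Λ → ℝ) × (Λ → ℝ) → ℝ := fun q => F (fun i => Real.exp (q.1 i)) *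
      Real.exp (-horoRest β h q.1 q.2) * (Matrix.of (horoMat β h q.1)).det ^ 2 with hG
  set c := Real.sqrt (2 * Real.pi) ^ Fintype.card Λ with hc
  have hc0 : 0 < c := by positivity
  have hGc : Continuous G := ((hF.comp (by fun_prop)).mul
    (Real.continuous_exp.comp continuous_horoRest.neg)).mul
    ((continuous_horoMat.comp continuous_fst).matrix_det.pow 2)
  have hGq : ∀ t y, G (t, y) = (F (fun i => Real.exp (t i)) *
      Real.exp (-horoRest β h t 0) * (Matrix.of (horoMat β h t)).det ^ 2) *
      Real.exp (-(1 / 2) * (y ⬝ᵥ (Matrix.of (horoMat β h t)).mulVec y)) := by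
    intro t y
    simp only [hG]
    rw [horoRest_eq_add, neg_add, Real.exp_add, neg_mul]
    ring
  have hga := fun t => gaussian_matrix_integral (posDef_horoMat hβ hh hconn hpos t)
  have hsq : ∀ t, (Matrix.of (horoMat β h t)).det ^ 2 *
      (c * (Real.sqrt (Matrix.of (horoMat β h t)).det)⁻¹) = c *
      ((Matrix.of (horoMat β h t)).det * Real.sqrt (Matrix.of (horoMat β h t)).det) := by
    intro t
    have hd := (posDef_horoMat hβ hh hconn hpos t).det_pos
    have h1 := Real.mul_self_sqrt hd.le
    have h2 := Real.sqrt_pos.2 hd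
    set D := (Matrix.of (horoMat β h t)).det
    have h3 : D * (Real.sqrt D)⁻¹ = Real.sqrt D := by
      rw [mul_inv_eq_iff_eq_mul₀ h2.ne', h1]
    linear_combination (c * D) * h3
  have hGi : ∀ t, ∫ y, G (t, y) = c * (F (fun i => Real.exp (t i)) *
      Real.exp (-horoT β h t)) := by
    intro t
    simp only [hGq]
    rw [integral_const_mul, (hga t).2, exp_neg_horoT hβ hh hconn hpos]
    linear_combination (F (fun i => Real.exp (t i)) * Real.exp (-horoRest β h t 0)) * hsq t
  have hGint : Integrable G := by
    rw [Measure.volume_eq_prod, integrable_prod_iff hGc.aestronglyMeasurable]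
    refine ⟨Filter.Eventually.of_forall fun t => ?_, ?_⟩
    · simp only [hGq]
      exact (hga t).1.const_mul _
    · refine (hR.norm.const_mul c).congr (Filter.Eventually.of_forall fun t => ?_)
      simp only [hGq, norm_mul, Real.norm_of_nonneg (Real.exp_pos _).le,
        Real.norm_of_nonneg (sq_nonneg (Matrix.det _))]
      rw [integral_const_mul, (hga t).2, exp_neg_horoT hβ hh hconn hpos]
      linear_combination -(‖F (fun i => Real.exp (t i))‖ *
        Real.exp (-horoRest β h t 0)) * hsq t
  rw [expect_eq_integral hβ hh hconn hpos obs (fun u _ => F u) (fun _ => hF) hobs hL hGint,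
    integral_mul_const, mul_comm]
  rw [Measure.volume_eq_prod] at hGint ⊢
  change (∫ q, G q ∂_) * _ = _
  rw [integral_prod _ hGint]
  simp only [hGi]
  rw [integral_const_mul, mul_comm c, mul_assoc]
  congr 1
  have h2 : (2 * Real.pi) ^ Fintype.card Λ = c * c := by
    rw [hc, ← mul_pow, Real.mul_self_sqrt (by positivity)]
  rw [h2, mul_inv, ← mul_assoc, mul_inv_cancel₀ hc0.ne', one_mul]

end Reduction

end

end HoroH24

namespace HoroH24

noncomputable section

open MeasureTheory

/-! ### Forms with coefficients of polynomial growth -/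

section PolynomialGrowth

variable {Λ : Type*} [Fintype Λ]

/-- Continuous functions of at most polynomial growth. -/
def PolyBounded (c : Config Λ → ℝ) : Prop :=
  Continuous c ∧ ∃ (C : ℝ) (m : ℕ), ∀ p, |c p| ≤ C * (1 + ‖p‖) ^ m

theorem PolyBounded.const (a : ℝ) : PolyBounded fun _ : Config Λ => a :=
  ⟨continuous_const, |a|, 0, fun p => by simp⟩

theorem PolyBounded.add {c c' : Config Λ → ℝ} (h : PolyBounded c) (h' : PolyBounded c') :
    PolyBounded fun p => c p + c' p := by
  obtain ⟨hc, C, m, hb⟩ := h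
  obtain ⟨hc', C', m', hb'⟩ := h'
  refine ⟨hc.add hc', |C| + |C'|, m + m', fun p => ?_⟩
  have h1 : 1 ≤ 1 + ‖p‖ := by linarith [norm_nonneg p]
  have e1 : (1 + ‖p‖) ^ m ≤ (1 + ‖p‖) ^ (m + m') := pow_le_pow_right₀ h1 (by omega)
  have e2 : (1 + ‖p‖) ^ m' ≤ (1 + ‖p‖) ^ (m + m') := pow_le_pow_right₀ h1 (by omega)
  calc |c p + c' p| ≤ |c p| + |c' p| := abs_add_le _ _
    _ ≤ |C| * (1 + ‖p‖) ^ m + |C'| * (1 + ‖p‖) ^ m' := by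
        refine add_le_add ((hb p).trans ?_) ((hb' p).trans ?_)
        · gcongr; exact le_abs_self C
        · gcongr; exact le_abs_self C'
    _ ≤ _ := by
        rw [add_mul]
        gcongr

theorem PolyBounded.mul {c c' : Config Λ → ℝ} (h : PolyBounded c) (h' : PolyBounded c') :
    PolyBounded fun p => c p * c' p := by
  obtain ⟨hc, C, m, hb⟩ := h
  obtain ⟨hc', C', m', hb'⟩ := h'
  refine ⟨hc.mul hc', C * C', m + m', fun p => ?_⟩
  rw [abs_mul, pow_add, mul_mul_mul_comm]
  exact mul_le_mul (hb p) (hb' p) (abs_nonneg _) ((abs_nonneg _).trans (hb p))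

theorem abs_fst_le_norm (p : Config Λ) (i : Λ) : |p.1 i| ≤ ‖p‖ :=
  (norm_le_pi_norm p.1 i).trans (norm_fst_le p)

theorem abs_snd_le_norm (p : Config Λ) (i : Λ) : |p.2 i| ≤ ‖p‖ :=
  (norm_le_pi_norm p.2 i).trans (norm_snd_le p)

theorem PolyBounded.fst (i : Λ) : PolyBounded fun p : Config Λ => p.1 i :=
  ⟨by fun_prop, 1, 1, fun p => by linarith [abs_fst_le_norm p i, norm_nonneg p]⟩

theorem PolyBounded.snd (i : Λ) : PolyBounded fun p : Config Λ => p.2 i :=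
  ⟨by fun_prop, 1, 1, fun p => by linarith [abs_snd_le_norm p i, norm_nonneg p]⟩

/-- The base is at least 1 and derivatives only lower the exponent, so every power is at most the
base itself. -/
theorem PolyBounded.iteratedDeriv_rpow (k : ℕ) (r : ℝ) (hr : r ≤ 1) (i : Λ) :
    PolyBounded fun p : Config Λ =>
      iteratedDeriv k (fun w : ℝ => w ^ r) (1 + p.1 i ^ 2 + p.2 i ^ 2) := by
  have hb : ∀ p : Config Λ, 1 ≤ 1 + p.1 i ^ 2 + p.2 i ^ 2 := fun p => by
    linarith [sq_nonneg (p.1 i), sq_nonneg (p.2 i)]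
  simp only [iteratedDeriv_eq_iterate, Real.iter_deriv_rpow_const]
  refine (PolyBounded.const _).mul ⟨?_, 2, 2, fun p => ?_⟩
  · refine Continuous.rpow_const (by fun_prop) fun p => Or.inl ?_
    linarith [hb p]
  · rw [abs_of_nonneg (Real.rpow_nonneg (by linarith [hb p]) _)]
    calc _ ≤ (1 + p.1 i ^ 2 + p.2 i ^ 2) ^ (1 : ℝ) := by
          refine Real.rpow_le_rpow_of_exponent_le (hb p) ?_
          have : (0 : ℝ) ≤ k := by positivity
          linarith
      _ ≤ _ := by
          rw [Real.rpow_one, ← sq_abs (p.1 i), ← sq_abs (p.2 i)]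
          nlinarith [abs_fst_le_norm p i, abs_snd_le_norm p i, norm_nonneg p,
            abs_nonneg (p.1 i), abs_nonneg (p.2 i)]

/-- Forms with coefficients of at most polynomial growth. -/
inductive PolyForm : (Config Λ → Grass Λ) → Prop
  | smul (c : Config Λ → ℝ) (g : Grass Λ) (hc : PolyBounded c) : PolyForm fun p => c p • g
  | add (a a' : Config Λ → Grass Λ) (h : PolyForm a) (h' : PolyForm a') :
      PolyForm fun p => a p + a' p

theorem PolyForm.const (g : Grass Λ) : PolyForm fun _ : Config Λ => g := by
  simpa using PolyForm.smul (fun _ => 1) g (PolyBounded.const 1)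

theorem PolyForm.algebraMap {c : Config Λ → ℝ} (hc : PolyBounded c) :
    PolyForm fun p => algebraMap ℝ (Grass Λ) (c p) := by
  simp only [Algebra.algebraMap_eq_smul_one]
  exact PolyForm.smul c 1 hc

theorem PolyForm.mul {a a' : Config Λ → Grass Λ} (h : PolyForm a) (h' : PolyForm a') :
    PolyForm fun p => a p * a' p := by
  induction h with
  | smul c g hc =>
    induction h' with
    | smul c' g' hc' =>
      simp only [smul_mul_smul_comm]
      exact PolyForm.smul _ _ (hc.mul hc')
    | add b b' _ _ ih ih' =>
      simp only [mul_add]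
      exact PolyForm.add _ _ ih ih'
  | add b b' _ _ ih ih' =>
    simp only [add_mul]
    exact PolyForm.add _ _ ih ih'

theorem PolyForm.const_smul {a : Config Λ → Grass Λ} (r : ℝ) (h : PolyForm a) :
    PolyForm fun p => r • a p := by
  simp only [Algebra.smul_def]
  exact (PolyForm.const _).mul h

theorem PolyForm.sub {a a' : Config Λ → Grass Λ} (h : PolyForm a) (h' : PolyForm a') :
    PolyForm fun p => a p - a' p := by
  simpa [sub_eq_add_neg] using PolyForm.add _ _ h (h'.const_smul (-1))

theorem PolyForm.sum {κ : Type*} (s : Finset κ) {a : κ → Config Λ → Grass Λ}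
    (h : ∀ k, PolyForm (a k)) : PolyForm fun p => ∑ k ∈ s, a k p := by
  classical
  induction s using Finset.induction_on with
  | empty => simpa using PolyForm.const (Λ := Λ) 0
  | insert k s hk ih => simpa [Finset.sum_insert hk] using PolyForm.add _ _ (h k) ih

theorem PolyForm.pow {a : Config Λ → Grass Λ} (h : PolyForm a) (n : ℕ) :
    PolyForm fun p => a p ^ n := by
  induction n with
  | zero => simpa using PolyForm.const (Λ := Λ) 1
  | succ n ih => simpa [pow_succ] using ih.mul h

theorem PolyForm.list_prod {n : ℕ} {a : Fin n → Config Λ → Grass Λ} (h : ∀ k, PolyForm (a k)) :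
    PolyForm fun p => (List.ofFn fun k => a k p).prod := by
  induction n with
  | zero => simpa using PolyForm.const (Λ := Λ) 1
  | succ n ih =>
    simp_rw [List.ofFn_succ, List.prod_cons]
    exact (h 0).mul (ih fun k => h k.succ)

theorem PolyForm.linear {a : Config Λ → Grass Λ} (h : PolyForm a) (L : Grass Λ →ₗ[ℝ] ℝ) :
    PolyBounded fun p => L (a p) := by
  induction h with
  | smul c g hc =>
    simp only [map_smul, smul_eq_mul]
    exact hc.mul (PolyBounded.const _)
  | add b b' _ _ ih ih' =>
    simp only [map_add]
    exact ih.add ih'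

theorem PolyForm.soul {a : Config Λ → Grass Λ} (h : PolyForm a) :
    PolyForm fun p => HoroH24.soul (a p) :=
  h.sub (PolyForm.algebraMap (h.linear ExteriorAlgebra.algebraMapInv.toLinearMap))

variable [DecidableEq Λ]

/-- The form under the square root in `z_i`. -/
def radicand (i : Λ) (p : Config Λ) : Grass Λ :=
  1 + xf i p ^ 2 + yf i p ^ 2 + ∑ γ : Fin 2, (-2 : ℝ) • (xi i γ * eta i γ)

theorem isJet_radicand {X : Type*} [TopologicalSpace X] [CompactSpace X] {β : Sym2 Λ → ℝ}
    {p : X → Config Λ} (hp : Continuous p) (i : Λ) :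
    IsJet β (fun q => radicand i (p q))
      (fun q v => 1 + (p q).1 i ^ 2 + (p q).2 i ^ 2 - pairSum v i) := by
  have h1 := ((isJet_const (X := X) (β := β) 1).add ((isJet_xf hp i).mul (isJet_xf hp i))).add
    ((isJet_yf hp i).mul (isJet_yf hp i))
  have h2 := IsJet.sum Finset.univ fun γ : Fin 2 =>
    (isJet_evenGen (X := X) (β := β) (Sum.inl (i, γ))).const_smul (ContinuousMap.const X (-2))
  refine (h1.add h2).of_eq (fun q => ?_) (fun q v => ?_)
  · simp [radicand, coe_evenGen_inl, sq]
  · simp [pairSum, sq]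
    ring

theorem body_radicand (i : Λ) (p : Config Λ) : body (radicand i p) = 1 + p.1 i ^ 2 + p.2 i ^ 2 := by
  have := (isJet_radicand (X := Unit) (β := 0) (p := fun _ => p) continuous_const i).apply_zero ()
  rw [← this]
  simp [pairSum]

omit [DecidableEq Λ] in
theorem polyForm_xf (i : Λ) : PolyForm (xf i) := PolyForm.algebraMap (PolyBounded.fst i)

omit [DecidableEq Λ] in
theorem polyForm_yf (i : Λ) : PolyForm (yf i) := PolyForm.algebraMap (PolyBounded.snd i)

theorem polyForm_radicand (i : Λ) : PolyForm (radicand i) :=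
  PolyForm.add _ _ (PolyForm.add _ _ (PolyForm.add _ _ (PolyForm.const 1) ((polyForm_xf i).pow 2))
    ((polyForm_yf i).pow 2)) (PolyForm.const _)

theorem polyForm_rpow (i : Λ) (r : ℝ) (hr : r ≤ 1) :
    PolyForm fun p => applyOne (fun w : ℝ => w ^ r) (radicand i p) := by
  unfold applyOne
  refine PolyForm.sum _ fun k => ?_
  simp only [body_radicand, Algebra.smul_def]
  exact (PolyForm.algebraMap ((PolyBounded.const _).mul
    (PolyBounded.iteratedDeriv_rpow k r hr i))).mul ((polyForm_radicand i).soul.pow k)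

theorem polyForm_zf (i : Λ) : PolyForm (zf i) := by
  have e : zf i = fun p : Config Λ => applyOne (fun w : ℝ => w ^ (1 / 2 : ℝ)) (radicand i p) := by
    have : Real.sqrt = fun w : ℝ => w ^ (1 / 2 : ℝ) := funext Real.sqrt_eq_rpow
    rw [← this]
    rfl
  rw [e]
  exact polyForm_rpow i _ (by norm_num)

theorem polyForm_action (β : Sym2 Λ → ℝ) (h : Λ → ℝ) : PolyForm (action β h) := by
  have hd : ∀ i j : Λ, PolyForm (dotf i j) := fun i j =>
    (PolyForm.add _ _ (PolyForm.add _ _ ((polyForm_xf i).mul (polyForm_xf j))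
      ((polyForm_yf i).mul (polyForm_yf j))) (PolyForm.const _)).sub
      ((polyForm_zf i).mul (polyForm_zf j))
  exact PolyForm.add _ _ ((PolyForm.sum _ fun i => PolyForm.sum _ fun j =>
    ((hd i i).sub (hd i j)).const_smul _).const_smul _)
    (PolyForm.sum _ fun i => ((polyForm_zf i).sub (PolyForm.const 1)).const_smul _)

/-- The body of the action. -/
def bodyAction (β : Sym2 Λ → ℝ) (h : Λ → ℝ) (p : Config Λ) : ℝ := body (action β h p)

theorem bodyAction_eq (β : Sym2 Λ → ℝ) (h : Λ → ℝ) (p : Config Λ) : bodyAction β h p =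
    realAction β h p.1 p.2 (realZ p.1 p.2 0) 0 :=
  ((isJet_action (X := Unit) (β := β) (h := h) (p := fun _ => p)
    continuous_const).apply_zero ()).symm

theorem continuous_bodyAction (β : Sym2 Λ → ℝ) (h : Λ → ℝ) : Continuous (bodyAction β h) :=
  ((polyForm_action β h).linear ExteriorAlgebra.algebraMapInv.toLinearMap).1

/-- All derivatives of exp at the body coincide, so the exponential of the body factors out of the
Taylor sum. -/
theorem exists_polyForm_exp (β : Sym2 Λ → ℝ) (h : Λ → ℝ) : ∃ a : Config Λ → Grass Λ, PolyForm a ∧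
    ∀ p, applyOne Real.exp (-action β h p) = Real.exp (-bodyAction β h p) • a p := by
  have hneg : PolyForm fun p => -action β h p := by
    simpa using (polyForm_action β h).const_smul (-1)
  refine ⟨_, PolyForm.sum (Finset.range (Fintype.card (Gen Λ) + 1)) fun k =>
    (hneg.soul.pow k).const_smul (k.factorial : ℝ)⁻¹, fun p => ?_⟩
  have hb : body (-action β h p) = -bodyAction β h p := map_neg _ _
  rw [applyOne, Finset.smul_sum]
  refine Finset.sum_congr rfl fun k _ => ?_
  rw [iteratedDeriv_eq_iterate, Real.iter_deriv_exp, hb, smul_smul, mul_comm]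

/-- The multivariate expansion of ∏ 1/z_i is exchanged for a product of one-variable expansions of
the power -1/2, whose coefficients visibly grow polynomially. -/
theorem exists_polyBounded_integrand (β : Sym2 Λ → ℝ) (h : Λ → ℝ) :
    ∃ c : Config Λ → ℝ, PolyBounded c ∧
      ∀ p, integrand β h (fun _ => 1) p = c p * Real.exp (-bodyAction β h p) := by
  obtain ⟨a, ha, hexp⟩ := exists_polyForm_exp β h
  let e := Fintype.equivFin Λ
  let inv : Config Λ → Grass Λ := fun p => (List.ofFn fun k =>
    applyOne (fun w : ℝ => w ^ (-(1 / 2) : ℝ)) (radicand (e.symm k) p)).prod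
  have hinv : PolyForm inv := PolyForm.list_prod fun k => polyForm_rpow _ _ (by norm_num)
  refine ⟨fun p => ((2 * Real.pi) ^ Fintype.card Λ)⁻¹ * fermiIntL (inv p * a p),
    (PolyBounded.const _).mul ((hinv.mul ha).linear _), fun p => ?_⟩
  have hp : Continuous fun _ : Unit => p := continuous_const
  have hjet1 := isJet_integrand (β := β) (h := h) hp (obs := fun _ => 1) (f := fun _ _ => 1)
    (by simpa using isJet_const (X := Unit) (β := β) 1)
  have hrad : ∀ k, 0 < 1 + p.1 (e.symm k) ^ 2 + p.2 (e.symm k) ^ 2 := fun k => by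
    linarith [sq_nonneg (p.1 (e.symm k)), sq_nonneg (p.2 (e.symm k))]
  have hjet2 := (IsJet.list_prod fun k => (isJet_radicand (β := β) hp (e.symm k)).applyOne
    (fun w : ℝ => w ^ (-(1 / 2) : ℝ)) (Set.Ioi 0) isOpen_Ioi
    (fun x hx => (Real.contDiffAt_rpow_const_of_ne (ne_of_gt hx)).contDiffWithinAt)
    (fun _ => by simpa [pairSum] using hrad k)).mul
    (((isJet_action (β := β) (h := h) hp).neg).applyOne Real.exp Set.univ isOpen_univ
      Real.contDiff_exp.contDiffOn fun q => trivial)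
  -- Over a one-point space with Dirac measure the transfer principle compares two forms with equal
  -- jets.
  have key := hjet1.integral_congr (Measure.dirac ()) (Measure.dirac ()) hjet2
    ⟨1 / 8, by norm_num, fun v hv => ⟨.of_finite, .of_finite, ?_⟩⟩
  · simp only [integral_dirac] at key
    change _ * fermiIntL _ = _
    rw [key]
    change _ * fermiIntL (inv p * applyOne Real.exp (-action β h p)) = _
    rw [hexp, mul_smul_comm, map_smul, smul_eq_mul]
    ring
  · simp only [integral_dirac, one_mul]
    congr 1
    rw [← Equiv.prod_comp e.symm]
    refine Finset.prod_congr rfl fun k _ => ?_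
    rw [realZ, Real.sqrt_eq_rpow, Real.rpow_neg]
    have h0 := (norm_le_pi_norm v (Sum.inl (e.symm k, 0))).trans hv
    have h1 := (norm_le_pi_norm v (Sum.inl (e.symm k, 1))).trans hv
    rw [Real.norm_eq_abs, abs_le] at h0 h1
    rw [pairSum]
    nlinarith [sq_nonneg (p.1 (e.symm k)), sq_nonneg (p.2 (e.symm k))]

end PolynomialGrowth

/-! ### Growth of the action and absolute convergence of [1] -/

section ActionGrowth

variable {Λ : Type*} [Fintype Λ] [DecidableEq Λ] {β : Sym2 Λ → ℝ} {h : Λ → ℝ}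

/-- `√(1 + x_i² + y_i²)`. -/
def bodyZ (p : Config Λ) (i : Λ) : ℝ := √(1 + p.1 i ^ 2 + p.2 i ^ 2)

omit [Fintype Λ] [DecidableEq Λ] in
theorem bodyZ_sq (p : Config Λ) (i : Λ) : bodyZ p i ^ 2 = 1 + p.1 i ^ 2 + p.2 i ^ 2 :=
  Real.sq_sqrt (by positivity)

omit [Fintype Λ] [DecidableEq Λ] in
theorem one_le_bodyZ (p : Config Λ) (i : Λ) : 1 ≤ bodyZ p i := by
  rw [bodyZ, Real.one_le_sqrt]
  linarith [sq_nonneg (p.1 i), sq_nonneg (p.2 i)]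

-- The right side is the hyperbolic cosine of the distance between two points of the hyperboloid.
omit [Fintype Λ] [DecidableEq Λ] in
theorem one_le_minkowski (p : Config Λ) (i j : Λ) :
    1 ≤ bodyZ p i * bodyZ p j - (p.1 i * p.1 j + p.2 i * p.2 j) := by
  have h1 := one_le_bodyZ p i
  have h2 := one_le_bodyZ p j
  have : 1 + (p.1 i * p.1 j + p.2 i * p.2 j) ≤ bodyZ p i * bodyZ p j := by
    refine abs_le_of_sq_le_sq' ?_ (by positivity) |>.2
    rw [mul_pow, bodyZ_sq, bodyZ_sq]
    nlinarith [sq_nonneg (p.1 i - p.1 j), sq_nonneg (p.2 i - p.2 j),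
      sq_nonneg (p.1 i * p.2 j - p.2 i * p.1 j)]
  linarith

-- Triangle inequality in the hyperbolic plane together with cosh(a + b) ≤ 2 cosh a cosh b.
omit [Fintype Λ] [DecidableEq Λ] in
theorem bodyZ_le_mul (p : Config Λ) (i j : Λ) : bodyZ p i ≤
    2 * bodyZ p j * (bodyZ p i * bodyZ p j - (p.1 i * p.1 j + p.2 i * p.2 j)) := by
  have h1 := one_le_bodyZ p i
  have h2 := one_le_bodyZ p j
  have hs : (p.1 i * p.1 j + p.2 i * p.2 j) ^ 2 ≤ bodyZ p i ^ 2 * (bodyZ p j ^ 2 - 1) := by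
    rw [bodyZ_sq, bodyZ_sq]
    nlinarith [sq_nonneg (p.1 i * p.2 j - p.2 i * p.1 j), sq_nonneg (p.1 j), sq_nonneg (p.2 j)]
  have h3 : 1 ≤ bodyZ p j ^ 2 := one_le_pow₀ h2
  have : 2 * bodyZ p j * (p.1 i * p.1 j + p.2 i * p.2 j) ≤
      bodyZ p i * (2 * bodyZ p j ^ 2 - 1) := by
    refine abs_le_of_sq_le_sq' ?_ (mul_nonneg (by linarith) (by linarith)) |>.2
    have h4 := mul_le_mul_of_nonneg_left hs (show 0 ≤ 4 * bodyZ p j ^ 2 by positivity)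
    have h5 := sq_nonneg (bodyZ p i)
    calc _ = 4 * bodyZ p j ^ 2 * (p.1 i * p.1 j + p.2 i * p.2 j) ^ 2 := by ring
      _ ≤ _ := h4
      _ ≤ _ := by linarith
  linarith

theorem bodyAction_eq' (p : Config Λ) : bodyAction β h p =
    (1 / 2) * ∑ i, ∑ j, β s(i, j) *
      (bodyZ p i * bodyZ p j - (p.1 i * p.1 j + p.2 i * p.2 j) - 1) +
      ∑ i, h i * (bodyZ p i - 1) := by
  have hz : ∀ i, realZ p.1 p.2 0 i = bodyZ p i := fun i => by simp [realZ, pairSum, bodyZ]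
  rw [bodyAction_eq, realAction]
  simp only [hz, bodyZ_sq]
  simp only [pairSum, Pi.zero_apply, Finset.sum_const_zero, add_zero, mul_zero]
  congr 2
  refine Finset.sum_congr rfl fun i _ => Finset.sum_congr rfl fun j _ => ?_
  ring

theorem bodyAction_edge_le (hβ : ∀ e, 0 ≤ β e) (hh : ∀ i, 0 ≤ h i) (p : Config Λ) {i j : Λ}
    (hij : i ≠ j) : β s(i, j) *
      (bodyZ p i * bodyZ p j - (p.1 i * p.1 j + p.2 i * p.2 j) - 1) ≤ bodyAction β h p := by
  rw [bodyAction_eq']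
  set g : Λ → Λ → ℝ := fun i j => β s(i, j) *
      (bodyZ p i * bodyZ p j - (p.1 i * p.1 j + p.2 i * p.2 j) - 1) with hg
  have hg0 : ∀ i j, 0 ≤ g i j := fun i j =>
    mul_nonneg (hβ _) (by linarith [one_le_minkowski p i j])
  have hsym : g j i = g i j := by
    simp only [hg, Sym2.eq_swap (a := j)]
    ring
  have h1 : ∑ k ∈ {i, j}, ∑ l, g k l ≤ ∑ k, ∑ l, g k l :=
    Finset.sum_le_sum_of_subset_of_nonneg (Finset.subset_univ _)
      fun k _ _ => Finset.sum_nonneg fun l _ => hg0 k l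
  rw [Finset.sum_pair hij] at h1
  have h2 := Finset.single_le_sum (f := g i) (fun l _ => hg0 i l) (Finset.mem_univ j)
  have h3 := Finset.single_le_sum (f := g j) (fun l _ => hg0 j l) (Finset.mem_univ i)
  have h4 : 0 ≤ ∑ i, h i * (bodyZ p i - 1) :=
    Finset.sum_nonneg fun i _ => mul_nonneg (hh i) (by linarith [one_le_bodyZ p i])
  change g i j ≤ 1 / 2 * ∑ k, ∑ l, g k l + _
  linarith

theorem bodyAction_site_le (hβ : ∀ e, 0 ≤ β e) (hh : ∀ i, 0 ≤ h i) (p : Config Λ) (i : Λ) :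
    h i * (bodyZ p i - 1) ≤ bodyAction β h p := by
  rw [bodyAction_eq']
  have h1 : 0 ≤ ∑ i, ∑ j, β s(i, j) *
      (bodyZ p i * bodyZ p j - (p.1 i * p.1 j + p.2 i * p.2 j) - 1) :=
    Finset.sum_nonneg fun i _ => Finset.sum_nonneg fun j _ =>
      mul_nonneg (hβ _) (by linarith [one_le_minkowski p i j])
  have h2 := Finset.single_le_sum (f := fun i => h i * (bodyZ p i - 1))
    (fun l _ => mul_nonneg (hh l) (by linarith [one_le_bodyZ p l])) (Finset.mem_univ i)
  linarith

/-- At a vertex with h > 0 the action controls z directly; along an edge z grows at most by a factor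
linear in the action. A path from i back to that vertex thus gives a power equal to its length plus
one. -/
theorem exists_norm_le_bodyAction (hβ : ∀ e, 0 ≤ β e) (hh : ∀ i, 0 ≤ h i)
    (hconn : (weightGraph β).Connected) (hpos : ∃ i, 0 < h i) :
    ∃ (K : ℝ) (N : ℕ), 0 ≤ K ∧ ∀ p, 0 ≤ bodyAction β h p ∧
      1 + ‖p‖ ≤ K * (1 + bodyAction β h p) ^ N := by
  obtain ⟨r, hr⟩ := hpos
  set B : ℝ := 2 + (h r)⁻¹ + ∑ e, 2 * (β e)⁻¹ with hB
  have hsum0 : 0 ≤ ∑ e, 2 * (β e)⁻¹ :=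
    Finset.sum_nonneg fun e _ => mul_nonneg (by norm_num) (inv_nonneg.2 (hβ e))
  have hBe : ∀ e, 2 * (β e)⁻¹ ≤ B := fun e => by
    have := Finset.single_le_sum (f := fun e => 2 * (β e)⁻¹)
      (fun e _ => mul_nonneg (by norm_num) (inv_nonneg.2 (hβ e))) (Finset.mem_univ e)
    have := inv_pos.2 hr
    linarith
  have hB2 : 2 ≤ B := by have := inv_pos.2 hr; linarith
  have hBr : (h r)⁻¹ ≤ B := by linarith
  set lvl : Λ → ℕ := fun i => (weightGraph β).dist i r
  set N := ∑ i, (lvl i + 1) with hN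
  refine ⟨2 * B ^ N, N, by positivity, fun p => ?_⟩
  have hH : 0 ≤ bodyAction β h p :=
    le_trans (mul_nonneg hr.le (by linarith [one_le_bodyZ p r])) (bodyAction_site_le hβ hh p r)
  refine ⟨hH, ?_⟩
  set H := bodyAction β h p
  have hz : ∀ d i, lvl i = d → bodyZ p i ≤ (B * (1 + H)) ^ (d + 1) := by
    intro d
    induction d with
    | zero =>
      intro i hi
      obtain rfl : i = r := (hconn.dist_eq_zero_iff).1 hi
      have h1 := bodyAction_site_le hβ hh p i
      rw [← le_div_iff₀' hr, div_eq_inv_mul] at h1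
      have h2 : (h i)⁻¹ * H ≤ B * H := by gcongr
      rw [zero_add, pow_one]
      linarith
    | succ d ih =>
      intro i hi
      obtain ⟨q, hadj, hq⟩ := exists_adj_dist_eq hconn hi
      rw [weightGraph, SimpleGraph.fromEdgeSet_adj] at hadj
      have hb : 0 < β s(i, q) := lt_of_le_of_ne (hβ _) (Ne.symm hadj.1)
      have h1 := bodyAction_edge_le hβ hh p hadj.2
      rw [← le_div_iff₀' hb, div_eq_inv_mul] at h1
      have h2 : 2 * (β s(i, q))⁻¹ * H ≤ B * H := by gcongr; exact hBe _
      have hzq := one_le_bodyZ p q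
      set E := bodyZ p i * bodyZ p q - (p.1 i * p.1 q + p.2 i * p.2 q)
      calc bodyZ p i ≤ 2 * bodyZ p q * E := bodyZ_le_mul p i q
        _ = bodyZ p q * (2 * E) := by ring
        _ ≤ (B * (1 + H)) ^ (d + 1) * (B * (1 + H)) := by
            refine mul_le_mul (ih q hq) ?_ ?_ (by positivity)
            · linarith
            · linarith [one_le_minkowski p i q]
        _ = _ := by ring
  have hBH : 1 ≤ B * (1 + H) := by nlinarith
  have hzN : ∀ i, bodyZ p i ≤ (B * (1 + H)) ^ N := fun i =>
    (hz _ i rfl).trans (pow_le_pow_right₀ hBH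
      (Finset.single_le_sum (f := fun i => lvl i + 1) (fun _ _ => Nat.zero_le _)
        (Finset.mem_univ i)))
  have hpow : 1 ≤ (B * (1 + H)) ^ N := one_le_pow₀ hBH
  have hn : ‖p‖ ≤ (B * (1 + H)) ^ N := by
    refine max_le ?_ ?_
    · refine (pi_norm_le_iff_of_nonneg (by positivity)).2 fun i => le_trans ?_ (hzN i)
      exact Real.abs_le_sqrt (by linarith [sq_nonneg (p.2 i)])
    · refine (pi_norm_le_iff_of_nonneg (by positivity)).2 fun i => le_trans ?_ (hzN i)
      exact Real.abs_le_sqrt (by linarith [sq_nonneg (p.1 i)])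
  rw [mul_assoc, ← mul_pow]
  linarith

theorem integrable_integrand_one (hβ : ∀ e, 0 ≤ β e) (hh : ∀ i, 0 ≤ h i)
    (hconn : (weightGraph β).Connected) (hpos : ∃ i, 0 < h i) :
    Integrable (integrand β h (fun _ : Config Λ => 1)) := by
  obtain ⟨c, ⟨hc, C, m, hb⟩, heq⟩ := exists_polyBounded_integrand β h
  obtain ⟨K, N, hK, hgrow⟩ := exists_norm_le_bodyAction hβ hh hconn hpos
  -- One more than the dimension, so that (1 + ‖p‖)^{-d} is integrable.
  set d := Module.finrank ℝ (Config Λ) + 1 with hd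
  have : (volume : Measure (Config Λ)).IsAddHaarMeasure := by
    rw [Measure.volume_eq_prod]
    exact Measure.prod.instIsAddHaarMeasure _ _
  have hint : Integrable fun p : Config Λ => (1 + ‖p‖) ^ (-(d : ℝ)) :=
    integrable_one_add_norm (by rw [hd]; push_cast; linarith)
  set A : ℝ := K ^ (m + d) * (((N * (m + d)).factorial : ℝ) * Real.exp 1) with hA
  refine (hint.const_mul (|C| * A)).mono' ?_ (Filter.Eventually.of_forall fun p => ?_)
  · rw [show integrand β h (fun _ => 1) = fun p => c p * Real.exp (-bodyAction β h p) from
      funext heq]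
    exact (hc.mul (Real.continuous_exp.comp (continuous_bodyAction β h).neg)).aestronglyMeasurable
  obtain ⟨hH, hp⟩ := hgrow p
  set H := bodyAction β h p
  have hn := norm_nonneg p
  have h1 : (1 + ‖p‖) ^ (m + d) * Real.exp (-H) ≤ A := by
    have e1 : (1 + H) ^ (N * (m + d)) ≤ ((N * (m + d)).factorial : ℝ) * Real.exp (1 + H) := by
      have := Real.pow_div_factorial_le_exp (1 + H) (by linarith) (N * (m + d))
      rwa [div_le_iff₀' (by positivity)] at this
    calc (1 + ‖p‖) ^ (m + d) * Real.exp (-H)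
        ≤ (K * (1 + H) ^ N) ^ (m + d) * Real.exp (-H) := by gcongr
      _ = K ^ (m + d) * ((1 + H) ^ (N * (m + d)) * Real.exp (-H)) := by
          rw [mul_pow, ← pow_mul]; ring
      _ ≤ K ^ (m + d) * (((N * (m + d)).factorial : ℝ) * Real.exp (1 + H) * Real.exp (-H)) := by
          gcongr
      _ = A := by
          rw [hA, mul_assoc, ← Real.exp_add, add_neg_cancel_right]
  rw [heq, norm_mul, Real.norm_eq_abs, Real.norm_of_nonneg (Real.exp_pos _).le,
    Real.rpow_neg (by positivity), Real.rpow_natCast, mul_assoc, ← div_eq_mul_inv]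
  calc |c p| * Real.exp (-H) ≤ |C| * (1 + ‖p‖) ^ m * Real.exp (-H) := by
        gcongr
        exact (hb p).trans (by gcongr; exact le_abs_self C)
    _ = |C| * ((1 + ‖p‖) ^ (m + d) * Real.exp (-H) / (1 + ‖p‖) ^ d) := by
        rw [pow_add]
        field_simp
    _ ≤ |C| * (A / (1 + ‖p‖) ^ d) := by gcongr

end ActionGrowth

end

end HoroH24

namespace HoroH24

noncomputable section

open MeasureTheory

/-! ### An integral of inverse Gaussian type -/

section InverseGaussian

theorem integral_sq_mul_gaussian :
    Integrable (fun s : ℝ => s ^ 2 * Real.exp (-(1 / 2) * s ^ 2)) ∧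
    ∫ s : ℝ, s ^ 2 * Real.exp (-(1 / 2) * s ^ 2) = √(2 * Real.pi) := by
  have h := integral_rpow_mul_exp_neg_mul_rpow (p := 2) (q := 2) (b := 1 / 2) (by norm_num)
    (by norm_num) (by norm_num)
  have h1 := integral_comp_abs (f := fun s : ℝ => s ^ 2 * Real.exp (-(1 / 2) * s ^ 2))
  simp only [sq_abs] at h1
  have hG : Real.Gamma (3 / 2) = √Real.pi / 2 := by
    rw [show (3 / 2 : ℝ) = 1 / 2 + 1 by norm_num, Real.Gamma_add_one (by norm_num),
      Real.Gamma_one_half_eq]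
    ring
  have hp : (1 / 2 : ℝ) ^ (-(2 + 1) / 2 : ℝ) = 2 * √2 := by
    rw [one_div, Real.inv_rpow (by norm_num), ← Real.rpow_neg (by norm_num),
      show (-(-(2 + 1) / 2) : ℝ) = 1 + 1 / 2 by norm_num, Real.rpow_add (by norm_num),
      Real.rpow_one, Real.sqrt_eq_rpow]
  have h2 : ∫ s : ℝ, s ^ 2 * Real.exp (-(1 / 2) * s ^ 2) = √(2 * Real.pi) := by
    rw [h1]
    simp only [Real.rpow_two] at h
    rw [h, hp, show ((2 + 1) / 2 : ℝ) = 3 / 2 by norm_num, hG, Real.sqrt_mul (by norm_num)]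
    ring
  exact ⟨Integrable.of_integral_ne_zero (by rw [h2]; positivity), h2⟩

theorem lintegral_add_sq_mul_gaussian {a : ℝ} (ha : 0 ≤ a) :
    ∫⁻ s : ℝ, ENNReal.ofReal ((s ^ 2 + a) * Real.exp (-(1 / 2) * s ^ 2)) =
      ENNReal.ofReal (√(2 * Real.pi) * (1 + a)) := by
  obtain ⟨hi, hv⟩ := integral_sq_mul_gaussian
  have hi' : Integrable fun s : ℝ => a * Real.exp (-(1 / 2) * s ^ 2) :=
    (integrable_exp_neg_mul_sq (by norm_num)).const_mul a
  simp only [add_mul]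
  rw [← ofReal_integral_eq_lintegral_ofReal
    (f := fun s : ℝ => s ^ 2 * Real.exp (-(1 / 2) * s ^ 2) + a * Real.exp (-(1 / 2) * s ^ 2))
    (hi.add hi') (Filter.Eventually.of_forall fun s => by positivity), integral_add hi hi', hv,
    integral_const_mul, integral_gaussian]
  congr 1
  rw [show Real.pi / (1 / 2) = 2 * Real.pi by ring]
  ring

/-- The reflection t ↦ log a - t preserves G and exchanges e^t with a e^{-t}. Averaging with it and
using e^{3t} + a³e^{-3t} = s'(s² + a) for s = e^t - a e^{-t} yields a Gaussian moment in s. -/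
theorem lintegral_exp_three {a : ℝ} (ha : 0 < a) :
    ∫⁻ t : ℝ, ENNReal.ofReal (2 * Real.exp t ^ 3 *
      Real.exp (-(1 / 2) * (Real.exp t ^ 2 + a ^ 2 / Real.exp t ^ 2))) =
      ENNReal.ofReal (√(2 * Real.pi) * (1 + a) * Real.exp (-a)) := by
  set G : ℝ → ℝ := fun t => Real.exp (-(1 / 2) * (Real.exp t ^ 2 + a ^ 2 / Real.exp t ^ 2)) with hG
  have hGsymm : ∀ t, G (Real.log a - t) = G t := by
    intro t
    simp only [hG, Real.exp_sub, Real.exp_log ha]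
    congr 2
    have := Real.exp_pos t
    field_simp
    ring
  set I := ∫⁻ t : ℝ, ENNReal.ofReal (2 * Real.exp t ^ 3 * G t) with hI
  have hrefl : I = ∫⁻ t : ℝ, ENNReal.ofReal (2 * (a / Real.exp t) ^ 3 * G t) := by
    rw [hI, ← lintegral_sub_left_eq_self _ (Real.log a)]
    simp only [hGsymm, Real.exp_sub, Real.exp_log ha]
  have hGc : Continuous G := by
    simp only [hG]
    fun_prop (disch := intro x; positivity)
  set s : ℝ → ℝ := fun t => Real.exp t - a / Real.exp t with hs
  have hds : ∀ t, HasDerivAt s (Real.exp t + a / Real.exp t) t := by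
    intro t
    have h := (Real.hasDerivAt_exp t).sub (((hasDerivAt_neg t).exp).const_mul a)
    have e : s = fun t => Real.exp t - a * Real.exp (-t) := by
      funext t
      simp only [hs, Real.exp_neg, div_eq_mul_inv]
    rw [e]
    refine h.congr_deriv ?_
    rw [Real.exp_neg, div_eq_mul_inv]
    ring
  have hmono : StrictMono s := strictMono_of_deriv_pos fun t => by
    rw [(hds t).deriv]
    positivity
  have hsurj : s '' Set.univ = Set.univ := by
    rw [Set.image_univ, Set.range_eq_univ]
    intro x
    have hlt : |x| < √(x ^ 2 + 4 * a) := by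
      rw [← Real.sqrt_sq_eq_abs]
      exact Real.sqrt_lt_sqrt (sq_nonneg _) (by linarith)
    have hpos : 0 < (x + √(x ^ 2 + 4 * a)) / 2 := by linarith [neg_abs_le x]
    refine ⟨Real.log ((x + √(x ^ 2 + 4 * a)) / 2), ?_⟩
    simp only [hs]
    rw [Real.exp_log hpos]
    rw [sub_eq_iff_eq_add, ← sub_eq_iff_eq_add', eq_div_iff hpos.ne']
    linear_combination (1 / 4) * Real.sq_sqrt (show 0 ≤ x ^ 2 + 4 * a by positivity)
  have hcov := lintegral_image_eq_lintegral_abs_deriv_mul MeasurableSet.univ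
    (fun t _ => (hds t).hasDerivWithinAt) hmono.injective.injOn
    (fun x => ENNReal.ofReal ((x ^ 2 + a) * Real.exp (-(1 / 2) * x ^ 2)))
  rw [hsurj, setLIntegral_univ, setLIntegral_univ, lintegral_add_sq_mul_gaussian ha.le] at hcov
  have hsum : I + I = ENNReal.ofReal (2 * Real.exp (-a)) *
      ENNReal.ofReal (√(2 * Real.pi) * (1 + a)) := by
    nth_rewrite 2 [hrefl]
    rw [hI, ← lintegral_add_left (by fun_prop), hcov, ← lintegral_const_mul' _ _
      ENNReal.ofReal_ne_top]
    refine lintegral_congr fun t => ?_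
    rw [← ENNReal.ofReal_add (by positivity) (by positivity), ← ENNReal.ofReal_mul (by positivity),
      ← ENNReal.ofReal_mul (by positivity)]
    congr 1
    rw [abs_of_pos (by positivity)]
    have he : G t = Real.exp (-a) * Real.exp (-(1 / 2) * s t ^ 2) := by
      rw [← Real.exp_add]
      simp only [hG, hs]
      congr 1
      have := Real.exp_pos t
      field_simp
      ring
    rw [he]
    simp only [hs]
    have := Real.exp_pos t
    field_simp
    ring
  have htwo : ENNReal.ofReal (2 * Real.exp (-a)) * ENNReal.ofReal (√(2 * Real.pi) * (1 + a)) =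
      2 * ENNReal.ofReal (√(2 * Real.pi) * (1 + a) * Real.exp (-a)) := by
    rw [← ENNReal.ofReal_mul (by positivity),
      show (2 : ENNReal) = ENNReal.ofReal 2 by simp, ← ENNReal.ofReal_mul (by norm_num)]
    congr 1
    ring
  rw [htwo, ← two_mul] at hsum
  exact (ENNReal.mul_right_inj (by norm_num) (by norm_num)).1 hsum

/-- The substitution c = e^{2t} leads to `lintegral_exp_three`. The case a = 0 is a Gamma integral,
since the reflection needs log a. -/
theorem lintegral_sqrt_mul_exp {a : ℝ} (ha : 0 ≤ a) :
    ∫⁻ c in Set.Ioi (0 : ℝ), ENNReal.ofReal (√c * Real.exp (-(1 / 2) * (c + a ^ 2 / c))) =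
      ENNReal.ofReal (√(2 * Real.pi) * (1 + a) * Real.exp (-a)) := by
  rcases ha.eq_or_lt with rfl | ha
  · have h := integral_rpow_mul_exp_neg_mul_rpow (p := 1) (q := 1 / 2) (b := 1 / 2) (by norm_num)
      (by norm_num) (by norm_num)
    have hG : Real.Gamma (3 / 2) = √Real.pi / 2 := by
      rw [show (3 / 2 : ℝ) = 1 / 2 + 1 by norm_num, Real.Gamma_add_one (by norm_num),
        Real.Gamma_one_half_eq]
      ring
    have hp : (1 / 2 : ℝ) ^ (-(1 / 2 + 1) / 1 : ℝ) = 2 * √2 := by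
      rw [one_div, Real.inv_rpow (by norm_num), ← Real.rpow_neg (by norm_num),
        show (-(-(2⁻¹ + 1) / 1) : ℝ) = 1 + 1 / 2 by norm_num, Real.rpow_add (by norm_num),
        Real.rpow_one, Real.sqrt_eq_rpow]
    rw [hp, show ((1 / 2 + 1) / 1 : ℝ) = 3 / 2 by norm_num, hG] at h
    simp only [Real.rpow_one, ← Real.sqrt_eq_rpow] at h
    have hne : ∫ x in Set.Ioi (0 : ℝ), √x * Real.exp (-(1 / 2) * x) ≠ 0 := by
      rw [h]; positivity
    simp only [ne_eq, OfNat.ofNat_ne_zero, not_false_eq_true, zero_pow, zero_div, add_zero]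
    rw [← ofReal_integral_eq_lintegral_ofReal (Integrable.of_integral_ne_zero hne)
      (Filter.Eventually.of_forall fun s => by positivity), h, Real.sqrt_mul (by norm_num)]
    congr 1
    simp
    ring
  · rw [← lintegral_exp_three ha]
    have himg : (fun t : ℝ => Real.exp t ^ 2) '' Set.univ = Set.Ioi 0 := by
      ext c
      simp only [Set.image_univ, Set.mem_range, Set.mem_Ioi]
      constructor
      · rintro ⟨t, rfl⟩
        positivity
      · intro hc
        exact ⟨Real.log (√c), by rw [Real.exp_log (Real.sqrt_pos.2 hc), Real.sq_sqrt hc.le]⟩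
    have hder : ∀ t : ℝ, HasDerivAt (fun t : ℝ => Real.exp t ^ 2) (2 * Real.exp t ^ 2) t := by
      intro t
      refine ((Real.hasDerivAt_exp t).pow 2).congr_deriv ?_
      push_cast
      ring
    have hinj : Function.Injective fun t : ℝ => Real.exp t ^ 2 := fun t t' htt =>
      Real.exp_injective ((sq_eq_sq₀ (Real.exp_pos _).le (Real.exp_pos _).le).1 htt)
    rw [← himg, lintegral_image_eq_lintegral_abs_deriv_mul MeasurableSet.univ
      (fun t _ => (hder t).hasDerivWithinAt) hinj.injOn, setLIntegral_univ]
    refine lintegral_congr fun t => ?_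
    rw [← ENNReal.ofReal_mul (abs_nonneg _), abs_of_pos (by positivity),
      Real.sqrt_sq (Real.exp_pos t).le]
    congr 1
    ring

end InverseGaussian

end

end HoroH24

namespace HoroH24

noncomputable section

open MeasureTheory

/-! ### Schur complements of the coupling matrix -/

section CouplingMatrix

variable {Λ : Type*} [Fintype Λ] [DecidableEq Λ] {β : Sym2 Λ → ℝ} {h : Λ → ℝ}

/-- The symmetric matrix with diagonal `b` and off-diagonal entries `-β_{ij}`. -/
def coupMat (β : Sym2 Λ → ℝ) (b : Λ → ℝ) : Matrix Λ Λ ℝ :=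
  Matrix.of fun i j => if i = j then b i else -β s(i, j)

/-- The edge weights between the vertices other than `n`. -/
def subWeight (β : Sym2 Λ → ℝ) (n : Λ) : Sym2 {j // j ≠ n} → ℝ := fun e => β (e.map Subtype.val)

/-- The weights of the edges at `n`. -/
def edgeWeight (β : Sym2 Λ → ℝ) (n : Λ) : {j // j ≠ n} → ℝ := fun j => β s(n, j)

/-- The restriction of a vector to the vertices other than `n`. -/
def subVec (n : Λ) (v : Λ → ℝ) : {j // j ≠ n} → ℝ := fun j => v j

omit [Fintype Λ] in
theorem isHermitian_coupMat (b : Λ → ℝ) : (coupMat β b).IsHermitian := by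
  ext i j
  simp only [coupMat, Matrix.conjTranspose_apply, Matrix.of_apply, star_trivial,
    Sym2.eq_swap (a := j), eq_comm (a := j)]
  split_ifs with hij
  · rw [hij]
  · rfl

omit [Fintype Λ] in
theorem coupMat_submatrix (n : Λ) (b : Λ → ℝ) :
    (coupMat β b).submatrix (Subtype.val : {j // j ≠ n} → Λ) Subtype.val =
      coupMat (subWeight β n) (subVec n b) := by
  ext i j
  simp [coupMat, subWeight, subVec, Subtype.ext_iff]

theorem coupMat_mulVec_self (n : Λ) (b v : Λ → ℝ) :
    (coupMat β b).mulVec v n = b n * v n - edgeWeight β n ⬝ᵥ subVec n v := by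
  rw [Matrix.mulVec, dotProduct, Fintype.sum_eq_add_sum_subtype_ne _ n]
  simp only [coupMat, Matrix.of_apply, if_true, dotProduct, edgeWeight, subVec, sub_eq_add_neg,
    ← Finset.sum_neg_distrib]
  congr 1
  refine Finset.sum_congr rfl fun j _ => ?_
  rw [if_neg j.2.symm]
  ring

theorem subVec_coupMat_mulVec (n : Λ) (b v : Λ → ℝ) :
    subVec n ((coupMat β b).mulVec v) =
      (coupMat (subWeight β n) (subVec n b)).mulVec (subVec n v) - v n • edgeWeight β n := by
  funext i
  rw [subVec, Matrix.mulVec, dotProduct, Fintype.sum_eq_add_sum_subtype_ne _ n]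
  simp only [coupMat, Matrix.of_apply, if_neg i.2, Pi.sub_apply, Pi.smul_apply, smul_eq_mul,
    edgeWeight, Matrix.mulVec, dotProduct, Sym2.eq_swap (a := n), Subtype.ext_iff, subVec,
    subWeight, Sym2.map_mk]
  ring

theorem dotProduct_split (n : Λ) (v w : Λ → ℝ) :
    v ⬝ᵥ w = v n * w n + subVec n v ⬝ᵥ subVec n w :=
  Fintype.sum_eq_add_sum_subtype_ne _ n

theorem PosDef.mulVec_inv {ι : Type*} [Fintype ι] [DecidableEq ι] {M : Matrix ι ι ℝ}
    (hM : M.PosDef) (v : ι → ℝ) : M.mulVec (M⁻¹.mulVec v) = v := by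
  rw [Matrix.mulVec_mulVec, Matrix.mul_nonsing_inv _ ((Matrix.isUnit_iff_isUnit_det _).1 hM.isUnit),
    Matrix.one_mulVec]

theorem PosDef.inv_mulVec {ι : Type*} [Fintype ι] [DecidableEq ι] {M : Matrix ι ι ℝ}
    (hM : M.PosDef) (v : ι → ℝ) : M⁻¹.mulVec (M.mulVec v) = v := by
  rw [Matrix.mulVec_mulVec, Matrix.nonsing_inv_mul _ ((Matrix.isUnit_iff_isUnit_det _).1 hM.isUnit),
    Matrix.one_mulVec]

theorem PosDef.dotProduct_inv_comm {ι : Type*} [Fintype ι] [DecidableEq ι] {M : Matrix ι ι ℝ}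
    (hM : M.PosDef) (v w : ι → ℝ) : v ⬝ᵥ M⁻¹.mulVec w = w ⬝ᵥ M⁻¹.mulVec v := by
  have hT : M⁻¹.transpose = M⁻¹ := by
    have := hM.isHermitian
    rw [Matrix.IsHermitian, Matrix.conjTranspose_eq_transpose_of_trivial] at this
    rw [Matrix.transpose_nonsing_inv, this]
  rw [Matrix.dotProduct_mulVec, ← Matrix.mulVec_transpose, hT, dotProduct_comm]

/-- The Schur complement of the principal minor which omits `n`. -/
def schurCompl (β : Sym2 Λ → ℝ) (n : Λ) (b : Λ → ℝ) : ℝ :=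
  b n - edgeWeight β n ⬝ᵥ
    (coupMat (subWeight β n) (subVec n b))⁻¹.mulVec (edgeWeight β n)

/-- Completing the square in the variables other than n. -/
theorem coupMat_quadratic (n : Λ) (b v : Λ → ℝ)
    (hM : (coupMat (subWeight β n) (subVec n b)).PosDef) :
    v ⬝ᵥ (coupMat β b).mulVec v =
      (subVec n v - v n • (coupMat (subWeight β n) (subVec n b))⁻¹.mulVec (edgeWeight β n)) ⬝ᵥ
        (coupMat (subWeight β n) (subVec n b)).mulVec
          (subVec n v - v n • (coupMat (subWeight β n) (subVec n b))⁻¹.mulVec (edgeWeight β n)) +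
      schurCompl β n b * v n ^ 2 := by
  rw [dotProduct_split n, coupMat_mulVec_self, subVec_coupMat_mulVec, schurCompl]
  set M := coupMat (subWeight β n) (subVec n b)
  set k := edgeWeight β n
  have h1 := PosDef.mulVec_inv hM k
  have h2 : (M⁻¹.mulVec k) ⬝ᵥ M.mulVec (subVec n v) = k ⬝ᵥ subVec n v := by
    have h3 := PosDef.dotProduct_inv_comm hM (M.mulVec (subVec n v)) k
    rw [PosDef.inv_mulVec hM] at h3
    rw [dotProduct_comm, h3]
  simp only [Matrix.mulVec_sub, Matrix.mulVec_smul, h1, sub_dotProduct, dotProduct_sub,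
    smul_dotProduct, dotProduct_smul, smul_eq_mul, h2]
  rw [dotProduct_comm (subVec n v) k, dotProduct_comm (M⁻¹.mulVec k) k]
  ring

theorem posDef_coupMat_iff (n : Λ) (b : Λ → ℝ) : (coupMat β b).PosDef ↔
    (coupMat (subWeight β n) (subVec n b)).PosDef ∧ 0 < schurCompl β n b := by
  constructor
  · intro hM
    have hM' : (coupMat (subWeight β n) (subVec n b)).PosDef := by
      rw [← coupMat_submatrix]
      exact hM.submatrix Subtype.val_injective
    refine ⟨hM', ?_⟩
    set m := (coupMat (subWeight β n) (subVec n b))⁻¹.mulVec (edgeWeight β n) with hm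
    let v : Λ → ℝ := fun i => if hi : i = n then 1 else m ⟨i, hi⟩
    have hvn : v n = 1 := by simp [v]
    have hvs : subVec n v = m := by
      funext j
      simp [v, subVec, j.2]
    have hv : v ≠ 0 := fun h0 => by
      rw [h0] at hvn
      simp at hvn
    have := hM.dotProduct_mulVec_pos hv
    rw [star_trivial, coupMat_quadratic n b v hM', hvn, hvs, ← hm] at this
    simpa using this
  · rintro ⟨hM, hc⟩
    refine Matrix.PosDef.of_dotProduct_mulVec_pos (isHermitian_coupMat b) fun v hv => ?_
    rw [star_trivial, coupMat_quadratic n b v hM]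
    set w := subVec n v - v n • (coupMat (subWeight β n) (subVec n b))⁻¹.mulVec (edgeWeight β n)
      with hw
    have h1 := hM.posSemidef.dotProduct_mulVec_nonneg w
    rw [star_trivial] at h1
    by_cases hn : v n = 0
    · have hw0 : w ≠ 0 := by
        intro h0
        rw [hw, hn, zero_smul, sub_zero] at h0
        refine hv (funext fun i => ?_)
        by_cases hi : i = n
        · rw [hi, hn]
          rfl
        · exact congrFun h0 ⟨i, hi⟩
      have h2 := hM.dotProduct_mulVec_pos hw0
      rw [star_trivial] at h2
      rw [hn]
      simpa using h2
    · have : 0 < schurCompl β n b * v n ^ 2 := by positivity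
      linarith

theorem det_coupMat (n : Λ) (b : Λ → ℝ) (hM : (coupMat (subWeight β n) (subVec n b)).PosDef) :
    (coupMat β b).det = (coupMat (subWeight β n) (subVec n b)).det * schurCompl β n b := by
  set M := coupMat (subWeight β n) (subVec n b)
  set k := edgeWeight β n
  have hsub : Subsingleton {j // ¬ j ≠ n} :=
    ⟨fun a b => Subtype.ext ((not_not.1 a.2).trans (not_not.1 b.2).symm)⟩
  let e := Equiv.sumCompl (fun j : Λ => j ≠ n)
  have : Invertible M := (hM.isUnit).invertible
  have hblock : (coupMat β b).submatrix e e = Matrix.fromBlocks M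
      (Matrix.of fun i _ => -k i) (Matrix.of fun _ j => -k j) (Matrix.of fun _ _ => b n) := by
    ext i j
    rcases i with i | i <;> rcases j with j | j
    · change (coupMat β b).submatrix (Subtype.val : {j // j ≠ n} → Λ) Subtype.val i j = _
      rw [coupMat_submatrix]
      rfl
    · have hj := not_not.1 j.2
      simp [e, coupMat, hj, i.2, k, edgeWeight, Sym2.eq_swap]
    · have hi := not_not.1 i.2
      simp [e, coupMat, hi, j.2.symm, k, edgeWeight]
    · have hj := not_not.1 j.2
      have hi := not_not.1 i.2
      simp [e, coupMat, hi, hj]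
  have hD : (Matrix.of (fun _ _ => b n) - Matrix.of (fun _ j => -k j) * ⅟M *
      Matrix.of (fun i _ => -k i) : Matrix {j // ¬ j ≠ n} {j // ¬ j ≠ n} ℝ).det =
      schurCompl β n b := by
    refine (Matrix.det_eq_elem_of_subsingleton _ (⟨n, by simp⟩ : {j // ¬ j ≠ n})).trans ?_
    simp only [schurCompl, Matrix.sub_apply, Matrix.of_apply, Matrix.mul_apply,
      Matrix.invOf_eq_nonsing_inv, dotProduct, Matrix.mulVec, Finset.sum_mul, Finset.mul_sum]
    congr 1
    rw [Finset.sum_comm]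
    exact Finset.sum_congr rfl fun i _ => Finset.sum_congr rfl fun j _ => by ring
  rw [← Matrix.det_submatrix_equiv_self e, hblock, Matrix.det_fromBlocks₁₁, hD]

theorem coupMat_inv_quadratic (n : Λ) (b h : Λ → ℝ) (hM : (coupMat β b).PosDef) :
    h ⬝ᵥ (coupMat β b)⁻¹.mulVec h =
      subVec n h ⬝ᵥ (coupMat (subWeight β n) (subVec n b))⁻¹.mulVec (subVec n h) +
      (h n + edgeWeight β n ⬝ᵥ
        (coupMat (subWeight β n) (subVec n b))⁻¹.mulVec (subVec n h)) ^ 2 / schurCompl β n b := by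
  obtain ⟨hM', hc⟩ := (posDef_coupMat_iff n b).1 hM
  have hk : edgeWeight β n ⬝ᵥ (coupMat (subWeight β n) (subVec n b))⁻¹.mulVec (edgeWeight β n) =
      b n - schurCompl β n b := by
    rw [schurCompl]
    ring
  set M := coupMat (subWeight β n) (subVec n b)
  set k := edgeWeight β n
  set c := schurCompl β n b
  set a := h n + k ⬝ᵥ M⁻¹.mulVec (subVec n h) with ha
  -- The solution of the block system: eliminating the other vertices gives a/c at n, and back
  -- substitution the rest.
  let u : Λ → ℝ := fun i => if hi : i = n then a / c else
    (M⁻¹.mulVec (subVec n h + (a / c) • k)) ⟨i, hi⟩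
  have hun : u n = a / c := by simp [u]
  have hus : subVec n u = M⁻¹.mulVec (subVec n h + (a / c) • k) := by
    funext j
    simp [u, subVec, j.2]
  have hu : (coupMat β b).mulVec u = h := by
    funext i
    by_cases hi : i = n
    · subst hi
      rw [coupMat_mulVec_self, hun, hus, Matrix.mulVec_add, Matrix.mulVec_smul, dotProduct_add,
        dotProduct_smul, smul_eq_mul]
      change b i * (a / c) - (k ⬝ᵥ M⁻¹.mulVec (subVec i h) + a / c * (k ⬝ᵥ M⁻¹.mulVec k)) = h i
      have hac : a / c * c = a := div_mul_cancel₀ _ hc.ne'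
      rw [hk]
      linear_combination hac
    · have := congrFun (subVec_coupMat_mulVec (β := β) n b u) ⟨i, hi⟩
      rw [hus, hun, PosDef.mulVec_inv hM', add_sub_cancel_right] at this
      exact this
  have hinv : (coupMat β b)⁻¹.mulVec h = u := by
    conv_lhs => rw [← hu]
    exact PosDef.inv_mulVec hM u
  rw [hinv, dotProduct_split n, hun, hus, Matrix.mulVec_add, Matrix.mulVec_smul, dotProduct_add,
    dotProduct_smul, smul_eq_mul, PosDef.dotProduct_inv_comm hM' (subVec n h) k, ha]
  ring

/-- Off-diagonal entries are nonpositive. With u = p - w split into positive and negative parts,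
w·Mp ≤ 0 and w·Mu = w·h ≥ 0, hence w·Mw ≤ 0 and w = 0. -/
theorem inv_mulVec_nonneg (hβ : ∀ e, 0 ≤ β e) {b : Λ → ℝ} (hM : (coupMat β b).PosDef)
    (hh : ∀ i, 0 ≤ h i) (i : Λ) : 0 ≤ (coupMat β b)⁻¹.mulVec h i := by
  set u := (coupMat β b)⁻¹.mulVec h
  have hu : (coupMat β b).mulVec u = h := PosDef.mulVec_inv hM h
  set w : Λ → ℝ := fun i => max (-u i) 0 with hw
  set p : Λ → ℝ := fun i => max (u i) 0 with hp
  have hwp : u = p - w := by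
    funext j
    simp only [hp, hw, Pi.sub_apply]
    rcases le_total (u j) 0 with hj | hj
    · rw [max_eq_right hj, max_eq_left (by linarith)]; ring
    · rw [max_eq_left hj, max_eq_right (by linarith)]; ring
  have hpw : ∀ j, w j * p j = 0 := by
    intro j
    simp only [hp, hw]
    rcases le_total (u j) 0 with hj | hj
    · rw [max_eq_right hj, mul_zero]
    · rw [max_eq_right (show -u j ≤ 0 by linarith), zero_mul]
  have h1 : 0 ≤ w ⬝ᵥ h := Finset.sum_nonneg fun j _ => mul_nonneg (le_max_right _ _) (hh j)
  have h2 : w ⬝ᵥ (coupMat β b).mulVec p ≤ 0 := by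
    simp only [dotProduct, Matrix.mulVec, Finset.mul_sum]
    refine Finset.sum_nonpos fun j _ => Finset.sum_nonpos fun l _ => ?_
    simp only [coupMat, Matrix.of_apply]
    split_ifs with hjl
    · subst hjl
      rw [mul_left_comm, hpw, mul_zero]
    · have h3 : 0 ≤ β s(j, l) * (w j * p l) :=
        mul_nonneg (hβ _) (mul_nonneg (le_max_right _ _) (le_max_right _ _))
      linarith
  by_contra hneg
  push Not at hneg
  have hw0 : w ≠ 0 := fun h0 => by
    have := congrFun h0 i
    simp only [hw, Pi.zero_apply] at this
    have := le_max_left (-u i) 0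
    linarith
  have h3 := hM.dotProduct_mulVec_pos hw0
  rw [star_trivial] at h3
  rw [← hu, hwp, Matrix.mulVec_sub, dotProduct_sub] at h1
  linarith

omit [Fintype Λ] in
theorem continuous_coupMat : Continuous fun b : Λ → ℝ => coupMat β b := by
  refine continuous_matrix fun i j => ?_
  simp only [coupMat, Matrix.of_apply]
  split_ifs <;> fun_prop

/-- Positive definite means positive semidefinite, a closed condition, with nonzero determinant, an
open one. -/
theorem measurableSet_posDef_coupMat : MeasurableSet {b : Λ → ℝ | (coupMat β b).PosDef} := by
  have e : {b : Λ → ℝ | (coupMat β b).PosDef} =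
      (⋂ v : Λ → ℝ, {b | 0 ≤ v ⬝ᵥ (coupMat β b).mulVec v}) ∩ {b | (coupMat β b).det ≠ 0} := by
    ext b
    simp only [Set.mem_inter_iff, Set.mem_iInter, Set.mem_ofPred_eq]
    constructor
    · intro hM
      exact ⟨fun v => by simpa using hM.posSemidef.dotProduct_mulVec_nonneg v, hM.det_pos.ne'⟩
    · rintro ⟨h1, h2⟩
      refine (Matrix.PosSemidef.posDef_iff_det_ne_zero ?_).2 h2
      exact Matrix.PosSemidef.of_dotProduct_mulVec_nonneg (isHermitian_coupMat b)
        fun v => by simpa using h1 v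
  rw [e]
  refine MeasurableSet.inter (IsClosed.measurableSet (isClosed_iInter fun v => ?_))
    (isOpen_ne_fun continuous_coupMat.matrix_det continuous_const).measurableSet
  exact isClosed_le continuous_const
    (continuous_const.dotProduct (continuous_coupMat.matrix_mulVec continuous_const))

theorem measurable_inv_quadratic (v w : Λ → ℝ) :
    Measurable fun b : Λ → ℝ => v ⬝ᵥ (coupMat β b)⁻¹.mulVec w := by
  simp only [Matrix.inv_def, Ring.inverse_eq_inv', Matrix.smul_mulVec, dotProduct_smul,
    smul_eq_mul]
  exact continuous_coupMat.matrix_det.measurable.inv.mul (continuous_const.dotProduct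
    (continuous_coupMat.matrix_adjugate.matrix_mulVec continuous_const)).measurable

end CouplingMatrix

end

end HoroH24

namespace HoroH24

noncomputable section

open MeasureTheory

/-! ### Integrating out one vertex -/

section VertexElimination

variable {Λ : Type*} [Fintype Λ] [DecidableEq Λ] {β : Sym2 Λ → ℝ} {h : Λ → ℝ}

/-- The vector with value `x` at `n` and the values of `b` elsewhere. -/
def extendVec (n : Λ) (x : ℝ) (b : {j // j ≠ n} → ℝ) : Λ → ℝ :=
  fun i => if hi : i = n then x else b ⟨i, hi⟩

omit [Fintype Λ] in
theorem extendVec_self (n : Λ) (x : ℝ) (b : {j // j ≠ n} → ℝ) : extendVec n x b n = x := by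
  simp [extendVec]

omit [Fintype Λ] in
theorem subVec_extendVec (n : Λ) (x : ℝ) (b : {j // j ≠ n} → ℝ) :
    subVec n (extendVec n x b) = b := by
  funext j
  simp [extendVec, subVec, j.2]

theorem lintegral_split (n : Λ) {f : (Λ → ℝ) → ENNReal} (hf : Measurable f) :
    ∫⁻ b, f b = ∫⁻ b : {j // j ≠ n} → ℝ, ∫⁻ x : ℝ, f (extendVec n x b) := by
  let e := MeasurableEquiv.piEquivPiSubtypeProd (fun _ : Λ => ℝ) (fun j => j ≠ n)
  have he := (volume_preserving_piEquivPiSubtypeProd (fun _ : Λ => ℝ) (fun j => j ≠ n)).symm e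
  rw [he.lintegral_map_equiv, Measure.volume_eq_prod,
    lintegral_prod (fun q => f (e.symm q)) (hf.comp e.symm.measurable).aemeasurable]
  refine lintegral_congr fun b => ?_
  let _ : Unique {j // ¬ j ≠ n} :=
    { default := ⟨n, by simp⟩
      uniq := fun a => Subtype.ext (not_not.1 a.2) }
  have hu := (volume_preserving_funUnique {j // ¬ j ≠ n} ℝ).symm
    (MeasurableEquiv.funUnique {j // ¬ j ≠ n} ℝ)
  have := hu.lintegral_map_equiv (fun w => f (e.symm (b, w)))
  refine Eq.trans ?_ (this.trans ?_)
  · congr!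
  · refine lintegral_congr fun x => ?_
    congr 1
    funext i
    by_cases hi : i = n
    · simp [e, MeasurableEquiv.piEquivPiSubtypeProd, extendVec, hi, MeasurableEquiv.funUnique]
    · simp [e, MeasurableEquiv.piEquivPiSubtypeProd, extendVec, hi]

/-- The density of the arboreal gas measure in the variables `b`. -/
def psiDensity (β : Sym2 Λ → ℝ) (h : Λ → ℝ) : (Λ → ℝ) → ENNReal :=
  {b | (coupMat β b).PosDef}.indicator fun b => ENNReal.ofReal (√(coupMat β b).det *
    Real.exp (-(1 / 2) * (∑ i, b i + h ⬝ᵥ (coupMat β b)⁻¹.mulVec h)))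

/-- The total mass of `psiDensity`. -/
def psi (β : Sym2 Λ → ℝ) (h : Λ → ℝ) : ENNReal := ∫⁻ b, psiDensity β h b

theorem measurable_psiDensity : Measurable (psiDensity β h) := by
  refine Measurable.indicator (Measurable.ennreal_ofReal ?_) measurableSet_posDef_coupMat
  refine (continuous_coupMat.matrix_det.measurable.sqrt).mul (Measurable.exp ?_)
  exact ((Finset.measurable_sum _ fun i _ => measurable_pi_apply i).add
    (measurable_inv_quadratic h h)).const_mul _

omit [Fintype Λ] [DecidableEq Λ] in
theorem subWeight_nonneg (hβ : ∀ e, 0 ≤ β e) (n : Λ) (e : Sym2 {j // j ≠ n}) :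
    0 ≤ subWeight β n e := hβ _

/-- For fixed b elsewhere, the Schur complement c at n ranges over (0, ∞), and the density depends
on it as √c exp(-(c + a²/c)/2). The factor e^{-a} of the result turns the field h' of the reduced
density into h' + k. -/
theorem lintegral_psiDensity_extend (hβ : ∀ e, 0 ≤ β e) (hh : ∀ i, 0 ≤ h i) (n : Λ)
    (b : {j // j ≠ n} → ℝ) : ∫⁻ x : ℝ, psiDensity β h (extendVec n x b) =
      ENNReal.ofReal (√(2 * Real.pi) * Real.exp (-h n)) *
        (psiDensity (subWeight β n) (subVec n h + edgeWeight β n) b *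
          ENNReal.ofReal (1 + h n + edgeWeight β n ⬝ᵥ
            (coupMat (subWeight β n) b)⁻¹.mulVec (subVec n h))) := by
  set M := coupMat (subWeight β n) b with hMdef
  set k := edgeWeight β n with hk
  set h' := subVec n h with hh'
  by_cases hM : M.PosDef
  · have hκ0 : 0 ≤ k ⬝ᵥ M⁻¹.mulVec h' :=
      Finset.sum_nonneg fun j _ => mul_nonneg (hβ _)
        (inv_mulVec_nonneg (subWeight_nonneg hβ n) hM (fun j => hh j) j)
    set a := h n + k ⬝ᵥ M⁻¹.mulVec h' with ha
    have ha0 : 0 ≤ a := add_nonneg (hh n) hκ0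
    set κ := k ⬝ᵥ M⁻¹.mulVec k with hκ
    have hsc : ∀ c, schurCompl β n (extendVec n (c + κ) b) = c := fun c => by
      rw [schurCompl, extendVec_self, subVec_extendVec]
      ring
    have hval : ∀ c, psiDensity β h (extendVec n (c + κ) b) = (Set.Ioi (0 : ℝ)).indicator
        (fun c => ENNReal.ofReal (√M.det * Real.exp (-(1 / 2) *
          (∑ j, b j + κ + h' ⬝ᵥ M⁻¹.mulVec h'))) *
          ENNReal.ofReal (√c * Real.exp (-(1 / 2) * (c + a ^ 2 / c)))) c := by
      intro c
      have hiff := posDef_coupMat_iff (β := β) n (extendVec n (c + κ) b)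
      rw [subVec_extendVec, hsc] at hiff
      by_cases hc : 0 < c
      · have hP : (coupMat β (extendVec n (c + κ) b)).PosDef := hiff.2 ⟨hM, hc⟩
        have hdet := det_coupMat (β := β) n (extendVec n (c + κ) b)
          (by rw [subVec_extendVec]; exact hM)
        rw [subVec_extendVec, hsc] at hdet
        have hinv := coupMat_inv_quadratic n (extendVec n (c + κ) b) h hP
        rw [subVec_extendVec, hsc] at hinv
        have hsum : ∑ i, extendVec n (c + κ) b i = (c + κ) + ∑ j, b j := by
          rw [Fintype.sum_eq_add_sum_subtype_ne _ n, extendVec_self]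
          congr 1
          exact Finset.sum_congr rfl fun j _ => congrFun (subVec_extendVec n (c + κ) b) j
        rw [psiDensity, Set.indicator_of_mem (show _ ∈ {b | (coupMat β b).PosDef} from hP),
          Set.indicator_of_mem (show c ∈ Set.Ioi (0 : ℝ) from hc),
          ← ENNReal.ofReal_mul (by positivity), hdet, hinv, hsum,
          Real.sqrt_mul hM.det_pos.le]
        congr 1
        rw [mul_mul_mul_comm, ← Real.exp_add]
        congr 2
        ring
      · rw [psiDensity, Set.indicator_of_notMem (show _ ∉ {b | (coupMat β b).PosDef} from
          fun hP => hc (hiff.1 hP).2), Set.indicator_of_notMem (show c ∉ Set.Ioi (0 : ℝ) from hc)]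
    rw [← lintegral_add_right_eq_self _ κ]
    simp only [hval]
    rw [lintegral_indicator measurableSet_Ioi, lintegral_const_mul' _ _ ENNReal.ofReal_ne_top,
      lintegral_sqrt_mul_exp ha0, psiDensity,
      Set.indicator_of_mem (show b ∈ {b | (coupMat (subWeight β n) b).PosDef} from hM),
      ← ENNReal.ofReal_mul (by positivity), ← ENNReal.ofReal_mul (by positivity),
      ← ENNReal.ofReal_mul (by positivity)]
    congr 1
    have hquad : (h' + k) ⬝ᵥ M⁻¹.mulVec (h' + k) =
        h' ⬝ᵥ M⁻¹.mulVec h' + 2 * (k ⬝ᵥ M⁻¹.mulVec h') + κ := by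
      rw [Matrix.mulVec_add, dotProduct_add, add_dotProduct, add_dotProduct,
        PosDef.dotProduct_inv_comm hM h' k]
      ring
    rw [← hMdef, hquad]
    have hexp : Real.exp (-(1 / 2) * (∑ j, b j + κ + h' ⬝ᵥ M⁻¹.mulVec h')) * Real.exp (-a) =
        Real.exp (-h n) * Real.exp (-(1 / 2) * (∑ j, b j +
          (h' ⬝ᵥ M⁻¹.mulVec h' + 2 * (k ⬝ᵥ M⁻¹.mulVec h') + κ))) := by
      rw [← Real.exp_add, ← Real.exp_add]
      congr 1
      rw [ha]
      ring
    rw [show 1 + h n + k ⬝ᵥ M⁻¹.mulVec h' = 1 + a by rw [ha]; ring]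
    linear_combination (√M.det * √(2 * Real.pi) * (1 + a)) * hexp
  · have h0 : ∀ x, psiDensity β h (extendVec n x b) = 0 := fun x => by
      rw [psiDensity]
      refine Set.indicator_of_notMem ?_ _
      intro hP
      have := ((posDef_coupMat_iff n _).1 hP).1
      rw [subVec_extendVec] at this
      exact hM this
    have h1 : psiDensity (subWeight β n) (h' + k) b = 0 :=
      Set.indicator_of_notMem (show b ∉ {b | (coupMat (subWeight β n) b).PosDef} from hM) _
    simp [h0, h1]

theorem psi_eq_lintegral (hβ : ∀ e, 0 ≤ β e) (hh : ∀ i, 0 ≤ h i) (n : Λ) :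
    psi β h = ENNReal.ofReal (√(2 * Real.pi) * Real.exp (-h n)) *
      ∫⁻ b, psiDensity (subWeight β n) (subVec n h + edgeWeight β n) b *
          ENNReal.ofReal (1 + h n + edgeWeight β n ⬝ᵥ
            (coupMat (subWeight β n) b)⁻¹.mulVec (subVec n h)) := by
  rw [psi, lintegral_split n measurable_psiDensity]
  simp only [lintegral_psiDensity_extend hβ hh n]
  rw [lintegral_const_mul' _ _ ENNReal.ofReal_ne_top]

theorem psi_zero (hβ : ∀ e, 0 ≤ β e) (n : Λ) :
    psi β 0 = ENNReal.ofReal √(2 * Real.pi) * psi (subWeight β n) (edgeWeight β n) := by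
  have h0 : subVec n (0 : Λ → ℝ) = 0 := rfl
  rw [psi_eq_lintegral (h := (0 : Λ → ℝ)) hβ (fun _ => le_rfl) n, h0, zero_add, psi]
  simp

/-- In `psi_eq_lintegral` the value h_n enters only through e^{-h_n} and one additive term, so after
multiplication by e^{h_n} the result is affine in h_n. -/
theorem psi_update (hβ : ∀ e, 0 ≤ β e) (hh : ∀ i, 0 ≤ h i) (n : Λ) :
    ENNReal.ofReal (Real.exp (h n)) * psi β h = psi β (Function.update h n 0) +
      ENNReal.ofReal (√(2 * Real.pi) * h n) *
        psi (subWeight β n) (subVec n h + edgeWeight β n) := by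
  have hs : subVec n (Function.update h n 0) = subVec n h := by
    funext j
    simp [subVec, j.2]
  have hh0 : ∀ i, 0 ≤ Function.update h n 0 i := fun i => by
    by_cases hi : i = n
    · simp [hi]
    · simp [hi, hh i]
  rw [psi_eq_lintegral hβ hh n, psi_eq_lintegral hβ hh0 n, hs, Function.update_self, neg_zero,
    Real.exp_zero, mul_one, add_zero, ← mul_assoc, ← ENNReal.ofReal_mul (Real.exp_pos _).le,
    mul_left_comm, ← Real.exp_add, add_neg_cancel, Real.exp_zero, mul_one,
    ENNReal.ofReal_mul (Real.sqrt_nonneg _), mul_assoc, ← mul_add]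
  congr 1
  rw [psi, ← lintegral_const_mul' (ENNReal.ofReal (h n))
    (psiDensity (subWeight β n) (subVec n h + edgeWeight β n)) ENNReal.ofReal_ne_top,
    ← lintegral_add_right _ (measurable_psiDensity.const_mul _)]
  refine lintegral_congr fun b => ?_
  by_cases hM : (coupMat (subWeight β n) b).PosDef
  · have hκ0 : 0 ≤ edgeWeight β n ⬝ᵥ (coupMat (subWeight β n) b)⁻¹.mulVec (subVec n h) :=
      Finset.sum_nonneg fun j _ => mul_nonneg (hβ _)
        (inv_mulVec_nonneg (subWeight_nonneg hβ n) hM (fun j => hh j) j)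
    rw [mul_comm (ENNReal.ofReal (h n)), ← mul_add, ← ENNReal.ofReal_add (by positivity) (hh n)]
    congr 2
    ring
  · rw [psiDensity, Set.indicator_of_notMem
      (show b ∉ {b | (coupMat (subWeight β n) b).PosDef} from hM)]
    simp

end VertexElimination

end

end HoroH24

namespace HoroH24

noncomputable section

open MeasureTheory

/-! ### From t to the diagonal of M -/

section Substitution

variable {Λ : Type*} [Fintype Λ] [DecidableEq Λ] {β : Sym2 Λ → ℝ} {h : Λ → ℝ}

/-- The diagonal of `e^{-t} (-Δ_{β(t),h(t)}) e^{-t}`. -/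
def diagVec (β : Sym2 Λ → ℝ) (h t : Λ → ℝ) : Λ → ℝ := fun i => horoDiag β h t i - β s(i, i)

theorem horoMat_eq_coupMat (t : Λ → ℝ) :
    Matrix.of (horoMat β h t) = coupMat β (diagVec β h t) := by
  ext i j
  rw [Matrix.of_apply, horoMat_apply, coupMat, Matrix.of_apply, diagVec]
  split_ifs with hij
  · rw [hij]
  · rw [zero_sub]

theorem coupMat_mulVec_apply (b v : Λ → ℝ) (i : Λ) :
    (coupMat β b).mulVec v i = b i * v i + β s(i, i) * v i - ∑ j, β s(i, j) * v j := by
  have e : ∀ j, coupMat β b i j * v j =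
      (if i = j then b i * v i + β s(i, i) * v i else 0) - β s(i, j) * v j := by
    intro j
    rw [coupMat, Matrix.of_apply]
    split_ifs with hij
    · subst hij
      ring
    · ring
  rw [Matrix.mulVec, dotProduct]
  simp only [e, Finset.sum_sub_distrib, Finset.sum_ite_eq, Finset.mem_univ, if_true]

/-- This identity inverts the substitution: t is recovered from b as log(M⁻¹h). -/
theorem coupMat_diagVec_mulVec_exp (t : Λ → ℝ) :
    (coupMat β (diagVec β h t)).mulVec (fun i => Real.exp (t i)) = h := by
  funext i
  rw [coupMat_mulVec_apply, diagVec, horoDiag, sub_mul, sub_add_cancel, add_mul, Finset.sum_mul]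
  simp only [mul_assoc, ← Real.exp_add, sub_add_cancel, neg_add_cancel, Real.exp_zero, mul_one]
  ring

/-- If u = M⁻¹h ≥ 0 vanishes at a vertex, its equation there forces h to vanish at that vertex and u
at all neighbours; by connectedness this contradicts h ≠ 0. -/
theorem coupMat_inv_mulVec_pos (hβ : ∀ e, 0 ≤ β e) (hh : ∀ i, 0 ≤ h i)
    (hconn : (weightGraph β).Connected) (hpos : ∃ i, 0 < h i) {b : Λ → ℝ}
    (hM : (coupMat β b).PosDef) (i : Λ) : 0 < (coupMat β b)⁻¹.mulVec h i := by
  have h0 := inv_mulVec_nonneg hβ hM hh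
  have hu := PosDef.mulVec_inv hM h
  set u := (coupMat β b)⁻¹.mulVec h
  have hz : ∀ a, u a = 0 → h a = 0 ∧ ∀ j, β s(a, j) * u j = 0 := by
    intro a ha
    have h1 := congrFun hu a
    rw [coupMat_mulVec_apply, ha, mul_zero, mul_zero, add_zero, zero_sub] at h1
    have h2 : ∀ j ∈ Finset.univ, 0 ≤ β s(a, j) * u j := fun j _ => mul_nonneg (hβ _) (h0 j)
    have h3 := Finset.sum_nonneg h2
    have h4 := hh a
    have h5 : ∑ j, β s(a, j) * u j = 0 := by linarith
    refine ⟨by linarith, fun j => (Finset.sum_eq_zero_iff_of_nonneg h2).1 h5 j (Finset.mem_univ j)⟩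
  by_contra hi
  have hi0 : u i = 0 := le_antisymm (not_lt.1 hi) (h0 i)
  have hall : ∀ j, u j = 0 := by
    intro j
    obtain ⟨w⟩ := hconn.preconnected i j
    clear hi
    induction w with
    | nil => exact hi0
    | cons hadj _ ih =>
      refine ih ?_
      rw [weightGraph, SimpleGraph.fromEdgeSet_adj] at hadj
      exact (mul_eq_zero.1 ((hz _ hi0).2 _)).resolve_left hadj.1
  obtain ⟨r, hr⟩ := hpos
  exact hr.ne' (hz r (hall r)).1

theorem image_diagVec (hβ : ∀ e, 0 ≤ β e) (hh : ∀ i, 0 ≤ h i)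
    (hconn : (weightGraph β).Connected) (hpos : ∃ i, 0 < h i) :
    diagVec β h '' Set.univ = {b | (coupMat β b).PosDef} := by
  ext b
  rw [Set.image_univ, Set.mem_range, Set.mem_ofPred_eq]
  constructor
  · rintro ⟨t, rfl⟩
    rw [← horoMat_eq_coupMat]
    exact posDef_horoMat hβ hh hconn hpos t
  · intro hM
    have hp := coupMat_inv_mulVec_pos hβ hh hconn hpos hM
    have hu := PosDef.mulVec_inv hM h
    set u := (coupMat β b)⁻¹.mulVec h
    refine ⟨fun i => Real.log (u i), funext fun i => ?_⟩
    have h1 := congrFun hu i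
    rw [coupMat_mulVec_apply] at h1
    rw [diagVec, horoDiag]
    simp only [Real.exp_sub, Real.exp_neg, Real.exp_log (hp _), mul_div_assoc', ← div_eq_mul_inv]
    rw [← Finset.sum_div, ← add_div, sub_eq_iff_eq_add, div_eq_iff (hp i).ne']
    linarith

theorem injective_diagVec (hβ : ∀ e, 0 ≤ β e) (hh : ∀ i, 0 ≤ h i)
    (hconn : (weightGraph β).Connected) (hpos : ∃ i, 0 < h i) :
    Function.Injective (diagVec β h) := by
  have key : ∀ t, (coupMat β (diagVec β h t))⁻¹.mulVec h = fun i => Real.exp (t i) := by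
    intro t
    have hM := posDef_horoMat hβ hh hconn hpos t
    rw [horoMat_eq_coupMat] at hM
    have := PosDef.inv_mulVec hM fun i => Real.exp (t i)
    rwa [coupMat_diagVec_mulVec_exp] at this
  intro t t' htt
  have h1 := key t
  rw [htt, key t'] at h1
  funext i
  exact (Real.exp_injective (congrFun h1 i)).symm

/-- The derivative of `diagVec`. -/
def diagVecDeriv (β : Sym2 Λ → ℝ) (h t : Λ → ℝ) : (Λ → ℝ) →L[ℝ] (Λ → ℝ) :=
  ContinuousLinearMap.pi fun i =>
    ∑ j, β s(i, j) • Real.exp (t j - t i) •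
        ((ContinuousLinearMap.proj j : (Λ → ℝ) →L[ℝ] ℝ) - ContinuousLinearMap.proj i) +
      h i • Real.exp (-t i) • -(ContinuousLinearMap.proj i : (Λ → ℝ) →L[ℝ] ℝ)

omit [DecidableEq Λ] in
theorem hasFDerivAt_diagVec (t : Λ → ℝ) : HasFDerivAt (diagVec β h) (diagVecDeriv β h t) t := by
  refine hasFDerivAt_pi.2 fun i => ?_
  have hp : ∀ j, HasFDerivAt (fun t : Λ → ℝ => t j)
    (ContinuousLinearMap.proj j : (Λ → ℝ) →L[ℝ] ℝ) t := fun j => hasFDerivAt_apply j t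
  exact ((HasFDerivAt.fun_sum fun j _ => (((hp j).sub (hp i)).exp.const_mul (β s(i, j)))).add
    ((hp i).neg.exp.const_mul (h i))).sub_const _

/-- The derivative is -e^{-t} M e^{t}, so its Jacobian is det M. -/
theorem diagVecDeriv_eq (t : Λ → ℝ) : (diagVecDeriv β h t : (Λ → ℝ) →ₗ[ℝ] (Λ → ℝ)) =
    Matrix.toLin' (-(Matrix.diagonal (fun i => Real.exp (-t i)) * coupMat β (diagVec β h t) *
      Matrix.diagonal (fun i => Real.exp (t i)))) := by
  refine LinearMap.ext fun v => funext fun i => ?_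
  rw [Matrix.toLin'_apply, Matrix.neg_mulVec, ← Matrix.mulVec_mulVec, ← Matrix.mulVec_mulVec,
    Pi.neg_apply, Matrix.mulVec_diagonal, coupMat_mulVec_apply]
  simp only [Matrix.mulVec_diagonal, diagVec, horoDiag]
  have e : ∀ j, Real.exp (t j - t i) = Real.exp (-t i) * Real.exp (t j) := fun j => by
    rw [← Real.exp_add]
    congr 1
    ring
  have hi : Real.exp (-t i) * Real.exp (t i) = 1 := by rw [← Real.exp_add]; simp
  simp only [diagVecDeriv, e, ContinuousLinearMap.coe_coe, ContinuousLinearMap.pi_apply,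
    add_apply, sum_apply, smul_apply,
    sub_apply, neg_apply, ContinuousLinearMap.proj_apply,
    smul_eq_mul, mul_sub, Finset.sum_sub_distrib]
  have e1 : ∑ j, β s(i, j) * (Real.exp (-t i) * Real.exp (t j) * v j) =
      Real.exp (-t i) * ∑ j, β s(i, j) * (Real.exp (t j) * v j) := by
    rw [Finset.mul_sum]
    exact Finset.sum_congr rfl fun j _ => by ring
  have e2 : ∑ j, β s(i, j) * (Real.exp (-t i) * Real.exp (t j) * v i) =
      (∑ j, β s(i, j) * (Real.exp (-t i) * Real.exp (t j))) * v i := by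
    rw [Finset.sum_mul]
    exact Finset.sum_congr rfl fun j _ => by ring
  rw [e1, e2]
  linear_combination (∑ j, β s(i, j) * (Real.exp (-t i) * Real.exp (t j)) +
    h i * Real.exp (-t i)) * v i * hi

theorem abs_det_diagVecDeriv (hβ : ∀ e, 0 ≤ β e) (hh : ∀ i, 0 ≤ h i)
    (hconn : (weightGraph β).Connected) (hpos : ∃ i, 0 < h i) (t : Λ → ℝ) :
    |(diagVecDeriv β h t).det| = (coupMat β (diagVec β h t)).det := by
  have hM := posDef_horoMat hβ hh hconn hpos t
  rw [horoMat_eq_coupMat] at hM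
  rw [ContinuousLinearMap.det, diagVecDeriv_eq, LinearMap.det_toLin', Matrix.det_neg,
    Matrix.det_mul, Matrix.det_mul, Matrix.det_diagonal, Matrix.det_diagonal, abs_mul, abs_pow,
    abs_neg, abs_one, one_pow, one_mul, mul_right_comm, ← Finset.prod_mul_distrib]
  simp only [← Real.exp_add, neg_add_cancel, Real.exp_zero, Finset.prod_const_one, one_mul]
  exact abs_of_pos hM.det_pos

theorem horoRest_zero_eq (t : Λ → ℝ)
    (hM : (coupMat β (diagVec β h t)).PosDef) : horoRest β h t 0 =
    (1 / 2) * (∑ i, diagVec β h t i + h ⬝ᵥ (coupMat β (diagVec β h t))⁻¹.mulVec h) -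
      ((1 / 2) * (∑ i, ∑ j, β s(i, j) - ∑ i, β s(i, i)) + ∑ i, h i) := by
  have hinv : (coupMat β (diagVec β h t))⁻¹.mulVec h = fun i => Real.exp (t i) := by
    have := PosDef.inv_mulVec hM fun i => Real.exp (t i)
    rwa [coupMat_diagVec_mulVec_exp] at this
  have hsw : ∑ i, ∑ j, β s(i, j) * Real.exp (t i - t j) =
      ∑ i, ∑ j, β s(i, j) * Real.exp (t j - t i) := by
    rw [Finset.sum_comm]
    simp only [Sym2.eq_swap]
  rw [hinv, horoRest_zero]
  simp only [diagVec, horoDiag, dotProduct, Real.cosh_eq, neg_sub, mul_sub, mul_one,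
    Finset.sum_sub_distrib, Finset.sum_add_distrib, mul_div_assoc', mul_add, ← Finset.sum_div, hsw]
  ring

/-- Of the power 3/2 of det M, one determinant is the Jacobian and √(det M) stays in the density.
Working in `ENNReal` leaves finiteness to the final evaluation. -/
theorem lintegral_exp_neg_horoT (hβ : ∀ e, 0 ≤ β e) (hh : ∀ i, 0 ≤ h i)
    (hconn : (weightGraph β).Connected) (hpos : ∃ i, 0 < h i) :
    ∫⁻ t, ENNReal.ofReal (Real.exp (-horoT β h t)) = ENNReal.ofReal (Real.exp
      ((1 / 2) * (∑ i, ∑ j, β s(i, j) - ∑ i, β s(i, i)) + ∑ i, h i)) * psi β h := by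
  have h1 := lintegral_image_eq_lintegral_abs_det_fderiv_mul volume MeasurableSet.univ
    (fun t _ => (hasFDerivAt_diagVec (β := β) (h := h) t).hasFDerivWithinAt)
    (injective_diagVec hβ hh hconn hpos).injOn (fun b => ENNReal.ofReal (√(coupMat β b).det *
    Real.exp (-(1 / 2) * (∑ i, b i + h ⬝ᵥ (coupMat β b)⁻¹.mulVec h))))
  rw [image_diagVec hβ hh hconn hpos, ← lintegral_indicator measurableSet_posDef_coupMat,
    Measure.restrict_univ] at h1
  change psi β h = _ at h1
  rw [h1, ← lintegral_const_mul' _ _ ENNReal.ofReal_ne_top]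
  refine lintegral_congr fun t => ?_
  have hM := posDef_horoMat hβ hh hconn hpos t
  rw [exp_neg_horoT hβ hh hconn hpos t]
  rw [horoMat_eq_coupMat] at hM ⊢
  rw [abs_det_diagVecDeriv hβ hh hconn hpos, horoRest_zero_eq t hM,
    ← ENNReal.ofReal_mul hM.det_pos.le, ← ENNReal.ofReal_mul (Real.exp_pos _).le, neg_sub,
    sub_eq_add_neg, Real.exp_add, ← neg_mul]
  congr 1
  ring

end Substitution

end

end HoroH24

namespace HoroH24

noncomputable section

/-! ### Components as vertex sets -/

section Components

variable {V : Type*} [Fintype V] {G : SimpleGraph V}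

open Classical in
/-- The vertex set of the component of `v`. -/
def compOf (G : SimpleGraph V) (v : V) : Finset V := Finset.univ.filter (G.Reachable v)

open Classical in
/-- The vertex sets of the components. -/
def compSets (G : SimpleGraph V) : Finset (Finset V) := Finset.univ.image (compOf G)

theorem mem_compOf {v w : V} : w ∈ compOf G v ↔ G.Reachable v w := by simp [compOf]

theorem mem_compSets {T : Finset V} : T ∈ compSets G ↔ ∃ v, compOf G v = T := by simp [compSets]

theorem self_mem_compOf (v : V) : v ∈ compOf G v := mem_compOf.2 (SimpleGraph.Reachable.refl v)

theorem compOf_eq_of_mem {v w : V} (h : w ∈ compOf G v) : compOf G v = compOf G w := by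
  rw [mem_compOf] at h
  ext x
  rw [mem_compOf, mem_compOf]
  exact ⟨fun hx => h.symm.trans hx, fun hx => h.trans hx⟩

theorem eq_compOf_of_mem {T : Finset V} (hT : T ∈ compSets G) {v : V} (hv : v ∈ T) :
    T = compOf G v := by
  obtain ⟨w, rfl⟩ := mem_compSets.1 hT
  exact compOf_eq_of_mem hv

open Classical in
theorem prod_connectedComponent (G : SimpleGraph V) (f : Finset V → ℝ) :
    ∏ T : G.ConnectedComponent, f {i | G.connectedComponentMk i = T} =
      ∏ T ∈ compSets G, f T := by
  have hc : ∀ v, (Finset.univ.filter fun i => G.connectedComponentMk i =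
      G.connectedComponentMk v) = compOf G v := fun v => by
    ext w
    rw [mem_compOf, Finset.mem_filter, SimpleGraph.ConnectedComponent.eq]
    exact ⟨fun h => h.2.symm, fun h => ⟨Finset.mem_univ _, h.symm⟩⟩
  have e : compSets G = Finset.univ.image fun T : G.ConnectedComponent =>
      Finset.univ.filter fun i => G.connectedComponentMk i = T := by
    ext T
    simp only [mem_compSets, Finset.mem_image, Finset.mem_univ, true_and]
    constructor
    · rintro ⟨v, rfl⟩
      exact ⟨G.connectedComponentMk v, hc v⟩
    · rintro ⟨c, rfl⟩
      induction c using SimpleGraph.ConnectedComponent.ind with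
      | h v => exact ⟨v, (hc v).symm⟩
  rw [e, Finset.prod_image]
  intro c _ c' _ hcc
  induction c using SimpleGraph.ConnectedComponent.ind with
  | h v =>
    have hv : v ∈ Finset.univ.filter fun i => G.connectedComponentMk i =
      G.connectedComponentMk v := by simp
    simp only [hcc] at hv
    simpa using hv

-- A walk starting in a component that contains neither end of the new edge can never use it.
omit [Fintype V] in
theorem reachable_of_sup_edge {u v : V} {a b : V} (hu : ¬ G.Reachable a u) (hv : ¬ G.Reachable a v)
    (hab : (G ⊔ SimpleGraph.edge u v).Reachable a b) : G.Reachable a b := by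
  obtain ⟨w⟩ := hab
  induction w with
  | nil => exact SimpleGraph.Reachable.refl _
  | cons hadj _ ih =>
    rw [SimpleGraph.sup_adj, SimpleGraph.edge_adj] at hadj
    rcases hadj with hadj | ⟨⟨rfl, -⟩ | ⟨rfl, -⟩, -⟩
    · have hr := hadj.reachable
      exact hr.trans (ih (fun h => hu (hr.trans h)) fun h => hv (hr.trans h))
    · exact absurd (SimpleGraph.Reachable.refl _) hu
    · exact absurd (SimpleGraph.Reachable.refl _) hv

theorem compOf_sup_edge {u v a : V} (hu : ¬ G.Reachable a u) (hv : ¬ G.Reachable a v) :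
    compOf (G ⊔ SimpleGraph.edge u v) a = compOf G a := by
  ext b
  rw [mem_compOf, mem_compOf]
  exact ⟨reachable_of_sup_edge hu hv, fun h => h.mono le_sup_left⟩

theorem mem_compSets_sup_edge {u v : V} (huv : u ≠ v) {T : Finset V} :
    T ∈ compSets (G ⊔ SimpleGraph.edge u v) ∧ u ∉ T ↔ T ∈ compSets G ∧ u ∉ T ∧ v ∉ T := by
  have hadj : (G ⊔ SimpleGraph.edge u v).Adj v u := by
    rw [SimpleGraph.sup_adj, SimpleGraph.edge_adj]
    exact Or.inr ⟨Or.inr ⟨rfl, rfl⟩, huv.symm⟩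
  constructor
  · rintro ⟨hT, hu⟩
    obtain ⟨a, rfl⟩ := mem_compSets.1 hT
    rw [mem_compOf] at hu
    have hv : ¬ (G ⊔ SimpleGraph.edge u v).Reachable a v := fun h => hu (h.trans hadj.reachable)
    have hu' : ¬ G.Reachable a u := fun h => hu (h.mono le_sup_left)
    have hv' : ¬ G.Reachable a v := fun h => hv (h.mono le_sup_left)
    rw [compOf_sup_edge hu' hv', mem_compOf, mem_compOf]
    exact ⟨mem_compSets.2 ⟨a, rfl⟩, hu', hv'⟩
  · rintro ⟨hT, hu, hv⟩
    obtain ⟨a, rfl⟩ := mem_compSets.1 hT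
    rw [mem_compOf] at hu hv
    exact ⟨mem_compSets.2 ⟨a, compOf_sup_edge hu hv⟩, mt mem_compOf.1 hu⟩

end Components

/-! ### Forests with a distinguished root -/

section RootedForests

variable {V : Type*} [Fintype V] [DecidableEq V]

/-- The graph with edge set `F`. -/
def edgeGraph (F : Finset (Sym2 V)) : SimpleGraph V := SimpleGraph.fromEdgeSet (F : Set (Sym2 V))

omit [Fintype V] in
theorem edgeGraph_insert (F : Finset (Sym2 V)) (u v : V) :
    edgeGraph (insert s(u, v) F) = edgeGraph F ⊔ SimpleGraph.edge u v := by
  rw [edgeGraph, edgeGraph, SimpleGraph.edge, Finset.coe_insert, Set.insert_eq,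
    Set.union_comm, SimpleGraph.fromEdgeSet_union]

open Classical in
/-- The weight of a forest with edge set `F`, with a factor `a T` for every tree `T` which does not
contain the root `n`; zero if `F` is not the edge set of a forest. -/
def rootedTerm (β : Sym2 V → ℝ) (n : V) (a : Finset V → ℝ) (F : Finset (Sym2 V)) : ℝ :=
  if (edgeGraph F).IsAcyclic then
    (∏ e ∈ F, β e) * ∏ T ∈ compSets (edgeGraph F) with n ∉ T, a T else 0

theorem rootedTerm_congr (β : Sym2 V → ℝ) (n : V) {a a' : Finset V → ℝ} (F : Finset (Sym2 V))
    (ha : ∀ T ∈ compSets (edgeGraph F), n ∉ T → a T = a' T) :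
    rootedTerm β n a F = rootedTerm β n a' F := by
  rw [rootedTerm, rootedTerm]
  congr 2
  refine Finset.prod_congr rfl fun T hT => ?_
  rw [Finset.mem_filter] at hT
  exact ha T hT.1 hT.2

/-- If n and i are already connected, the new edge closes a cycle. Otherwise it joins the tree of i
to the root's tree, so the factor `a T` of that tree is traded for the edge weight. -/
theorem rootedTerm_insert (β : Sym2 V → ℝ) {n i : V} (hi : i ≠ n) {F : Finset (Sym2 V)}
    (hF : s(n, i) ∉ F) (a : Finset V → ℝ) :
    rootedTerm β n a F + rootedTerm β n a (insert s(n, i) F) =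
      rootedTerm β n (fun T => a T + if i ∈ T then β s(n, i) else 0) F := by
  classical
  have hadj : ¬ (edgeGraph F).Adj n i := by
    rw [edgeGraph, SimpleGraph.fromEdgeSet_adj]
    exact fun h => hF h.1
  have hac := SimpleGraph.isAcyclic_sup_fromEdgeSet_iff (G := edgeGraph F) (u := n) (v := i)
  rw [← edgeGraph_insert] at hac
  by_cases hA : (edgeGraph F).IsAcyclic
  swap
  · rw [rootedTerm, rootedTerm, rootedTerm, if_neg hA, if_neg (fun h => hA (hac.1 h).1), if_neg hA,
      add_zero]
  by_cases hR : (edgeGraph F).Reachable n i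
  · have h0 : rootedTerm β n a (insert s(n, i) F) = 0 := by
      rw [rootedTerm, if_neg]
      exact fun h => ((hac.1 h).2 hR).elim (fun h => hi h.symm) hadj
    rw [h0, add_zero]
    refine rootedTerm_congr β n F fun T hT hn => ?_
    rw [if_neg, add_zero]
    intro hiT
    rw [eq_compOf_of_mem hT hiT, mem_compOf] at hn
    exact hn hR.symm
  · have hA' := hac.2 ⟨hA, fun h => absurd h hR⟩
    rw [rootedTerm, rootedTerm, rootedTerm, if_pos hA, if_pos hA', if_pos hA,
      Finset.prod_insert hF]
    have e1 : (compSets (edgeGraph (insert s(n, i) F))).filter (n ∉ ·) =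
        ((compSets (edgeGraph F)).filter (n ∉ ·)).erase (compOf (edgeGraph F) i) := by
      ext T
      rw [Finset.mem_filter, edgeGraph_insert, mem_compSets_sup_edge hi.symm, Finset.mem_erase,
        Finset.mem_filter]
      constructor
      · rintro ⟨h1, h2, h3⟩
        exact ⟨fun h => h3 (h ▸ self_mem_compOf i), h1, h2⟩
      · rintro ⟨h1, h2, h3⟩
        exact ⟨h2, h3, fun h => h1 (eq_compOf_of_mem h2 h)⟩
    have hmem : compOf (edgeGraph F) i ∈ (compSets (edgeGraph F)).filter (n ∉ ·) :=
      Finset.mem_filter.2 ⟨mem_compSets.2 ⟨i, rfl⟩, fun h => hR (mem_compOf.1 h).symm⟩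
    rw [e1, ← Finset.mul_prod_erase _ _ hmem, ← Finset.mul_prod_erase _ _ hmem,
      if_pos (self_mem_compOf i)]
    have e2 : ∏ T ∈ ((compSets (edgeGraph F)).filter (n ∉ ·)).erase (compOf (edgeGraph F) i),
        (a T + if i ∈ T then β s(n, i) else 0) =
        ∏ T ∈ ((compSets (edgeGraph F)).filter (n ∉ ·)).erase (compOf (edgeGraph F) i), a T := by
      refine Finset.prod_congr rfl fun T hT => ?_
      rw [Finset.mem_erase, Finset.mem_filter] at hT
      rw [if_neg fun h => hT.1 (eq_compOf_of_mem hT.2.1 h), add_zero]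
    rw [e2]
    ring

/-- The tree weight `a` is arbitrary so that each edge at n can be absorbed into it in turn. -/
theorem sum_rootedTerm_star (β : Sym2 V → ℝ) (n : V) (W : Finset V) :
    ∀ (F : Finset (Sym2 V)) (a : Finset V → ℝ), (∀ i ∈ W, i ≠ n ∧ s(n, i) ∉ F) →
      ∑ S ∈ (W.image fun i => s(n, i)).powerset, rootedTerm β n a (F ∪ S) =
        rootedTerm β n (fun T => a T + ∑ i ∈ W, if i ∈ T then β s(n, i) else 0) F := by
  induction W using Finset.induction_on with
  | empty => intro F a _; simp
  | insert i W hi ih =>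
    intro F a hW
    have hinj : ∀ j, s(n, i) = s(n, j) → i = j := fun j h => Sym2.congr_right.1 h
    have hiW : s(n, i) ∉ W.image fun i => s(n, i) := by
      rw [Finset.mem_image]
      rintro ⟨j, hj, hji⟩
      exact hi (hinj j hji.symm ▸ hj)
    rw [Finset.image_insert, Finset.sum_powerset_insert hiW]
    have h1 := ih F a fun j hj => hW j (Finset.mem_insert_of_mem hj)
    have h2 := ih (insert s(n, i) F) a fun j hj => ⟨(hW j (Finset.mem_insert_of_mem hj)).1, by
      rw [Finset.mem_insert, not_or]
      exact ⟨fun h => hi (hinj j h.symm ▸ hj), (hW j (Finset.mem_insert_of_mem hj)).2⟩⟩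
    simp only [Finset.union_insert]
    simp only [Finset.insert_union] at h2
    obtain ⟨h3, h4⟩ := hW i (Finset.mem_insert_self _ _)
    rw [h1, h2, rootedTerm_insert β h3 h4]
    refine rootedTerm_congr β n F fun T _ _ => ?_
    rw [Finset.sum_insert hi]
    ring

theorem sum_powerset_union {ι : Type*} [DecidableEq ι] {s t : Finset ι} (hst : Disjoint s t)
    (f : Finset ι → ℝ) :
    ∑ u ∈ (s ∪ t).powerset, f u = ∑ a ∈ s.powerset, ∑ b ∈ t.powerset, f (a ∪ b) := by
  induction t using Finset.induction_on generalizing f with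
  | empty => simp
  | insert x t hx ih =>
    rw [Finset.disjoint_insert_right] at hst
    rw [Finset.union_insert, Finset.sum_powerset_insert, ih hst.2, ih hst.2,
      ← Finset.sum_add_distrib]
    · refine Finset.sum_congr rfl fun a _ => ?_
      rw [Finset.sum_powerset_insert hx]
      simp only [Finset.union_insert]
    · rw [Finset.mem_union, not_or]
      exact ⟨hst.1, hx⟩

end RootedForests

/-! ### Forests avoiding a vertex -/

section VertexDeletion

variable {V : Type*} [Fintype V] [DecidableEq V] (n : V)

/-- The inclusion of the edges which avoid `n`. -/
def edgeIncl : Sym2 {j // j ≠ n} ↪ Sym2 V := (Function.Embedding.subtype _).sym2Map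

omit [Fintype V] [DecidableEq V] in
theorem edgeIncl_mk (i j : {j // j ≠ n}) : edgeIncl n s(i, j) = s(i.1, j.1) := rfl

omit [Fintype V] [DecidableEq V] in
theorem edgeGraph_map_adj (F : Finset (Sym2 {j // j ≠ n})) (i j : {j // j ≠ n}) :
    (edgeGraph (F.map (edgeIncl n))).Adj i j ↔ (edgeGraph F).Adj i j := by
  rw [edgeGraph, edgeGraph, SimpleGraph.fromEdgeSet_adj, SimpleGraph.fromEdgeSet_adj,
    Finset.mem_coe, Finset.mem_coe, ← edgeIncl_mk, Finset.mem_map', Ne, Ne, Subtype.ext_iff]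

omit [Fintype V] [DecidableEq V] in
theorem ne_of_edgeGraph_map_adj (F : Finset (Sym2 {j // j ≠ n})) {a b : V}
    (hab : (edgeGraph (F.map (edgeIncl n))).Adj a b) : b ≠ n := by
  rw [edgeGraph, SimpleGraph.fromEdgeSet_adj, Finset.mem_coe, Finset.mem_map] at hab
  obtain ⟨⟨e, -, he⟩, -⟩ := hab
  have hb : b ∈ edgeIncl n e := he ▸ Sym2.mem_mk_right a b
  induction e using Sym2.ind with
  | _ i j =>
    rw [edgeIncl_mk, Sym2.mem_iff] at hb
    rcases hb with rfl | rfl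
    · exact i.2
    · exact j.2

omit [Fintype V] [DecidableEq V] in
theorem edgeGraph_map_reachable (F : Finset (Sym2 {j // j ≠ n})) (i : {j // j ≠ n}) (b : V) :
    (edgeGraph (F.map (edgeIncl n))).Reachable i b ↔
      ∃ j : {j // j ≠ n}, j.1 = b ∧ (edgeGraph F).Reachable i j := by
  constructor
  · rintro ⟨w⟩
    generalize ha : i.1 = a at w
    induction w generalizing i with
    | nil => exact ⟨i, ha, SimpleGraph.Reachable.refl _⟩
    | cons hadj _ ih =>
      rename_i u v _ _
      subst ha
      obtain ⟨j, hj, hr⟩ := ih ⟨v, ne_of_edgeGraph_map_adj n F hadj⟩ rfl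
      refine ⟨j, hj, SimpleGraph.Reachable.trans ?_ hr⟩
      exact ((edgeGraph_map_adj n F i ⟨v, ne_of_edgeGraph_map_adj n F hadj⟩).1 hadj).reachable
  · rintro ⟨j, rfl, ⟨w⟩⟩
    induction w with
    | nil => exact SimpleGraph.Reachable.refl _
    | cons hadj _ ih => exact ((edgeGraph_map_adj n F _ _).2 hadj).reachable.trans ih

-- Induction on edges: adding an edge keeps a forest acyclic under a condition on adjacency and
-- reachability, both of which the inclusion preserves.
omit [Fintype V] in
theorem edgeGraph_map_isAcyclic (F : Finset (Sym2 {j // j ≠ n})) :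
    (edgeGraph (F.map (edgeIncl n))).IsAcyclic ↔ (edgeGraph F).IsAcyclic := by
  induction F using Finset.induction_on with
  | empty => simp [edgeGraph]
  | insert e F _ ih =>
    induction e using Sym2.ind with
    | _ i j =>
      rw [Finset.map_insert, edgeIncl_mk, edgeGraph_insert, edgeGraph_insert,
        SimpleGraph.isAcyclic_sup_fromEdgeSet_iff, SimpleGraph.isAcyclic_sup_fromEdgeSet_iff, ih,
        edgeGraph_map_adj, edgeGraph_map_reachable, Subtype.ext_iff]
      refine and_congr_right fun _ => imp_congr_left ?_
      constructor
      · rintro ⟨k, hk, hr⟩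
        rwa [← Subtype.ext hk]
      · exact fun h => ⟨j, rfl, h⟩

theorem compOf_edgeGraph_map (F : Finset (Sym2 {j // j ≠ n})) (i : {j // j ≠ n}) :
    compOf (edgeGraph (F.map (edgeIncl n))) i.1 =
      (compOf (edgeGraph F) i).map (Function.Embedding.subtype _) := by
  ext b
  rw [mem_compOf, edgeGraph_map_reachable, Finset.mem_map]
  constructor
  · rintro ⟨j, rfl, h⟩
    exact ⟨j, mem_compOf.2 h, rfl⟩
  · rintro ⟨j, h, rfl⟩
    exact ⟨j, rfl, mem_compOf.1 h⟩

theorem compSets_edgeGraph_map (F : Finset (Sym2 {j // j ≠ n})) :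
    (compSets (edgeGraph (F.map (edgeIncl n)))).filter (n ∉ ·) =
      (compSets (edgeGraph F)).map (Finset.mapEmbedding (Function.Embedding.subtype _)).toEmbedding := by
  ext T
  rw [Finset.mem_filter, Finset.mem_map]
  constructor
  · rintro ⟨hT, hn⟩
    obtain ⟨a, rfl⟩ := mem_compSets.1 hT
    have ha : a ≠ n := fun h => hn (mem_compOf.2 (by rw [h]))
    exact ⟨_, mem_compSets.2 ⟨⟨a, ha⟩, rfl⟩, (compOf_edgeGraph_map n F ⟨a, ha⟩).symm⟩
  · rintro ⟨T', hT', rfl⟩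
    obtain ⟨i, rfl⟩ := mem_compSets.1 hT'
    change (compOf (edgeGraph F) i).map (Function.Embedding.subtype _) ∈ _ ∧
      n ∉ (compOf (edgeGraph F) i).map (Function.Embedding.subtype _)
    refine ⟨mem_compSets.2 ⟨i.1, compOf_edgeGraph_map n F i⟩, fun h => ?_⟩
    obtain ⟨j, -, hj⟩ := Finset.mem_map.1 h
    exact j.2 hj

end VertexDeletion

end

end HoroH24

namespace HoroH24

noncomputable section

open MeasureTheory

/-! ### Recursion for the arboreal partition function -/

section ArborealRecursion

variable {Λ : Type*} [Fintype Λ] [DecidableEq Λ] {β : Sym2 Λ → ℝ} {h : Λ → ℝ}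

/-- All pairs of distinct vertices. -/
def allEdges (Λ : Type*) [Fintype Λ] [DecidableEq Λ] : Finset (Sym2 Λ) := {e | ¬ e.IsDiag}

theorem mem_allEdges {i j : Λ} : s(i, j) ∈ allEdges Λ ↔ i ≠ j := by simp [allEdges]

-- Forests using a pair of weight zero contribute nothing, so the sum may run over the complete
-- graph, which behaves uniformly under vertex deletion.
open Classical in
theorem arborealZ_eq (β : Sym2 Λ → ℝ) (h : Λ → ℝ) :
    arborealZ β h = ∑ F ∈ (allEdges Λ).powerset, if (edgeGraph F).IsAcyclic then
      (∏ e ∈ F, β e) * ∏ T ∈ compSets (edgeGraph F), (1 + ∑ i ∈ T, h i) else 0 := by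
  have e0 : arborealZ β h = ∑ F ∈ (weightGraph β).edgeFinset.powerset,
      if (edgeGraph F).IsAcyclic then
      (∏ e ∈ F, β e) * ∏ T ∈ compSets (edgeGraph F), (1 + ∑ i ∈ T, h i) else 0 := by
    rw [arborealZ, Finset.sum_filter]
    refine (Finset.sum_nbij (fun F : Finset (Sym2 Λ) => (F : Set (Sym2 Λ))) ?_
      Finset.coe_injective.injOn ?_ fun F _ => ?_).symm
    · intro F hF
      simpa using hF
    · intro F hF
      simpa using hF
    · rw [← prod_connectedComponent (edgeGraph F) fun T => 1 + ∑ i ∈ T, h i, Finset.toFinset_coe]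
      unfold edgeGraph
      congr!
  rw [e0]
  have hsub : (weightGraph β).edgeFinset ⊆ allEdges Λ := by
    intro e he
    rw [SimpleGraph.mem_edgeFinset] at he
    simpa [allEdges] using (weightGraph β).not_isDiag_of_mem_edgeSet he
  refine Finset.sum_subset (Finset.powerset_mono.2 hsub) fun F hF hF' => ?_
  rw [Finset.mem_powerset] at hF hF'
  obtain ⟨e, he, he'⟩ := Finset.not_subset.1 hF'
  have hd := hF he
  have h0 : β e = 0 := by
    by_contra hne
    refine he' ?_
    rw [SimpleGraph.mem_edgeFinset, weightGraph, SimpleGraph.edgeSet_fromEdgeSet]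
    refine ⟨hne, ?_⟩
    simpa [allEdges] using hd
  rw [Finset.prod_eq_zero he h0, zero_mul, ite_self]

theorem allEdges_eq_union (n : Λ) : allEdges Λ = (allEdges {j // j ≠ n}).map (edgeIncl n) ∪
    (Finset.univ.erase n).image fun i => s(n, i) := by
  ext e
  induction e using Sym2.ind with
  | _ i j =>
    rw [mem_allEdges, Finset.mem_union, Finset.mem_map, Finset.mem_image]
    constructor
    · intro hij
      by_cases hi : i = n
      · exact Or.inr ⟨j, Finset.mem_erase.2 ⟨fun h => hij (hi.trans h.symm), Finset.mem_univ _⟩,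
          by rw [hi]⟩
      by_cases hj : j = n
      · exact Or.inr ⟨i, Finset.mem_erase.2 ⟨hi, Finset.mem_univ _⟩, by rw [hj, Sym2.eq_swap]⟩
      · exact Or.inl ⟨s(⟨i, hi⟩, ⟨j, hj⟩), mem_allEdges.2 fun h => hij (Subtype.ext_iff.1 h), rfl⟩
    · rintro (⟨e, he, hej⟩ | ⟨k, hk, hkj⟩)
      · induction e using Sym2.ind with
        | _ a b =>
          rw [edgeIncl_mk] at hej
          rw [← mem_allEdges, ← hej, mem_allEdges]
          exact fun h => mem_allEdges.1 he (Subtype.ext h)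
      · rw [← mem_allEdges, ← hkj, mem_allEdges]
        exact (Finset.mem_erase.1 hk).1.symm

omit [Fintype Λ] [DecidableEq Λ] in
theorem notMem_map_edgeIncl (n : Λ) (F : Finset (Sym2 {j // j ≠ n})) (i : Λ) :
    s(n, i) ∉ F.map (edgeIncl n) := by
  rw [Finset.mem_map]
  rintro ⟨e, -, he⟩
  induction e using Sym2.ind with
  | _ a b =>
    rw [edgeIncl_mk] at he
    have hn : n ∈ s(a.1, b.1) := he ▸ Sym2.mem_mk_left n i
    rw [Sym2.mem_iff] at hn
    exact hn.elim (fun h => a.2 h.symm) fun h => b.2 h.symm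

/-- The forests of the complete graph, with the tree of `n` not weighted, give the partition
function on the other vertices. -/
theorem sum_rootedTerm (β : Sym2 Λ → ℝ) (h : Λ → ℝ) (n : Λ) :
    ∑ F ∈ (allEdges Λ).powerset, rootedTerm β n (fun T => 1 + ∑ i ∈ T, h i) F =
      arborealZ (subWeight β n) (subVec n h + edgeWeight β n) := by
  classical
  have hd : Disjoint ((allEdges {j // j ≠ n}).map (edgeIncl n))
      ((Finset.univ.erase n).image fun i => s(n, i)) := by
    rw [Finset.disjoint_right]
    intro e he
    obtain ⟨i, -, rfl⟩ := Finset.mem_image.1 he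
    exact notMem_map_edgeIncl n _ i
  rw [allEdges_eq_union n, sum_powerset_union hd, arborealZ_eq, Finset.map_eq_image,
    Finset.powerset_image, Finset.sum_image (Finset.image_injective (edgeIncl n).injective).injOn]
  refine Finset.sum_congr rfl fun F _ => ?_
  rw [← Finset.map_eq_image]
  rw [sum_rootedTerm_star β n _ _ _ fun i hi =>
    ⟨(Finset.mem_erase.1 hi).1, notMem_map_edgeIncl n F i⟩, rootedTerm, compSets_edgeGraph_map,
    Finset.prod_map, Finset.prod_map, edgeGraph_map_isAcyclic]
  -- A tree avoiding n either stays separate, with weight 1 + Σh, or is attached to n by exactly one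
  -- edge; the edge weights thus act as additional external fields.
  have hT : ∀ T : Finset {j // j ≠ n}, (1 + ∑ i ∈ T.map (Function.Embedding.subtype _), h i) +
      (∑ i ∈ Finset.univ.erase n, if i ∈ T.map (Function.Embedding.subtype _) then β s(n, i)
        else 0) = 1 + ∑ i ∈ T, (subVec n h + edgeWeight β n) i := by
    intro T
    rw [← Finset.sum_filter, Finset.filter_mem_eq_inter, Finset.inter_eq_right.2, Finset.sum_map,
      Finset.sum_map, add_assoc, ← Finset.sum_add_distrib]
    · rfl
    · intro i hi
      obtain ⟨j, -, rfl⟩ := Finset.mem_map.1 hi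
      exact Finset.mem_erase.2 ⟨j.2, Finset.mem_univ _⟩
  congr 1
  congr 1
  exact Finset.prod_congr rfl fun T _ => hT T

/-- At h = 0 all tree weights are 1, so leaving the tree of n unweighted changes nothing. -/
theorem arborealZ_zero (β : Sym2 Λ → ℝ) (n : Λ) :
    arborealZ β 0 = arborealZ (subWeight β n) (edgeWeight β n) := by
  have e := sum_rootedTerm β 0 n
  have h0 : subVec n (0 : Λ → ℝ) = 0 := rfl
  rw [h0, zero_add] at e
  rw [← e, arborealZ_eq]
  refine Finset.sum_congr rfl fun F _ => ?_
  simp [rootedTerm]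

/-- Only the tree of n contains h_n; the coefficient of h_n is the forest sum with that tree
unweighted, evaluated by `sum_rootedTerm`. -/
theorem arborealZ_update (β : Sym2 Λ → ℝ) (h : Λ → ℝ) (n : Λ) :
    arborealZ β h = arborealZ β (Function.update h n 0) +
      h n * arborealZ (subWeight β n) (subVec n h + edgeWeight β n) := by
  classical
  rw [← sum_rootedTerm, arborealZ_eq, arborealZ_eq, Finset.mul_sum, ← Finset.sum_add_distrib]
  refine Finset.sum_congr rfl fun F _ => ?_
  rw [rootedTerm]
  split_ifs with hF
  swap
  · simp
  have hmem : compOf (edgeGraph F) n ∈ compSets (edgeGraph F) := mem_compSets.2 ⟨n, rfl⟩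
  have e : (compSets (edgeGraph F)).filter (n ∉ ·) =
      (compSets (edgeGraph F)).erase (compOf (edgeGraph F) n) := by
    ext T
    rw [Finset.mem_filter, Finset.mem_erase, and_comm]
    exact and_congr_left fun hT => ⟨fun hn hh => hn (hh ▸ self_mem_compOf n),
      fun hne hn => hne (eq_compOf_of_mem hT hn)⟩
  have h1 : ∑ i ∈ compOf (edgeGraph F) n, h i =
      ∑ i ∈ compOf (edgeGraph F) n, Function.update h n 0 i + h n := by
    rw [← Finset.add_sum_erase _ _ (self_mem_compOf n),
      ← Finset.add_sum_erase _ (Function.update h n 0) (self_mem_compOf n), Function.update_self,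
      zero_add, add_comm]
    congr 1
    exact Finset.sum_congr rfl fun i hi => (Function.update_of_ne (Finset.ne_of_mem_erase hi) _ _).symm
  have h2 : ∏ T ∈ (compSets (edgeGraph F)).erase (compOf (edgeGraph F) n),
      (1 + ∑ i ∈ T, Function.update h n 0 i) =
      ∏ T ∈ (compSets (edgeGraph F)).erase (compOf (edgeGraph F) n), (1 + ∑ i ∈ T, h i) := by
    rw [← e]
    refine Finset.prod_congr rfl fun T hT => ?_
    congr 1
    refine Finset.sum_congr rfl fun i hi => Function.update_of_ne ?_ _ _
    rintro rfl
    exact (Finset.mem_filter.1 hT).2 hi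
  rw [e, ← Finset.mul_prod_erase _ _ hmem, ← Finset.mul_prod_erase _ _ hmem, h2, h1]
  ring

theorem arborealZ_nonneg (hβ : ∀ e, 0 ≤ β e) (hh : ∀ i, 0 ≤ h i) : 0 ≤ arborealZ β h := by
  refine Finset.sum_nonneg fun F _ => mul_nonneg (Finset.prod_nonneg fun e _ => hβ e)
    (Finset.prod_nonneg fun T _ => add_nonneg zero_le_one (Finset.sum_nonneg fun i _ => hh i))

theorem arborealZ_of_isEmpty [IsEmpty Λ] : arborealZ β h = 1 := by
  have e : allEdges Λ = ∅ := Finset.eq_empty_of_isEmpty _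
  have e' : compSets (edgeGraph (∅ : Finset (Sym2 Λ))) = ∅ :=
    Finset.eq_empty_of_forall_notMem fun T hT => isEmptyElim (mem_compSets.1 hT).choose
  have ha : (edgeGraph (∅ : Finset (Sym2 Λ))).IsAcyclic := .of_subsingleton
  rw [arborealZ_eq, e, Finset.powerset_empty, Finset.sum_singleton, if_pos ha, e']
  simp

end ArborealRecursion

/-! ### Evaluation of the partition function -/

section PartitionFunction

/-- The exponent of the normalisation of `psi`. -/
def edgeMass {Λ : Type*} [Fintype Λ] (β : Sym2 Λ → ℝ) : ℝ :=
  (1 / 2) * (∑ i, ∑ j, β s(i, j) - ∑ i, β s(i, i))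

theorem edgeMass_eq {Λ : Type*} [Fintype Λ] [DecidableEq Λ] (β : Sym2 Λ → ℝ) (n : Λ) :
    edgeMass β = edgeMass (subWeight β n) + ∑ j, edgeWeight β n j := by
  rw [edgeMass, edgeMass, Fintype.sum_eq_add_sum_subtype_ne _ n,
    Fintype.sum_eq_add_sum_subtype_ne (fun j => β s(n, j)) n,
    Fintype.sum_eq_add_sum_subtype_ne (fun i => β s(i, i)) n]
  have e : ∀ i : {j // j ≠ n}, ∑ j, β s(i.1, j) = edgeWeight β n i +
      ∑ j, subWeight β n s(i, j) := fun i => by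
    rw [Fintype.sum_eq_add_sum_subtype_ne _ n, edgeWeight, Sym2.eq_swap]
    rfl
  simp only [e, Finset.sum_add_distrib]
  have e2 : ∑ i : {j // j ≠ n}, β s(i.1, i.1) = ∑ i, subWeight β n s(i, i) := rfl
  have e3 : ∑ i : {j // j ≠ n}, β s(n, i.1) = ∑ i, edgeWeight β n i := rfl
  rw [e2, e3]
  ring

theorem psi_of_isEmpty {Λ : Type*} [Fintype Λ] [DecidableEq Λ] [IsEmpty Λ] (β : Sym2 Λ → ℝ)
    (h : Λ → ℝ) : psi β h = 1 := by
  have hP : ∀ b : Λ → ℝ, (coupMat β b).PosDef := fun b =>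
    Matrix.PosDef.of_dotProduct_mulVec_pos (isHermitian_coupMat b)
      fun v hv => absurd (Subsingleton.elim v 0) hv
  have e : psiDensity β h = fun _ => 1 := by
    funext b
    rw [psiDensity, Set.indicator_of_mem (show b ∈ {b | (coupMat β b).PosDef} from hP b)]
    simp [dotProduct]
  rw [psi, e, lintegral_one, volume_pi, Measure.pi_univ]
  simp

/-- Induction on the number of vertices and, within it, on the number of vertices with h ≠ 0. No
connectedness or positivity of h is required, since vertex deletion would not preserve them; `psi`
remains meaningful because it is an integral over the positive definite cone. -/
theorem exp_mul_psi (k : ℕ) : ∀ {Λ : Type*} [Fintype Λ] [DecidableEq Λ] (β : Sym2 Λ → ℝ)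
    (h : Λ → ℝ), Fintype.card Λ = k → (∀ e, 0 ≤ β e) → (∀ i, 0 ≤ h i) →
    ENNReal.ofReal (Real.exp (edgeMass β + ∑ i, h i)) * psi β h =
      ENNReal.ofReal (√(2 * Real.pi) ^ k * arborealZ β h) := by
  induction k with
  | zero =>
    intro Λ _ _ β h hk hβ hh
    have : IsEmpty Λ := Fintype.card_eq_zero_iff.1 hk
    rw [psi_of_isEmpty, arborealZ_of_isEmpty]
    simp [edgeMass]
  | succ k ih =>
    intro Λ _ _ β h hk hβ hh
    have hcard : ∀ n : Λ, Fintype.card {j // j ≠ n} = k := fun n => by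
      rw [Fintype.card_subtype_compl, Fintype.card_subtype_eq, hk, Nat.add_sub_cancel]
    have hk0 : ∀ n j, 0 ≤ edgeWeight β n j := fun n j => hβ _
    generalize hs : (Finset.univ.filter fun i => h i ≠ 0).card = m
    induction m generalizing h with
    | zero =>
      have h0 : h = 0 := by
        funext i
        have := Finset.card_eq_zero.1 hs
        by_contra hi
        have hmem : i ∈ Finset.univ.filter fun i => h i ≠ 0 := by simpa using hi
        rw [this] at hmem
        simp at hmem
      obtain ⟨n⟩ : Nonempty Λ := Fintype.card_pos_iff.1 (by omega)
      subst h0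
      have h1 := ih (subWeight β n) (edgeWeight β n) (hcard n) (subWeight_nonneg hβ n) (hk0 n)
      rw [psi_zero hβ n, arborealZ_zero β n, edgeMass_eq β n, mul_left_comm]
      simp only [Pi.zero_apply, Finset.sum_const_zero, add_zero]
      rw [h1, ← ENNReal.ofReal_mul (Real.sqrt_nonneg _), pow_succ']
      congr 1
      ring
    | succ m ihm =>
      obtain ⟨n, hn⟩ : (Finset.univ.filter fun i => h i ≠ 0).Nonempty :=
        Finset.card_pos.1 (by omega)
      have hh0 : ∀ i, 0 ≤ Function.update h n 0 i := fun i => by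
        by_cases hi : i = n
        · simp [hi]
        · simp [hi, hh i]
      have hcm : (Finset.univ.filter fun i => Function.update h n 0 i ≠ 0).card = m := by
        have e : (Finset.univ.filter fun i => Function.update h n 0 i ≠ 0) =
            (Finset.univ.filter fun i => h i ≠ 0).erase n := by
          ext i
          by_cases hi : i = n
          · simp [hi]
          · simp [hi]
        rw [e, Finset.card_erase_of_mem hn, hs, Nat.add_sub_cancel]
      have hs0 : ∀ j, 0 ≤ (subVec n h + edgeWeight β n) j := fun j => add_nonneg (hh _) (hk0 n j)
      have h1 := ihm (Function.update h n 0) hh0 hcm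
      have h2 := ih (subWeight β n) (subVec n h + edgeWeight β n) (hcard n)
        (subWeight_nonneg hβ n) hs0
      have hsum : ∑ i, h i = h n + ∑ j, subVec n h j := Fintype.sum_eq_add_sum_subtype_ne _ n
      have hsum0 : ∑ i, Function.update h n 0 i = ∑ j, subVec n h j := by
        rw [Fintype.sum_eq_add_sum_subtype_ne _ n, Function.update_self, zero_add]
        exact Finset.sum_congr rfl fun j _ => Function.update_of_ne j.2 _ _
      set c := edgeMass β + ∑ j, subVec n h j with hc
      -- The mass of the edges at n moves from `edgeMass` into the field, so all three exponentials
      -- have the same exponent up to h_n.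
      have hc2 : edgeMass (subWeight β n) + ∑ j, (subVec n h + edgeWeight β n) j = c := by
        rw [hc, edgeMass_eq β n]
        simp only [Pi.add_apply, Finset.sum_add_distrib]
        ring
      rw [hsum0] at h1
      rw [hc2] at h2
      rw [hsum, show edgeMass β + (h n + ∑ j, subVec n h j) = c + h n by rw [hc]; ring,
        Real.exp_add, ENNReal.ofReal_mul (Real.exp_pos _).le, mul_assoc, psi_update hβ hh n,
        mul_add, h1, mul_left_comm, h2, ← ENNReal.ofReal_mul (mul_nonneg (Real.sqrt_nonneg _) (hh n)),
        ← ENNReal.ofReal_add (mul_nonneg (by positivity) (arborealZ_nonneg hβ hh0))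
          (mul_nonneg (mul_nonneg (Real.sqrt_nonneg _) (hh n)) (mul_nonneg (by positivity)
            (arborealZ_nonneg (subWeight_nonneg hβ n) hs0))), arborealZ_update β h n]
      congr 1
      ring

variable {Λ : Type*} [Fintype Λ] [DecidableEq Λ] {β : Sym2 Λ → ℝ} {h : Λ → ℝ}

theorem lintegral_exp_neg_horoT_eq (hβ : ∀ e, 0 ≤ β e) (hh : ∀ i, 0 ≤ h i)
    (hconn : (weightGraph β).Connected) (hpos : ∃ i, 0 < h i) :
    ∫⁻ t, ENNReal.ofReal (Real.exp (-horoT β h t)) =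
      ENNReal.ofReal (√(2 * Real.pi) ^ Fintype.card Λ * arborealZ β h) := by
  rw [lintegral_exp_neg_horoT hβ hh hconn hpos]
  exact exp_mul_psi _ β h rfl hβ hh

theorem continuous_exp_neg_horoT (hβ : ∀ e, 0 ≤ β e) (hh : ∀ i, 0 ≤ h i)
    (hconn : (weightGraph β).Connected) (hpos : ∃ i, 0 < h i) :
    Continuous fun t => Real.exp (-horoT β h t) := by
  simp only [exp_neg_horoT hβ hh hconn hpos]
  have h1 : Continuous fun t : Λ → ℝ => horoRest β h t 0 :=
    (continuous_horoRest (β := β) (h := h)).comp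
      (f := fun t : Λ → ℝ => (t, (0 : Λ → ℝ))) (by fun_prop)
  have h2 := (continuous_horoMat (β := β) (h := h)).matrix_det
  exact h1.neg.rexp.mul (h2.mul h2.sqrt)

theorem integrable_exp_neg_horoT (hβ : ∀ e, 0 ≤ β e) (hh : ∀ i, 0 ≤ h i)
    (hconn : (weightGraph β).Connected) (hpos : ∃ i, 0 < h i) :
    Integrable fun t => Real.exp (-horoT β h t) := by
  refine ⟨(continuous_exp_neg_horoT hβ hh hconn hpos).aestronglyMeasurable, ?_⟩
  rw [hasFiniteIntegral_iff_ofReal (Filter.Eventually.of_forall fun t => (Real.exp_pos _).le),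
    lintegral_exp_neg_horoT_eq hβ hh hconn hpos]
  exact ENNReal.ofReal_lt_top

theorem integral_exp_neg_horoT (hβ : ∀ e, 0 ≤ β e) (hh : ∀ i, 0 ≤ h i)
    (hconn : (weightGraph β).Connected) (hpos : ∃ i, 0 < h i) :
    ∫ t, Real.exp (-horoT β h t) = √(2 * Real.pi) ^ Fintype.card Λ * arborealZ β h := by
  rw [integral_eq_lintegral_of_nonneg_ae (Filter.Eventually.of_forall fun t => (Real.exp_pos _).le)
    (continuous_exp_neg_horoT hβ hh hconn hpos).aestronglyMeasurable,
    lintegral_exp_neg_horoT_eq hβ hh hconn hpos, ENNReal.toReal_ofReal]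
  exact mul_nonneg (by positivity) (arborealZ_nonneg hβ hh)

theorem expect_one (hβ : ∀ e, 0 ≤ β e) (hh : ∀ i, 0 ≤ h i)
    (hconn : (weightGraph β).Connected) (hpos : ∃ i, 0 < h i) :
    expect β h (fun _ => 1) = arborealZ β h := by
  rw [expect_eq_integral_horoT hβ hh hconn hpos (fun _ => 1) (fun _ => 1) continuous_const
    (fun y R => ?_) (integrable_integrand_one hβ hh hconn hpos)
    (by simpa using integrable_exp_neg_horoT hβ hh hconn hpos)]
  · simp only [one_mul]
    rw [integral_mul_const, integral_exp_neg_horoT hβ hh hconn hpos, mul_right_comm,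
      mul_inv_cancel₀ (by positivity), one_mul]
  · simpa using isJet_const (β := β) (ContinuousMap.const (Metric.closedBall (0 : Λ → ℝ) R) (1 : ℝ))

end PartitionFunction

end

end HoroH24

theorem mainTheorem6 {Λ : Type*} [Fintype Λ] [DecidableEq Λ]
    (β : Sym2 Λ → ℝ) (h : Λ → ℝ)
    (hβ : ∀ e, 0 ≤ β e) (hh : ∀ i, 0 ≤ h i)
    (hconn : (HoroH24.weightGraph β).Connected) (hpos : ∃ i, 0 < h i) :
    (∀ F : (Λ ⊕ Λ → ℝ) → ℝ, ContDiff ℝ ∞ F →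
      MeasureTheory.Integrable (HoroH24.integrand β h (HoroH24.obsTS F)) →
      MeasureTheory.Integrable (fun q : (Λ → ℝ) × (Λ → ℝ) =>
        F (Sum.elim (fun i => Real.exp (q.1 i)) (fun i => Real.exp (q.1 i) * q.2 i)) *
          Real.exp (-HoroH24.horoTS β h q.1 q.2)) →
      HoroH24.expect β h (HoroH24.obsTS F) =
        ∫ q : (Λ → ℝ) × (Λ → ℝ),
          F (Sum.elim (fun i => Real.exp (q.1 i)) (fun i => Real.exp (q.1 i) * q.2 i)) *
            Real.exp (-HoroH24.horoTS β h q.1 q.2) *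
              ((2 * Real.pi) ^ Fintype.card Λ)⁻¹) ∧
    (∀ F : (Λ → ℝ) → ℝ, ContDiff ℝ ∞ F →
      MeasureTheory.Integrable (HoroH24.integrand β h (HoroH24.obsT F)) →
      MeasureTheory.Integrable (fun t : Λ → ℝ =>
        F (fun i => Real.exp (t i)) * Real.exp (-HoroH24.horoT β h t)) →
      HoroH24.expect β h (HoroH24.obsT F) =
        ∫ t : Λ → ℝ, F (fun i => Real.exp (t i)) * Real.exp (-HoroH24.horoT β h t) *
          (Real.sqrt (2 * Real.pi) ^ Fintype.card Λ)⁻¹) ∧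
    (MeasureTheory.Integrable (HoroH24.integrand β h (fun _ => 1)) ∧
      HoroH24.expect β h (fun _ => 1) = HoroH24.arborealZ β h) := by
  refine ⟨fun F hF hL hR => HoroH24.expect_obsTS hβ hh hconn hpos F hF hL hR, fun F hF hL hR => ?_,
    HoroH24.integrable_integrand_one hβ hh hconn hpos, ?_⟩
  · refine HoroH24.expect_eq_integral_horoT hβ hh hconn hpos _ F hF.continuous (fun y R => ?_) hL hR
    have : CompactSpace (Metric.closedBall (0 : Λ → ℝ) R) :=
      isCompact_iff_compactSpace.1 (isCompact_closedBall _ _)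
    exact HoroH24.isJet_obsT
      (p := fun q : Metric.closedBall (0 : Λ → ℝ) R => ((q : Λ → ℝ), y)) (by fun_prop) hF
  · exact HoroH24.expect_one hβ hh hconn hpos
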